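/- Let $n_1,n_2,\varkappa\ge 1$ be integers, write $x=(x',x'')\in\mathbb R^{n_1}\times\mathbb R^{n_2}$, let $Q=n_1+(1+\varkappa)n_2$, and let $V_\varkappa(x')$ be either $|x'|^{2\varkappa}$ or $\sum_{j=1}^{n_1}(x'_j)^{2\varkappa}$. Let $G_\varkappa=-\Delta_{x'}-V_\varkappa(x')\Delta_{x''}$ be the Grushin operator, $X=(X_j,X_{\alpha,k})$ with $X_j=\partial_{x'_j}$, $X_{\alpha,k}=(x')^{\alpha}\partial_{x''_k}$ ($1\le j\le n_1$, $1\le k\le n_2$, $\alpha\in\mathbb N^{n_1}$, $|\alpha|=\varkappa$), and $$d(x,y)=|x'-y'|+\begin{cases}\dfrac{|x''-y''|}{(|x'|+|y'|)^{\varkappa}} & \text{if } |x''-y''|^{1/(1+\varkappa)}\le |x'|+|y'|,\\[1ex] |x''-y''|^{1/(1+\varkappa)} & \text{otherwise}\end{cases}$$ (the first fraction being read as $0$ when $x'=y'=0$ and $x''=y''$), with balls $B(x,r)=\{y: d(x,y)<r\}$ and Lebesgue measure $|\cdot|$; for $B=B(c,r)$ put $sB=B(c,sr)$. For $I\subset\mathbb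 R$ an interval, let $\mathbf 1_I(G_\varkappa)$ be the bounded operator on $L^2(\mathbb R^{n_1+n_2})$ given by $$\mathbf 1_I(G_\varkappa)f(x)=\int_{\mathbb R^{n_2}}e^{-i\lambda\cdot x''}\big(\mathbf 1_I(H_\varkappa(\lambda))f^\lambda\big)(x')\,d\lambda,\qquad f^\lambda(x')=(2\pi)^{-n_2}\int_{\mathbb R^{n_2}} f(x',x'')e^{i\lambda\cdot x''}dx'',$$ for Schwartz $f$, where $\mathbf 1_I(H_\varkappa(\lambda))$ is the orthogonal projection of $L^2(\mathbb R^{n_1})$ onto the closed span of the eigenvectors of $H_\varkappa(\lambda)=-\Delta_{x'}+|\lambda|^2V_\varkappa(x')$ with eigenvalue in $I$. Put $\chi_0(G_\varkappa)=\mathbf 1_{(-\infty,1)}(G_\varkappa)$ and $\chi_j(G_\varkappa)=\mathbf 1_{[2^{j-1},2^j)}(G_\varkappa)$ for $j\ge 1$. Let $T$ be a bounded linear operator on $L^2(\mathbb R^{n_1+n_2})$ and suppose that each $T_j=T\circ\chi_j(G_\varkappa)$, $j\in\mathbb N$, has a measurable integral kernel $T_j(x,y)$ which is $C^1$ in $x$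 for almost every $y$. Suppose that for some $R_0>Q/2$ the following hold with constants independent of $j\in\mathbb N$ and $\mathfrak r\in[0,R_0]$: $$\sup_x |B(x,2^{-j/2})|\int d(x,y)^{2\mathfrak r}|T_j(x,y)|^2\,dy\lesssim_{R_0} 2^{-j\mathfrak r},$$ and, for every $\mathcal K_0>0$, $$\sup_x |B(x,2^{-j/2})|\int_{d(x,y)<\mathcal K_0} d(x,y)^{2\mathfrak r}|X_xT_j(x,y)|^2\,dy\lesssim_{R_0,\mathcal K_0} 2^{-j\mathfrak r}2^{j}.$$ Let $C_0>1$ be any constant with $d(x,y)\le C_0\,(d(x,z)+d(z,y))$ for all $x,y,z$, let $C_1\ge 1$ and $0<\delta_0<1$, and put $s=3C_1C_0^2/\delta_0$. (In particular, $\delta_0$ may be the scale ratio of a system of Christ dyadic cubes for $d$, and $C_1$ may be any constant $C_{1,\varkappa}$ such that any two points of any ball $B(x_0,r)$ can be joined by a curve inside $B(x_0,C_{1,\varkappa}r)$; such a constant is necessarily $\ge 1$.) Then there is a finite constant $C$ (depending on $T,\varkappa,n_1,n_2,s$ but not on $f$ or $x$) such that for every bounded measurable $f:\mathbb R^{n_1+n_2}\to\mathbb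 C$ with compact support, for almost every $x$, $$\mathcal M^{\#}_{T,s}f(x)\le C\,\mathcal M_2f(x),$$ where, the suprema being over all balls $B$ containing $x$, $$\mathcal M^{\#}_{T,s}f(x)=\sup_{B\ni x}\ \operatorname*{ess\,sup}_{y,z\in B}\big|T(f\chi_{\mathbb R^{n_1+n_2}\setminus sB})(y)-T(f\chi_{\mathbb R^{n_1+n_2}\setminus sB})(z)\big|,\qquad \mathcal M_2f(x)=\Big(\sup_{B\ni x}\frac1{|B|}\int_B|f|^2\Big)^{1/2}.$$ -/

import Mathlib

open MeasureTheory
open scoped ENNReal NNReal SchwartzMap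

noncomputable section

namespace Grushin

/-- The Euclidean space `ℝⁿ` with Lebesgue measure. -/
abbrev V (n : ℕ) : Type := EuclideanSpace ℝ (Fin n)

/-- Points `x = (x', x'')` of `ℝ^{n₁} × ℝ^{n₂}`, with Lebesgue measure. -/
abbrev Sp (n₁ n₂ : ℕ) : Type := V n₁ × V n₂

/-- Lebesgue measure on `ℝ^{n₁} × ℝ^{n₂}` has temperate growth, so Schwartz functions are in `L²`. -/
instance hasTemperateGrowth_volume (n₁ n₂ : ℕ) : (volume : Measure (Sp n₁ n₂)).HasTemperateGrowth := by
  have : (volume : Measure (Sp n₁ n₂)).IsAddHaarMeasure :=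
    inferInstanceAs
      ((volume : Measure (V n₁)).prod (volume : Measure (V n₂))).IsAddHaarMeasure
  infer_instance

/-- Complex `L²` spaces with respect to Lebesgue measure. -/
abbrev L2 (α : Type) [MeasureSpace α] : Type := Lp ℂ 2 (volume : Measure α)

/-- The class in `L²` of a square integrable function (and `0` for all other functions). -/
def toL2 {α : Type} [MeasureSpace α] (u : α → ℂ) : L2 α :=
  open Classical in if h : MemLp u 2 (volume : Measure α) then h.toLp u else 0

/-! ### The Grushin quasi-metric, its balls, and the horizontal gradient -/

/-- The Grushin quasi-metric `d`. -/
def dist {n₁ n₂ : ℕ} (κ : ℕ) (x y : Sp n₁ n₂) : ℝ :=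
  ‖x.1 - y.1‖ +
    if ‖x.2 - y.2‖ ^ (1 / (1 + (κ : ℝ))) ≤ ‖x.1‖ + ‖y.1‖ then
      ‖x.2 - y.2‖ / (‖x.1‖ + ‖y.1‖) ^ κ
    else ‖x.2 - y.2‖ ^ (1 / (1 + (κ : ℝ)))

/-- The ball `B(x, r) = {y : d(x, y) < r}`. -/
def ball {n₁ n₂ : ℕ} (κ : ℕ) (x : Sp n₁ n₂) (r : ℝ) : Set (Sp n₁ n₂) :=
  {y | dist κ x y < r}

/-- The homogeneous dimension `Q = n₁ + (1 + κ) n₂`. -/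
def homDim (n₁ n₂ κ : ℕ) : ℕ := n₁ + (1 + κ) * n₂

/-- `X_j u (x) = ∂u/∂x'_j (x)`. -/
def gradX' {n₁ n₂ : ℕ} (j : Fin n₁) (u : Sp n₁ n₂ → ℂ) (x : Sp n₁ n₂) : ℂ :=
  fderiv ℝ u x (EuclideanSpace.single j (1 : ℝ), 0)

/-- `X_{α,k} u (x) = (x')^α ∂u/∂x''_k (x)`. -/
def gradX'' {n₁ n₂ : ℕ} (α : Fin n₁ → ℕ) (k : Fin n₂) (u : Sp n₁ n₂ → ℂ) (x : Sp n₁ n₂) : ℂ :=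
  ((∏ i, x.1 i ^ α i : ℝ) : ℂ) * fderiv ℝ u x (0, EuclideanSpace.single k (1 : ℝ))

/-- `|X u (x)|²`, where `X = (X_j, X_{α,k})` with `1 ≤ j ≤ n₁`, `1 ≤ k ≤ n₂`, `|α| = κ`. -/
def gradSq {n₁ n₂ : ℕ} (κ : ℕ) (u : Sp n₁ n₂ → ℂ) (x : Sp n₁ n₂) : ℝ :=
  ∑ j : Fin n₁, ‖gradX' j u x‖ ^ 2 +
    ∑ α ∈ Finset.piAntidiag (Finset.univ : Finset (Fin n₁)) κ, ∑ k : Fin n₂,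
      ‖gradX'' α k u x‖ ^ 2

/-! ### The Grushin operator and its spectral projections -/

/-- The two admissible choices of the potential `V_κ`. -/
inductive PotentialType
  | radial
  | separable

/-- `V_κ(x') = |x'|^{2κ}` or `V_κ(x') = ∑ⱼ (x'_j)^{2κ}`. -/
def potential {n₁ : ℕ} (p : PotentialType) (κ : ℕ) (x' : V n₁) : ℝ :=
  match p with
  | .radial => ‖x'‖ ^ (2 * κ)
  | .separable => ∑ j, x' j ^ (2 * κ)

/-- `h ∈ L²(ℝ^{n₁})` satisfies `H_κ(lam) h = ν h` (in the sense of tempered distributions), where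
`H_κ(lam) = -Δ + |lam|² V_κ`. -/
def IsEigenvector {n₁ n₂ : ℕ} (p : PotentialType) (κ : ℕ) (lam : V n₂) (ν : ℝ)
    (h : L2 (V n₁)) : Prop :=
  ∀ φ : 𝓢(V n₁, ℂ),
    ∫ x, h x * (-(Laplacian.laplacian (φ : V n₁ → ℂ) x)
        + ((‖lam‖ ^ 2 * potential p κ x : ℝ) : ℂ) * φ x)
      = (ν : ℂ) * ∫ x, h x * φ x

/-- The spectral projection of `H_κ(lam)` for the set `I`: the orthogonal projection of
`L²(ℝ^{n₁})` onto the closed span of the eigenvectors whose eigenvalue lies in `I`. -/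
def fiberProj {n₁ n₂ : ℕ} (p : PotentialType) (κ : ℕ) (I : Set ℝ) (lam : V n₂) :
    L2 (V n₁) →L[ℂ] L2 (V n₁) :=
  (Submodule.span ℂ
    {h : L2 (V n₁) | ∃ ν ∈ I, IsEigenvector p κ lam ν h}).topologicalClosure.starProjection

/-- The partial inverse Fourier transform
`f^lam(x') = (2π)^{-n₂} ∫ f(x', x'') e^{i lam·x''} dx''`. -/
def partialFourier {n₁ n₂ : ℕ} (f : Sp n₁ n₂ → ℂ) (lam : V n₂) (x' : V n₁) : ℂ :=
  (((2 * Real.pi) ^ n₂ : ℝ) : ℂ)⁻¹ *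
    ∫ x'' : V n₂, f (x', x'') * Complex.exp (Complex.I * ((inner ℝ lam x'' : ℝ) : ℂ))

/-- `S` is the Grushin multiplier `1_I(G_κ)`: on Schwartz functions it is given by
`S f (x) = ∫ e^{-i lam·x''} (1_I(H_κ(lam)) f^lam)(x') d lam`. The identity is paired with an
arbitrary Schwartz function `g`, because `1_I(H_κ(lam)) f^lam` is only an element of `L²`. -/
def IsSpectralProjection {n₁ n₂ : ℕ} (p : PotentialType) (κ : ℕ) (I : Set ℝ)
    (S : L2 (Sp n₁ n₂) →L[ℂ] L2 (Sp n₁ n₂)) : Prop :=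
  ∀ f g : 𝓢(Sp n₁ n₂, ℂ),
    inner ℂ (g.toLp 2 volume) (S (f.toLp 2 volume)) =
      (((2 * Real.pi) ^ n₂ : ℝ) : ℂ) *
        ∫ lam : V n₂, inner ℂ (toL2 (partialFourier g lam))
          (fiberProj p κ I lam (toL2 (partialFourier f lam)))

/-- A bounded operator is determined by the formula that defines `1_I(G_κ)`. -/
theorem IsSpectralProjection.unique {n₁ n₂ : ℕ} {p : PotentialType} {κ : ℕ} {I : Set ℝ}
    {S S' : L2 (Sp n₁ n₂) →L[ℂ] L2 (Sp n₁ n₂)} (h : IsSpectralProjection p κ I S)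
    (h' : IsSpectralProjection p κ I S') : S = S' := by
  have hd : DenseRange (SchwartzMap.toLpCLM ℝ ℂ 2 (volume : Measure (Sp n₁ n₂))) :=
    SchwartzMap.denseRange_toLpCLM ENNReal.ofNat_ne_top
  apply ContinuousLinearMap.coeFn_injective
  apply hd.equalizer S.continuous S'.continuous
  funext f
  simp only [Function.comp]
  apply hd.eq_of_inner_right ℂ
  intro g
  exact (h f g).trans (h' f g).symm

/-- The spectral projection `1_I(G_κ)` of the Grushin operator `G_κ = -Δ_{x'} - V_κ(x') Δ_{x''}`:
the unique bounded operator on `L²` given by the spectral decomposition of `G_κ`. -/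
def spectralProjection {n₁ n₂ : ℕ} (p : PotentialType) (κ : ℕ) (I : Set ℝ) :
    L2 (Sp n₁ n₂) →L[ℂ] L2 (Sp n₁ n₂) :=
  open Classical in
  if h : ∃ S : L2 (Sp n₁ n₂) →L[ℂ] L2 (Sp n₁ n₂), IsSpectralProjection p κ I S
  then h.choose else 0

/-- The spectral windows: eigenvalues `< 1` for `j = 0`, and in `[2^{j-1}, 2^j)` for `j ≥ 1`. -/
def window : ℕ → Set ℝ
  | 0 => Set.Iio 1
  | j + 1 => Set.Ico (2 ^ j) (2 ^ (j + 1))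

/-- `T_j = T ∘ χ_j(G_κ)`. -/
def piece {n₁ n₂ : ℕ} (p : PotentialType) (κ : ℕ) (T : L2 (Sp n₁ n₂) →L[ℂ] L2 (Sp n₁ n₂))
    (j : ℕ) : L2 (Sp n₁ n₂) →L[ℂ] L2 (Sp n₁ n₂) :=
  T.comp (spectralProjection p κ (window j))

/-! ### Integral kernels and the weighted `L²` conditions -/

/-- `K` is an integral kernel of `S`. -/
def IsIntegralKernel {α : Type} [MeasureSpace α] (S : L2 α →L[ℂ] L2 α) (K : α → α → ℂ) : Prop :=
  Measurable (Function.uncurry K) ∧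
    ∀ f : L2 α, ∀ᵐ x, Integrable (fun y => K x y * f y) ∧ S f x = ∫ y, K x y * f y

/-- `sup_x |B(x, 2^{-j/2})| ∫ d(x,y)^{2r} |K_j(x,y)|² dy ≲ 2^{-jr}`, uniformly in `j ∈ ℕ` and
`r ∈ [0, R₀]`. -/
def KernelCondition {n₁ n₂ : ℕ} (κ : ℕ) (R₀ : ℝ) (K : ℕ → Sp n₁ n₂ → Sp n₁ n₂ → ℂ) : Prop :=
  ∃ C : ℝ≥0, ∀ r ∈ Set.Icc (0 : ℝ) R₀, ∀ (j : ℕ) (x : Sp n₁ n₂),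
    volume (ball κ x ((2 : ℝ) ^ (-(j : ℝ) / 2))) *
        ∫⁻ y, ENNReal.ofReal (dist κ x y ^ (2 * r)) * ‖K j x y‖ₑ ^ 2
      ≤ C * ENNReal.ofReal ((2 : ℝ) ^ (-(j : ℝ) * r))

/-- For every `K₀ > 0`,
`sup_x |B(x, 2^{-j/2})| ∫_{d(x,y)<K₀} d(x,y)^{2r} |X_x K_j(x,y)|² dy ≲ 2^{-jr} 2^j`, uniformly in
`j ∈ ℕ` and `r ∈ [0, R₀]`. -/
def GradientKernelCondition {n₁ n₂ : ℕ} (κ : ℕ) (R₀ : ℝ)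
    (K : ℕ → Sp n₁ n₂ → Sp n₁ n₂ → ℂ) : Prop :=
  ∀ K₀ : ℝ, 0 < K₀ → ∃ C : ℝ≥0, ∀ r ∈ Set.Icc (0 : ℝ) R₀, ∀ (j : ℕ) (x : Sp n₁ n₂),
    volume (ball κ x ((2 : ℝ) ^ (-(j : ℝ) / 2))) *
        ∫⁻ y in ball κ x K₀, ENNReal.ofReal (dist κ x y ^ (2 * r)) *
          ENNReal.ofReal (gradSq κ (fun x' => K j x' y) x)
      ≤ C * ENNReal.ofReal ((2 : ℝ) ^ (-(j : ℝ) * r) * (2 : ℝ) ^ j)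

/-! ### Maximal operators -/

/-- The uncentered maximal function `M_2 f = (M(|f|²))^{1/2}`. -/
def maximal2 {n₁ n₂ : ℕ} (κ : ℕ) (f : Sp n₁ n₂ → ℂ) (x : Sp n₁ n₂) : ℝ≥0∞ :=
  (⨆ (c : Sp n₁ n₂) (r : ℝ) (_ : 0 < r) (_ : x ∈ ball κ c r),
    (∫⁻ y in ball κ c r, ‖f y‖ₑ ^ 2) / volume (ball κ c r)) ^ (1 / 2 : ℝ)

/-- The grand maximal truncated operator
`M^#_{T,s} f(x) = sup_{B ∋ x} ess sup_{y,z ∈ B} |T(f χ_{(sB)ᶜ})(y) - T(f χ_{(sB)ᶜ})(z)|`,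
where `sB = B(c, s r)` for `B = B(c, r)`. -/
def grandMaximal {n₁ n₂ : ℕ} (κ : ℕ) (T : L2 (Sp n₁ n₂) →L[ℂ] L2 (Sp n₁ n₂)) (s : ℝ)
    (f : Sp n₁ n₂ → ℂ) (x : Sp n₁ n₂) : ℝ≥0∞ :=
  ⨆ (c : Sp n₁ n₂) (r : ℝ) (_ : 0 < r) (_ : x ∈ ball κ c r),
    essSup (fun q : Sp n₁ n₂ × Sp n₁ n₂ =>
        ‖T (toL2 ((ball κ c (s * r))ᶜ.indicator f)) q.1
          - T (toL2 ((ball κ c (s * r))ᶜ.indicator f)) q.2‖ₑ)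
      ((volume.restrict (ball κ c r)).prod (volume.restrict (ball κ c r)))

end Grushin

end

/-! Put τ_j = 2^{-j/2}, ε = R₀ - Q/2, B = B(c,r) and let F be f cut off to the complement of sB. The
spectral windows exhaust the spectrum, so T F = Σ_j T_j F in L² and, along a subsequence of partial
sums, almost everywhere. Hence |TF(y) - TF(z)| ≤ Σ_j ∫ |K_j(y,w) - K_j(z,w)| |F(w)| dw for almost
all y, z (`ae_enorm_sub_le_tsum`). It remains to bound the j-th term by a weight times M₂f(x), with
weights summable uniformly in r (`exists_lintegral_kernel_sub_le`, `tsum_pieceWeight_le`).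

If τ_j ≤ r, no cancellation is needed: Cauchy–Schwarz with the weight d(y,w)^{R₀}, the size
condition at exponent R₀ and dyadic shells around c give (τ_j/r)^ε; the shells sum because 2R₀ > Q.
If τ_j > r, then r < 1. Where d(c,w) ≥ 1 the same argument gives τ_j^ε. Where d(c,w) < 1, the points
y and z are joined by three segments of horizontal length O(r) that stay at distance O(r) from y,
and the gradient condition gives r/τ_j.

The expansion T F = Σ_j T_j F requires that the operators 1_I(G) exist (their definition falls back
to 0 otherwise) and that those of the windows sum strongly to the identity
(`tendsto_sum_spectralProjection`). Both follow from an explicit diagonalisation. A partial Fourier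
transform in x'' reduces G to the fibre operators -Δ + |λ|²V, and by homogeneity of V dilations
reduce every λ ≠ 0 to |λ| = 1. There the resolvent is compact because V is confining
(`isCompactOperator_schr_resolvent`), so an eigenbasis exists. Expansion in the dilated eigenbasis
is an isometry `decomp`, through which 1_I(G) becomes multiplication by an indicator. Since
eigenvectors are understood in the sense of distributions, their orthogonality for distinct
eigenvalues is not automatic; it rests on essential self-adjointness (`eq_zero_of_orthogonal`). -/

noncomputable section

namespace Grushin

open Filter Topology

/-! ### Form spaces and resolvents of abstract symmetric operators. -/

section FormCompletion

variable {E L : Type} [AddCommGroup E] [Module ℂ E] [NormedAddCommGroup L] [InnerProductSpace ℂ L]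

/-- A Hilbert space completion of the quadratic form `φ ↦ ⟪io φ, A φ⟫`. -/
structure FormCompletion (io A : E →ₗ[ℂ] L) where
  /-- The form space. -/
  H : Type
  [normed : NormedAddCommGroup H]
  [innerProd : InnerProductSpace ℂ H]
  [complete : CompleteSpace H]
  /-- The embedding of the core. -/
  j : E →ₗ[ℂ] H
  /-- The map of the form space to the ambient space. -/
  J : H →L[ℂ] L
  dense : DenseRange j
  J_j : ∀ φ, J (j φ) = io φ
  inner_j : ∀ φ ψ, inner ℂ (j φ) (j ψ) = inner ℂ (io φ) (A ψ)
  norm_J_le : ∀ ξ, ‖J ξ‖ ≤ ‖ξ‖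

attribute [instance] FormCompletion.normed FormCompletion.innerProd FormCompletion.complete

/-- The lower bound makes the form an inner product whose norm dominates the ambient one, so `io`
extends to the abstract completion as a contraction `J`. Injectivity of `J` is not asserted: the
later arguments do not need closability of the form. -/
theorem exists_formCompletion [CompleteSpace L] (io A : E →ₗ[ℂ] L) (hinj : Function.Injective io)
    (hsymm : ∀ φ ψ, inner ℂ (A φ) (io ψ) = inner ℂ (io φ) (A ψ))
    (hpos : ∀ φ, ‖io φ‖ ^ 2 ≤ RCLike.re (inner ℂ (io φ) (A φ))) :
    Nonempty (FormCompletion io A) := by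
  let cd : InnerProductSpace.Core ℂ E :=
    { inner := fun φ ψ => inner ℂ (io φ) (A ψ)
      conj_inner_symm := fun φ ψ => by
        rw [inner_conj_symm, hsymm]
      re_inner_nonneg := fun φ => (sq_nonneg _).trans (hpos φ)
      add_left := fun φ ψ χ => by simp only [map_add, inner_add_left]
      smul_left := fun φ ψ r => by simp only [map_smul, inner_smul_left]
      definite := fun φ h => by
        have h1 := hpos φ
        rw [show inner ℂ (io φ) (A φ) = 0 from h] at h1
        have h2 : ‖io φ‖ = 0 := by
          have : ‖io φ‖ ^ 2 ≤ 0 := by simpa using h1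
          nlinarith [norm_nonneg (io φ)]
        exact hinj (by simpa using h2) }
  let : NormedAddCommGroup E := cd.toNormedAddCommGroup
  let : InnerProductSpace ℂ E := InnerProductSpace.ofCore cd.toCore
  have hin : ∀ φ ψ : E, inner ℂ φ ψ = inner ℂ (io φ) (A ψ) := fun _ _ => rfl
  have hbd : ∀ φ : E, ‖io φ‖ ≤ 1 * ‖φ‖ := fun φ => by
    rw [one_mul]
    apply le_of_sq_le_sq _ (norm_nonneg _)
    rw [← inner_self_eq_norm_sq (𝕜 := ℂ) φ, hin]
    exact hpos φ
  let ioc : E →L[ℂ] L := io.mkContinuous 1 hbd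
  let cmp : E →L[ℂ] UniformSpace.Completion E := UniformSpace.Completion.toComplL
  have hd : DenseRange cmp := UniformSpace.Completion.denseRange_coe
  have hui : IsUniformInducing cmp := UniformSpace.Completion.isUniformInducing_coe E
  let J : UniformSpace.Completion E →L[ℂ] L := ioc.extend cmp
  have hJ : ∀ φ : E, J (cmp φ) = io φ := fun φ =>
    ContinuousLinearMap.extend_eq ioc hd hui φ
  refine ⟨{ H := UniformSpace.Completion E, j := cmp.toLinearMap, J := J, dense := hd, J_j := hJ,
            inner_j := fun φ ψ => UniformSpace.Completion.inner_coe φ ψ, norm_J_le := ?_ }⟩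
  intro ξ
  induction ξ using hd.induction_on with
  | hp => exact isClosed_le (by fun_prop) (by fun_prop)
  | ih φ =>
    rw [hJ]
    have : ‖cmp φ‖ = ‖φ‖ := UniformSpace.Completion.norm_coe φ
    rw [this]
    simpa using hbd φ

namespace FormCompletion

variable {io A : E →ₗ[ℂ] L} (F : FormCompletion io A)

theorem norm_j_sq (φ : E) : ‖F.j φ‖ ^ 2 = RCLike.re (inner ℂ (io φ) (A φ)) := by
  rw [← F.inner_j, inner_self_eq_norm_sq (𝕜 := ℂ)]

/-- By density in the first argument. A pairing with a core vector sees only the image under `J`,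
which turns identities in the form space into identities in the ambient space. -/
theorem inner_eq (ξ : F.H) (φ : E) : inner ℂ ξ (F.j φ) = inner ℂ (F.J ξ) (A φ) := by
  induction ξ using F.dense.induction_on with
  | hp => exact isClosed_eq (by fun_prop) (by fun_prop)
  | ih ψ => rw [F.inner_j, F.J_j]

/-- Riesz representation in the form space. -/
theorem exists_riesz (v : L) (C : ℝ) (hv : ∀ φ, ‖inner ℂ v (A φ)‖ ≤ C * ‖F.j φ‖) :
    ∃ ξ : F.H, ∀ φ, inner ℂ v (A φ) = inner ℂ (F.J ξ) (A φ) := by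
  let l : E →ₗ[ℂ] ℂ := (innerSL ℂ v).toLinearMap.comp A
  have hl : ∀ φ, ‖l φ‖ ≤ C * ‖F.j φ‖ := hv
  let m := l.extendOfNorm F.j
  refine ⟨(InnerProductSpace.toDual ℂ F.H).symm m, fun φ => ?_⟩
  rw [← F.inner_eq, InnerProductSpace.toDual_symm_apply]
  exact (LinearMap.extendOfNorm_eq F.dense ⟨C, hl⟩ φ).symm

/-- Duality: the hypothesis bounds the functional of `ξ` on the dense core, hence everywhere, and
testing it on `ξ` itself recovers the norm. -/
theorem norm_le_of_forall (ξ : F.H) (C : ℝ) (hC : 0 ≤ C)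
    (h : ∀ φ, ‖inner ℂ (F.J ξ) (A φ)‖ ≤ C * ‖F.j φ‖) : ‖ξ‖ ≤ C := by
  have h1 : ∀ η : F.H, ‖inner ℂ ξ η‖ ≤ C * ‖η‖ := by
    intro η
    induction η using F.dense.induction_on with
    | hp => exact isClosed_le (by fun_prop) (by fun_prop)
    | ih ψ => rw [F.inner_eq]; exact h ψ
  have h2 := h1 ξ
  rw [inner_self_eq_norm_sq_to_K] at h2
  have h3 : ‖ξ‖ * ‖ξ‖ ≤ C * ‖ξ‖ := by simpa [sq] using h2
  rcases (norm_nonneg ξ).eq_or_lt with h0 | h0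
  · rw [← h0]; exact hC
  · exact le_of_mul_le_mul_right h3 h0

variable [CompleteSpace L]

/-- The inverse of the operator attached to the form. -/
def resolvent : L →L[ℂ] L := F.J.comp F.J.adjoint

/-- The weak form of A R = 1 for R = J J*: `inner_eq` removes the outer `J`, and the adjoint moves
the inner one onto the core. -/
theorem inner_resolvent (u : L) (φ : E) :
    inner ℂ (F.resolvent u) (A φ) = inner ℂ u (io φ) := by
  rw [resolvent, ContinuousLinearMap.comp_apply, ← F.inner_eq,
    ContinuousLinearMap.adjoint_inner_left, F.J_j]

theorem resolvent_symm (u v : L) :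
    inner ℂ (F.resolvent u) v = inner ℂ u (F.resolvent v) := by
  simp only [resolvent, ContinuousLinearMap.comp_apply]
  rw [← ContinuousLinearMap.adjoint_inner_right, ContinuousLinearMap.adjoint_inner_left]

/-- Since R = J J*, compactness of `J` is enough, and `J` is a norm limit of the compact operators K
∘ J: by hypothesis K approximates the identity up to `ε` in the form norm. -/
theorem isCompactOperator_resolvent
    (h : ∀ ε > 0, ∃ K : L →L[ℂ] L, IsCompactOperator K ∧
      ∀ φ, ‖io φ - K (io φ)‖ ≤ ε * ‖F.j φ‖) : IsCompactOperator F.resolvent := by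
  have hJ : IsCompactOperator F.J := by
    choose! K hK hK' using h
    let u : ℕ → ℝ := fun n => 1 / ((n : ℝ) + 1)
    have hu : ∀ n, 0 < u n := fun n => by positivity
    refine isCompactOperator_of_tendsto (l := atTop)
      (F := fun n : ℕ => (K (u n)).comp F.J) (f := F.J) ?_
      (Eventually.of_forall fun n => (hK _ (hu n)).comp_clm F.J)
    rw [tendsto_iff_norm_sub_tendsto_zero]
    refine squeeze_zero (fun _ => norm_nonneg _) (fun n => ?_)
      tendsto_one_div_add_atTop_nhds_zero_nat
    refine ContinuousLinearMap.opNorm_le_bound _ (hu n).le fun ξ => ?_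
    induction ξ using F.dense.induction_on with
    | hp => exact isClosed_le (by fun_prop) (by fun_prop)
    | ih φ =>
      have := hK' (u n) (hu n) φ
      rw [norm_sub_rev] at this
      simpa only [sub_apply, ContinuousLinearMap.comp_apply, F.J_j] using this
  exact hJ.comp_clm F.J.adjoint

end FormCompletion

end FormCompletion

/-! ### A class of compact integral operators. -/

section Compact

/-- The integral operator `f ↦ b ⟪E ·, f⟫` with `b ∈ L²` and `E` bounded is compact. -/
theorem exists_isCompactOperator {X : Type} [MeasureSpace X] {L : Type} [NormedAddCommGroup L]
    [InnerProductSpace ℂ L] [CompleteSpace L] [SecondCountableTopology L] (b : X → ℂ)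
    (hb : MemLp b 2 (volume : Measure X)) (E : X → L) (C : ℝ) (hE : ∀ x, ‖E x‖ ≤ C)
    (hm : ∀ f, AEStronglyMeasurable (fun x => inner ℂ (E x) f) (volume : Measure X)) :
    ∃ N : L →L[ℂ] L2 X, IsCompactOperator N ∧ ∀ f, N f =ᵐ[volume] fun x => b x * inner ℂ (E x) f := by
  have hin : ∀ f x, ‖inner ℂ (E x) f‖ ≤ C * ‖f‖ := fun f x =>
    (norm_inner_le_norm _ _).trans (by gcongr; exact hE x)
  have hmem : ∀ f, MemLp (fun x => b x * inner ℂ (E x) f) 2 (volume : Measure X) := fun f =>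
    MemLp.of_le_mul (c := C * ‖f‖) hb (hb.1.mul (hm f)) (Eventually.of_forall fun x => by
      rw [norm_mul, mul_comm]
      gcongr
      exact hin f x)
  let N₀ : L →ₗ[ℂ] L2 X :=
    { toFun := fun f => (hmem f).toLp
      map_add' := fun f g => by
        rw [← MemLp.toLp_add]
        congr 1
        ext x
        simp [mul_add]
      map_smul' := fun c f => by
        rw [RingHom.id_apply, ← MemLp.toLp_const_smul]
        congr 1
        ext x
        simp
        ring }
  have hN₀ : ∀ f, N₀ f =ᵐ[volume] fun x => b x * inner ℂ (E x) f := fun f => (hmem f).coeFn_toLp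
  have hnorm : ∀ f, ‖N₀ f‖ ≤ (C * ‖hb.toLp‖) * ‖f‖ := fun f => by
    rw [mul_right_comm]
    refine Lp.norm_le_mul_norm_of_ae_le_mul ?_
    filter_upwards [hN₀ f, hb.coeFn_toLp] with x h1 h2
    rw [h1, h2, norm_mul, mul_comm]
    gcongr
    exact hin f x
  refine ⟨N₀.mkContinuous _ hnorm, ?_, hN₀⟩
  set N := N₀.mkContinuous _ hnorm
  refine (isCompactOperator_iff_isCompact_closure_image_closedBall (N : L →ₗ[ℂ] L2 X)
    zero_lt_one).mpr ?_
  suffices h : IsSeqCompact (N '' Metric.closedBall (0 : L) 1) from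
    h.isCompact.closure
  intro y hy
  choose f hf hfy using hy
  -- The unit ball is weakly sequentially compact: the vectors are read as functionals, weak-*
  -- compactness is applied, and the limit functional comes back as a vector `g` by Riesz.
  obtain ⟨φ, hφ, σ, hσ, hlim⟩ := WeakDual.isSeqCompact_closedBall ℂ L 0 1
    (x := fun n => StrongDual.toWeakDual (InnerProductSpace.toDual ℂ L (f n))) (fun n => by
      simpa using hf n)
  obtain ⟨g, hg⟩ := (InnerProductSpace.toDual ℂ L).surjective (WeakDual.toStrongDual φ)
  have hg1 : ‖g‖ ≤ 1 := by
    rw [← LinearIsometryEquiv.norm_map (InnerProductSpace.toDual ℂ L), hg]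
    simpa using hφ
  have hw : ∀ v, Tendsto (fun n => inner ℂ v (f (σ n))) atTop (𝓝 (inner ℂ v g)) := by
    intro v
    have h1 : Tendsto (fun n => inner ℂ (f (σ n)) v) atTop (𝓝 (inner ℂ g v)) := by
      have h2 := ((WeakDual.eval_continuous v).tendsto φ).comp hlim
      have h3 : inner ℂ g v = φ v := by
        rw [← InnerProductSpace.toDual_apply_apply, hg]; rfl
      rw [h3]
      exact h2
    have := (Complex.continuous_conj.tendsto _).comp h1
    simpa [Function.comp_def, inner_conj_symm] using this
  refine ⟨N g, ⟨g, by simpa using hg1, rfl⟩, σ, hσ, ?_⟩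
  have hfy' : ∀ n, y (σ n) = N (f (σ n)) := fun n => (hfy _).symm
  simp only [Function.comp_def, hfy']
  rw [tendsto_iff_edist_tendsto_0]
  have hd : ∀ n, edist (N (f (σ n))) (N g) =
      (∫⁻ x, ‖b x * inner ℂ (E x) (f (σ n)) - b x * inner ℂ (E x) g‖ₑ ^ 2) ^ (1 / 2 : ℝ) := by
    intro n
    rw [Lp.edist_def, eLpNorm_eq_lintegral_rpow_enorm_toReal (by norm_num) (by norm_num)]
    congr 1
    refine lintegral_congr_ae ?_
    filter_upwards [hN₀ (f (σ n)), hN₀ g] with x h1 h2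
    have h1' : N (f (σ n)) x = b x * inner ℂ (E x) (f (σ n)) := h1
    have h2' : N g x = b x * inner ℂ (E x) g := h2
    simp [h1', h2']
  simp only [hd]
  have hz : (0 : ℝ≥0∞) = 0 ^ (1 / 2 : ℝ) := by simp
  rw [hz]
  refine (ENNReal.continuous_rpow_const.tendsto _).comp ?_
  -- The sign of `C` is known only if `X` has a point at which to evaluate `hE`.
  have hC : 0 ≤ C * 2 ∨ IsEmpty X := by
    by_cases hX : Nonempty X
    · obtain ⟨x⟩ := hX
      left
      have := (norm_nonneg _).trans (hE x)
      positivity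
    · exact Or.inr (not_nonempty_iff.mp hX)
  rw [show (0 : ℝ≥0∞) = ∫⁻ _ : X, 0 by simp]
  -- Weak convergence gives pointwise convergence of the integrand; as all vectors lie in the unit
  -- ball, 2C|b| dominates the differences.
  refine tendsto_lintegral_of_dominated_convergence' (fun x => ‖b x * ((C * 2 : ℝ) : ℂ)‖ₑ ^ 2) ?_ ?_ ?_ ?_
  · intro n
    exact (((hb.1.mul (hm _)).sub (hb.1.mul (hm _))).enorm).pow_const 2
  · intro n
    refine Eventually.of_forall fun x => ?_
    simp only
    gcongr
    rw [enorm_le_iff_norm_le, ← mul_sub, norm_mul, norm_mul]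
    gcongr
    rw [← inner_sub_right]
    rcases hC with hC | hC
    · rw [Complex.norm_real, Real.norm_of_nonneg hC]
      refine (hin _ _).trans ?_
      have h1 : ‖f (σ n) - g‖ ≤ 2 := by
        have : ‖f (σ n)‖ ≤ 1 := by simpa using hf (σ n)
        linarith [norm_sub_le (f (σ n)) g]
      have hC' : 0 ≤ C := by linarith
      gcongr
    · exact hC.elim x
  · have h2 : MemLp (fun x => b x * ((C * 2 : ℝ) : ℂ)) 2 (volume : Measure X) := by
      simpa [mul_comm] using hb.const_mul ((C * 2 : ℝ) : ℂ)
    have := h2.eLpNorm_lt_top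
    rw [eLpNorm_lt_top_iff_lintegral_rpow_enorm_lt_top (by norm_num) (by norm_num)] at this
    simpa using this.ne
  · refine Eventually.of_forall fun x => ?_
    have h1 : Tendsto (fun n => b x * inner ℂ (E x) (f (σ n)) - b x * inner ℂ (E x) g) atTop (𝓝 0) := by
      have := ((hw (E x)).const_mul (b x)).sub_const (b x * inner ℂ (E x) g)
      simpa using this
    have := ((ENNReal.continuous_pow 2).tendsto _).comp h1.enorm
    simpa [Function.comp_def] using this

end Compact

/-! ### Eigenbases of compact self-adjoint operators. -/

section Eigenbasis

/-- An injective compact self-adjoint operator on a separable Hilbert space has a countable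
Hilbert basis of eigenvectors with real nonzero eigenvalues. -/
theorem exists_hilbertBasis_eigenvectors {L : Type} [NormedAddCommGroup L]
    [InnerProductSpace ℂ L] [CompleteSpace L] [SecondCountableTopology L] (R : L →L[ℂ] L)
    (hR : IsCompactOperator R) (hsymm : ∀ u v, inner ℂ (R u) v = inner ℂ u (R v))
    (hinj : ∀ u, R u = 0 → u = 0) :
    ∃ (ι : Type) (_ : Countable ι) (b : HilbertBasis ι ℂ L) (μ : ι → ℝ),
      ∀ i, μ i ≠ 0 ∧ R (b i) = (μ i : ℂ) • b i := by
  classical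
  have hs : (R : L →ₗ[ℂ] L).IsSymmetric := hsymm
  let V : ℂ → Submodule ℂ L := fun μ => Module.End.eigenspace (R : L →ₗ[ℂ] L) μ
  have hV : OrthogonalFamily ℂ (fun μ => V μ) fun μ => (V μ).subtypeₗᵢ :=
    hs.orthogonalFamily_eigenspaces
  have hcl : ∀ μ, CompleteSpace (V μ) := fun μ => by
    have : IsClosed (V μ : Set L) := by
      have h1 : (V μ : Set L) = {x | R x = μ • x} := by
        ext x
        exact Module.End.mem_eigenspace_iff
      rw [h1]
      exact isClosed_eq (by fun_prop) (by fun_prop)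
    exact this.completeSpace_coe
  -- All complex `μ` are allowed: the trivial eigenspaces contribute empty bases.
  choose w b hb using fun μ => exists_hilbertBasis ℂ (V μ)
  let v : (Σ μ : ℂ, w μ) → L := fun a => ((b a.1 a.2 : V a.1) : L)
  have hv : Orthonormal ℂ v := hV.orthonormal_sigma_orthonormal (fun μ => (b μ).orthonormal)
  have hsp : (Submodule.span ℂ (Set.range v))ᗮ = ⊥ := by
    rw [eq_bot_iff]
    intro x hx
    have h0 : (⨆ μ, V μ)ᗮ = ⊥ :=
      ContinuousLinearMap.orthogonalComplement_iSup_eigenspaces_eq_bot hR hs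
    rw [← h0]
    rw [Submodule.mem_orthogonal] at hx ⊢
    intro u hu
    have hle : (⨆ μ, V μ) ≤ (Submodule.span ℂ (Set.range v)).topologicalClosure := by
      refine iSup_le fun μ y hy => ?_
      have h1 := (b μ).hasSum_repr ⟨y, hy⟩
      have h2 := h1.mapL (V μ).subtypeL
      refine (Submodule.isClosed_topologicalClosure _).mem_of_tendsto h2
        (Eventually.of_forall fun s => ?_)
      refine Submodule.sum_mem _ fun i _ => ?_
      refine Submodule.le_topologicalClosure _ ?_
      simp only [map_smul]
      exact Submodule.smul_mem _ _ (Submodule.subset_span ⟨⟨μ, i⟩, rfl⟩)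
    have h3 := hle hu
    have hc : IsClosed {u : L | inner ℂ u x = 0} := isClosed_eq (by fun_prop) (by fun_prop)
    exact closure_minimal (fun u hu => hx u hu) hc h3
  let B : HilbertBasis (Σ μ : ℂ, w μ) ℂ L := HilbertBasis.mkOfOrthogonalEqBot hv hsp
  have hB : ∀ a, B a = v a := fun a => by
    rw [HilbertBasis.coe_mkOfOrthogonalEqBot]
  have heig : ∀ a, R (B a) = a.1 • B a := fun a => by
    rw [hB]
    exact Module.End.mem_eigenspace_iff.mp (b a.1 a.2).2
  have hne : ∀ a, B a ≠ 0 := fun a h => by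
    have := B.orthonormal.1 a
    rw [h] at this
    simp at this
  have hre : ∀ a : Σ μ : ℂ, w μ, ((a.1.re : ℝ) : ℂ) = a.1 := fun a => by
    have h1 : Module.End.HasEigenvalue (R : L →ₗ[ℂ] L) a.1 :=
      Module.End.hasEigenvalue_of_hasEigenvector
        (x := B a) ⟨Module.End.mem_eigenspace_iff.mpr (heig a), hne a⟩
    exact (Complex.conj_eq_iff_re).mp (hs.conj_eigenvalue_eq_self h1)
  -- Distinct orthonormal vectors have distance √2 ≥ 1, so they form a discrete subset of a
  -- separable space.
  have hcount : Countable (Σ μ : ℂ, w μ) := by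
    have hdist : ∀ a a', a ≠ a' → 1 ≤ Dist.dist (B a) (B a') := fun a a' h => by
      have h1 := B.orthonormal.2 h
      rw [dist_eq_norm]
      have h2 := norm_sub_sq (𝕜 := ℂ) (B a) (B a')
      rw [h1, B.orthonormal.1 a, B.orthonormal.1 a'] at h2
      simp at h2
      nlinarith [norm_nonneg (B a - B a')]
    have hinjB : Function.Injective B := fun a a' h => by
      by_contra hne'
      have := hdist a a' hne'
      rw [h, dist_self] at this
      linarith
    have hdisc : DiscreteTopology (Set.range B) := by
      refine DiscreteTopology.of_forall_le_dist (r := 1) one_pos ?_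
      rintro ⟨_, a, rfl⟩ ⟨_, a', rfl⟩ h
      exact hdist a a' (fun h' => h (by rw [h']))
    have : Countable (Set.range B) := TopologicalSpace.separableSpace_iff_countable.mp inferInstance
    exact (Equiv.ofInjective B hinjB).injective.countable
  refine ⟨_, hcount, B, fun a => a.1.re, fun a => ⟨fun h => ?_, ?_⟩⟩
  · refine hne a (hinj _ ?_)
    have h0 : a.1.re = 0 := h
    rw [heig, ← hre, h0]
    simp
  · rw [heig, hre]

/-- If every vector of a Hilbert basis lies in `U` or in `Uᗮ`, the projection onto `U` selects
coordinates. -/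
theorem hasSum_inner_starProjection {L ι : Type} [NormedAddCommGroup L]
    [InnerProductSpace ℂ L] [CompleteSpace L] (b : HilbertBasis ι ℂ L) (U : Submodule ℂ L)
    [U.HasOrthogonalProjection] (S : Set ι) (h1 : ∀ i ∈ S, b i ∈ U) (h2 : ∀ i ∉ S, b i ∈ Uᗮ)
    (G F : L) :
    HasSum (S.indicator fun i => inner ℂ G (b i) * inner ℂ (b i) F)
      (inner ℂ G (U.starProjection F)) := by
  have h := ((b.hasSum_repr F).mapL U.starProjection).mapL (innerSL ℂ G)
  simp only [innerSL_apply_apply] at h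
  have hfun : (S.indicator fun i => inner ℂ G (b i) * inner ℂ (b i) F) =
      fun i => inner ℂ G (U.starProjection (b.repr F i • b i)) := by
    funext i
    by_cases hi : i ∈ S
    · rw [Set.indicator_of_mem hi, map_smul, inner_smul_right, b.repr_apply_apply,
        Submodule.starProjection_eq_self_iff.mpr (h1 i hi), mul_comm]
    · rw [Set.indicator_of_notMem hi, map_smul,
        (Submodule.starProjection_apply_eq_zero_iff _).mpr (h2 i hi)]
      simp
  rw [hfun]
  exact h

end Eigenbasis

/-! ### Multiplication operators on L². -/

section Multiplication

variable {α : Type} [MeasureSpace α]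

theorem memLp_mul (m : α → ℂ) (hm : Measurable m) (C : ℝ) (hC : ∀ x, ‖m x‖ ≤ C) (f : L2 α) :
    MemLp (fun x => m x * f x) 2 (volume : Measure α) :=
  MemLp.of_le_mul (c := C) (Lp.memLp f) (hm.aestronglyMeasurable.mul (Lp.aestronglyMeasurable f))
    (Eventually.of_forall fun x => by rw [norm_mul]; gcongr; exact hC x)

/-- Multiplication by a bounded measurable function on `L²`. -/
def mulL2 (m : α → ℂ) (hm : Measurable m) (C : ℝ) (hC : ∀ x, ‖m x‖ ≤ C) : L2 α →L[ℂ] L2 α :=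
  LinearMap.mkContinuous
    { toFun := fun f => (memLp_mul m hm C hC f).toLp
      map_add' := fun f g => by
        apply Lp.ext
        filter_upwards [Lp.coeFn_add f g, (memLp_mul m hm C hC f).coeFn_toLp,
          (memLp_mul m hm C hC g).coeFn_toLp, (memLp_mul m hm C hC (f + g)).coeFn_toLp,
          Lp.coeFn_add (memLp_mul m hm C hC f).toLp (memLp_mul m hm C hC g).toLp]
          with x h1 h2 h3 h4 h5
        rw [h4, h5, h1, Pi.add_apply, Pi.add_apply, h2, h3, mul_add]
      map_smul' := fun c f => by
        apply Lp.ext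
        filter_upwards [Lp.coeFn_smul c f, (memLp_mul m hm C hC f).coeFn_toLp,
          (memLp_mul m hm C hC (c • f)).coeFn_toLp,
          Lp.coeFn_smul c (memLp_mul m hm C hC f).toLp] with x h1 h2 h3 h4
        rw [h3, RingHom.id_apply, h4, h1, Pi.smul_apply, Pi.smul_apply, h2, smul_eq_mul,
          smul_eq_mul]
        ring } C (fun f => by
      refine Lp.norm_le_mul_norm_of_ae_le_mul ?_
      filter_upwards [(memLp_mul m hm C hC f).coeFn_toLp] with x hx
      simp only [LinearMap.coe_mk, AddHom.coe_mk]
      rw [hx, norm_mul]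
      gcongr
      exact hC x)

theorem mulL2_ae (m : α → ℂ) (hm : Measurable m) (C : ℝ) (hC : ∀ x, ‖m x‖ ≤ C) (f : L2 α) :
    mulL2 m hm C hC f =ᵐ[volume] fun x => m x * f x :=
  (memLp_mul m hm C hC f).coeFn_toLp

theorem inner_mulL2 (m : α → ℂ) (hm : Measurable m) (C : ℝ) (hC : ∀ x, ‖m x‖ ≤ C)
    (hreal : ∀ x, (starRingEnd ℂ) (m x) = m x) (f g : L2 α) :
    inner ℂ (mulL2 m hm C hC f) g = inner ℂ f (mulL2 m hm C hC g) := by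
  rw [L2.inner_def, L2.inner_def]
  refine integral_congr_ae ?_
  filter_upwards [mulL2_ae m hm C hC f, mulL2_ae m hm C hC g] with x h1 h2
  rw [h1, h2]
  simp [hreal]
  ring

end Multiplication

/-! ### Calculus of Schwartz functions inside L². -/

section Schwartz

open scoped LineDeriv Laplacian

variable {n : ℕ}

/-- The inclusion of Schwartz functions in `L²`. -/
def ioS : 𝓢(V n, ℂ) →ₗ[ℂ] L2 (V n) := (SchwartzMap.toLpCLM ℂ ℂ 2 volume).toLinearMap

theorem ioS_ae (φ : 𝓢(V n, ℂ)) : ioS φ =ᵐ[volume] φ := φ.coeFn_toLp 2 volume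

theorem ioS_injective : Function.Injective (ioS (n := n)) := SchwartzMap.injective_toLp 2 volume

theorem denseRange_ioS : DenseRange (ioS (n := n)) :=
  SchwartzMap.denseRange_toLpCLM (F := ℂ) ENNReal.ofNat_ne_top

theorem inner_ioS (φ ψ : 𝓢(V n, ℂ)) :
    inner ℂ (ioS φ) (ioS ψ) = ∫ x, inner ℂ (φ x) (ψ x) :=
  SchwartzMap.inner_toL2_toL2_eq φ ψ

theorem norm_ioS_sq (φ : 𝓢(V n, ℂ)) : ‖ioS φ‖ ^ 2 = ∫ x, ‖φ x‖ ^ 2 := by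
  rw [← inner_self_eq_norm_sq (𝕜 := ℂ), inner_ioS, ← integral_re]
  · refine integral_congr_ae (Eventually.of_forall fun x => ?_)
    simp only
    rw [inner_self_eq_norm_sq (𝕜 := ℂ)]
  · have := L2.integrable_inner (𝕜 := ℂ) (ioS φ) (ioS φ)
    refine this.congr ?_
    filter_upwards [ioS_ae φ] with x hx
    rw [hx]

theorem integrable_norm_sq (φ : 𝓢(V n, ℂ)) : Integrable (fun x => ‖φ x‖ ^ 2) := by
  have := (φ.memLp 2 volume).integrable_norm_pow (by norm_num)
  simpa using this

theorem norm_ioS_le {φ ψ : 𝓢(V n, ℂ)} {c : ℝ} (h : ∀ x, ‖φ x‖ ≤ c * ‖ψ x‖) :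
    ‖ioS φ‖ ≤ c * ‖ioS ψ‖ := by
  refine Lp.norm_le_mul_norm_of_ae_le_mul ?_
  filter_upwards [ioS_ae φ, ioS_ae ψ] with x h1 h2
  rw [h1, h2]
  exact h x

/-- Multiplication of Schwartz functions. -/
def mulS (η : 𝓢(V n, ℂ)) : 𝓢(V n, ℂ) →ₗ[ℂ] 𝓢(V n, ℂ) :=
  (SchwartzMap.smulLeftCLM ℂ (η : V n → ℂ)).toLinearMap

@[simp]
theorem mulS_apply (η φ : 𝓢(V n, ℂ)) (x : V n) : mulS η φ x = η x * φ x := by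
  simp only [mulS, ContinuousLinearMap.coe_coe]
  rw [SchwartzMap.smulLeftCLM_apply_apply η.hasTemperateGrowth, smul_eq_mul]

/-- The partial derivatives of a Schwartz function. -/
def pd (i : Fin n) (φ : 𝓢(V n, ℂ)) : 𝓢(V n, ℂ) := ∂_{EuclideanSpace.basisFun (Fin n) ℝ i} φ

theorem pd_mulS (i : Fin n) (η φ : 𝓢(V n, ℂ)) :
    pd i (mulS η φ) = mulS (pd i η) φ + mulS η (pd i φ) := by
  ext x
  simp only [pd, add_apply, mulS_apply, SchwartzMap.lineDerivOp_apply_eq_fderiv]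
  have h : (mulS η φ : V n → ℂ) = fun x => η x * φ x := funext (mulS_apply η φ)
  rw [h, fderiv_fun_mul η.differentiableAt φ.differentiableAt]
  simp
  ring

theorem laplacian_eq (φ : 𝓢(V n, ℂ)) : Δ φ = ∑ i, pd i (pd i φ) :=
  SchwartzMap.laplacian_eq_sum (EuclideanSpace.basisFun (Fin n) ℝ) φ

theorem pd_add (i : Fin n) (φ ψ : 𝓢(V n, ℂ)) : pd i (φ + ψ) = pd i φ + pd i ψ :=
  LineDeriv.lineDerivOp_add _ _ _

/-- The commutator of the Laplacian with multiplication by `η`. -/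
def comm (η φ : 𝓢(V n, ℂ)) : 𝓢(V n, ℂ) :=
  (2 : ℂ) • ∑ i, mulS (pd i η) (pd i φ) + mulS (Δ η) φ

theorem laplacian_mulS (η φ : 𝓢(V n, ℂ)) : Δ (mulS η φ) = mulS η (Δ φ) + comm η φ := by
  simp only [laplacian_eq, comm, pd_mulS, pd_add, map_sum]
  simp only [Finset.sum_add_distrib, two_smul]
  have : mulS (∑ i, pd i (pd i η)) φ = ∑ i, mulS (pd i (pd i η)) φ := by
    ext x
    simp [sum_apply, Finset.sum_mul]
  rw [this]
  abel

theorem inner_pd (i : Fin n) (φ ψ : 𝓢(V n, ℂ)) :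
    inner ℂ (ioS φ) (ioS (pd i ψ)) = -inner ℂ (ioS (pd i φ)) (ioS ψ) := by
  rw [inner_ioS, inner_ioS]
  exact SchwartzMap.integral_bilinear_lineDerivOp_right_eq_neg_left φ ψ
    (isBoundedBilinearMap_inner (𝕜 := ℂ) (E := ℂ)).toContinuousLinearMap
    (EuclideanSpace.basisFun (Fin n) ℝ i)

theorem inner_laplacian (φ ψ : 𝓢(V n, ℂ)) :
    inner ℂ (ioS φ) (ioS (Δ ψ)) = -∑ i, inner ℂ (ioS (pd i φ)) (ioS (pd i ψ)) := by
  rw [laplacian_eq, map_sum, inner_sum, ← Finset.sum_neg_distrib]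
  exact Finset.sum_congr rfl fun i _ => inner_pd i _ _

/-- The preimage is the Fourier multiplier with symbol (1 + |2πξ|²)⁻¹ applied to `χ`; this symbol
has temperate growth, so it preserves the Schwartz space. -/
theorem one_sub_laplacian_surjective (χ : 𝓢(V n, ℂ)) : ∃ φ : 𝓢(V n, ℂ), φ - Δ φ = χ := by
  let g : V n → ℝ := fun x => (1 + ‖(2 * Real.pi) • x‖ ^ 2) ^ (-1 : ℝ)
  have hg : g.HasTemperateGrowth :=
    (Function.hasTemperateGrowth_one_add_norm_sq_rpow (V n) (-1)).comp
      ((2 * Real.pi) • ContinuousLinearMap.id ℝ (V n)).hasTemperateGrowth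
  refine ⟨SchwartzMap.fourierMultiplierCLM ℂ g χ, ?_⟩
  have h2 : (fun x : V n => ‖x‖ ^ 2).HasTemperateGrowth :=
    Function.hasTemperateGrowth_norm_sq (V n)
  have h2' : (fun x : V n => (2 * Real.pi) ^ 2 • ‖x‖ ^ 2).HasTemperateGrowth := by
    have := (Function.HasTemperateGrowth.const ((2 * Real.pi) ^ 2) (E := V n)).mul h2
    exact this
  rw [SchwartzMap.laplacian_eq_fourierMultiplierCLM,
    SchwartzMap.fourierMultiplierCLM_fourierMultiplierCLM_apply h2 hg]
  apply (FourierTransform.fourierCLE ℂ 𝓢(V n, ℂ)).injective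
  simp only [FourierTransform.fourierCLE_apply, SchwartzMap.fourierMultiplierCLM_apply]
  rw [neg_smul, sub_neg_eq_add, FourierTransform.fourier_add, FourierTransform.fourier_smul,
    FourierTransform.fourier_fourierInv_eq, FourierTransform.fourier_fourierInv_eq]
  ext x
  rw [add_apply, smul_apply, SchwartzMap.smulLeftCLM_apply_apply hg,
    SchwartzMap.smulLeftCLM_apply_apply (h2.mul hg)]
  have h3 : 0 < 1 + ‖(2 * Real.pi) • x‖ ^ 2 := by positivity
  have h4 : g x + (2 * Real.pi) ^ 2 * (‖x‖ ^ 2 * g x) = 1 := by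
    simp only [g]
    rw [Real.rpow_neg_one]
    have : ‖(2 * Real.pi) • x‖ ^ 2 = (2 * Real.pi) ^ 2 * ‖x‖ ^ 2 := by
      rw [norm_smul, mul_pow, Real.norm_eq_abs, sq_abs]
    rw [this] at h3 ⊢
    field_simp
  have h5 : g x • (SchwartzMap.fourierTransformCLM ℂ χ) x + (2 * Real.pi) ^ 2 • ((‖x‖ ^ 2 * g x) •
      (SchwartzMap.fourierTransformCLM ℂ χ) x) = (SchwartzMap.fourierTransformCLM ℂ χ) x := by
    rw [smul_smul, ← add_smul, h4, one_smul]
  exact h5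

/-- Smooth cutoff functions at scale `R`. -/
theorem exists_cutoff (n : ℕ) : ∃ B : ℝ, 0 ≤ B ∧ ∀ R : ℝ, 1 ≤ R → ∃ η : 𝓢(V n, ℂ),
    (∀ x, ∃ t : ℝ, 0 ≤ t ∧ t ≤ 1 ∧ η x = t) ∧ (∀ x, ‖x‖ ≤ R → η x = 1) ∧
    (∀ x, 2 * R ≤ ‖x‖ → η x = 0) ∧ (∀ i x, ‖pd i η x‖ ≤ B / R) ∧ ∀ x, ‖(Δ η) x‖ ≤ B / R := by
  let b : ContDiffBump (0 : V n) := ⟨1, 2, one_pos, one_lt_two⟩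
  have hcs : HasCompactSupport (fun x => (b x : ℂ)) :=
    b.hasCompactSupport.comp_left (g := ((↑) : ℝ → ℂ)) Complex.ofReal_zero
  have hcd : ContDiff ℝ ((⊤ : ℕ∞) : WithTop ℕ∞) (fun x => (b x : ℂ)) := Complex.ofRealCLM.contDiff.comp b.contDiff
  let χ : 𝓢(V n, ℂ) := hcs.toSchwartzMap hcd
  have hχ : ∀ x, χ x = (b x : ℂ) := fun x => rfl
  -- Suprema of the derivatives of the bump at scale one. Rescaling gains R⁻¹ per derivative, and R
  -- ≥ 1 lets R⁻² be weakened to R⁻¹ for the Laplacian.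
  let B₁ : ℝ := ∑ i, SchwartzMap.seminorm ℂ 0 0 (pd i χ)
  let B₂ : ℝ := ∑ i, SchwartzMap.seminorm ℂ 0 0 (pd i (pd i χ))
  have hB₁ : 0 ≤ B₁ := Finset.sum_nonneg fun i _ => apply_nonneg _ _
  have hB₂ : 0 ≤ B₂ := Finset.sum_nonneg fun i _ => apply_nonneg _ _
  refine ⟨B₁ + B₂, add_nonneg hB₁ hB₂, fun R hR => ?_⟩
  have hR0 : 0 < R := by linarith
  let g : V n ≃L[ℝ] V n := ContinuousLinearEquiv.smulLeft (Units.mk0 R⁻¹ (inv_ne_zero hR0.ne'))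
  have hg : ∀ x, g x = R⁻¹ • x := fun x => rfl
  let η : 𝓢(V n, ℂ) := SchwartzMap.compCLMOfContinuousLinearEquiv ℂ g χ
  have hη : ∀ x, η x = χ (R⁻¹ • x) := fun x => rfl
  have hnorm : ∀ x : V n, ‖R⁻¹ • x‖ = ‖x‖ / R := fun x => by
    rw [norm_smul, Real.norm_of_nonneg (inv_nonneg.mpr hR0.le)]
    field_simp
  have hpd : ∀ (ψ : 𝓢(V n, ℂ)) i, pd i (SchwartzMap.compCLMOfContinuousLinearEquiv ℂ g ψ) =
      R⁻¹ • SchwartzMap.compCLMOfContinuousLinearEquiv ℂ g (pd i ψ) := fun ψ i => by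
    ext x
    simp only [pd]
    rw [SchwartzMap.lineDerivOp_compCLMOfContinuousLinearEquiv, hg, LineDeriv.lineDerivOp_left_smul]
    simp
  refine ⟨η, fun x => ⟨b (R⁻¹ • x), b.nonneg, b.le_one, by rw [hη, hχ]⟩, fun x hx => ?_,
    fun x hx => ?_, fun i x => ?_, fun x => ?_⟩
  · rw [hη, hχ, b.one_of_mem_closedBall, Complex.ofReal_one]
    rw [mem_closedBall_zero_iff, hnorm]
    exact (div_le_one hR0).mpr hx
  · rw [hη, hχ, b.zero_of_le_dist, Complex.ofReal_zero]
    rw [dist_zero_right, hnorm]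
    exact (le_div_iff₀ hR0).mpr hx
  · simp only [η]
    rw [hpd, smul_apply, norm_smul, Real.norm_of_nonneg (inv_nonneg.mpr hR0.le), mul_comm,
      div_eq_mul_inv]
    gcongr
    calc ‖pd i χ (g x)‖ ≤ SchwartzMap.seminorm ℂ 0 0 (pd i χ) := SchwartzMap.norm_le_seminorm ℂ _ _
      _ ≤ B₁ := Finset.single_le_sum (f := fun i => SchwartzMap.seminorm ℂ 0 0 (pd i χ))
          (fun i _ => apply_nonneg _ _) (Finset.mem_univ i)
      _ ≤ B₁ + B₂ := by linarith
  · have h1 : Δ η = ∑ i, R⁻¹ • R⁻¹ •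
        SchwartzMap.compCLMOfContinuousLinearEquiv ℂ g (pd i (pd i χ)) := by
      rw [laplacian_eq]
      refine Finset.sum_congr rfl fun i _ => ?_
      simp only [η]
      rw [hpd]
      have : ∀ ψ : 𝓢(V n, ℂ), pd i (R⁻¹ • ψ) = R⁻¹ • pd i ψ := fun ψ => LineDeriv.lineDerivOp_smul _ _ _
      rw [this, hpd]
    rw [h1, sum_apply]
    have h2 : R⁻¹ ≤ 1 := inv_le_one_of_one_le₀ hR
    calc ‖∑ i, (R⁻¹ • R⁻¹ • SchwartzMap.compCLMOfContinuousLinearEquiv ℂ g (pd i (pd i χ))) x‖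
        ≤ ∑ i, 1 / R * SchwartzMap.seminorm ℂ 0 0 (pd i (pd i χ)) := by
          refine norm_sum_le_of_le _ fun i _ => ?_
          rw [smul_apply, smul_apply, norm_smul, norm_smul, one_div,
            Real.norm_of_nonneg (inv_nonneg.mpr hR0.le)]
          have h3 : ‖SchwartzMap.compCLMOfContinuousLinearEquiv ℂ g (pd i (pd i χ)) x‖ ≤
              SchwartzMap.seminorm ℂ 0 0 (pd i (pd i χ)) :=
            SchwartzMap.norm_le_seminorm ℂ (pd i (pd i χ)) (g x)
          have h4 := norm_nonneg (SchwartzMap.compCLMOfContinuousLinearEquiv ℂ g (pd i (pd i χ)) x)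
          gcongr
          nlinarith
      _ = B₂ / R := by rw [← Finset.mul_sum]; ring
      _ ≤ (B₁ + B₂) / R := by gcongr; linarith

end Schwartz

/-! ### Essential self-adjointness of 1 - Δ + W on Schwartz functions. -/

section Schroedinger

open scoped LineDeriv Laplacian FourierTransform

variable {n : ℕ}

/-- Multiplication of Schwartz functions by a potential. -/
def potS (W : V n → ℝ) : 𝓢(V n, ℂ) →ₗ[ℂ] 𝓢(V n, ℂ) :=
  (SchwartzMap.smulLeftCLM ℂ (fun x => (W x : ℂ))).toLinearMap

theorem potS_apply {W : V n → ℝ} (hW : Function.HasTemperateGrowth fun x => (W x : ℂ))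
    (φ : 𝓢(V n, ℂ)) (x : V n) : potS W φ x = W x * φ x := by
  simp only [potS, ContinuousLinearMap.coe_coe]
  rw [SchwartzMap.smulLeftCLM_apply_apply hW, smul_eq_mul]

/-- The operator `1 - Δ + W` on Schwartz functions. -/
def schrS (W : V n → ℝ) : 𝓢(V n, ℂ) →ₗ[ℂ] 𝓢(V n, ℂ) :=
  LinearMap.id - (LineDeriv.laplacianCLM ℂ (V n) 𝓢(V n, ℂ)).toLinearMap + potS W

theorem schrS_eq (W : V n → ℝ) (φ : 𝓢(V n, ℂ)) : schrS W φ = φ - Δ φ + potS W φ := by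
  simp [schrS]

/-- The operator `1 - Δ + W` from Schwartz functions to `L²`. -/
def schrA (W : V n → ℝ) : 𝓢(V n, ℂ) →ₗ[ℂ] L2 (V n) := ioS.comp (schrS W)

theorem inner_schrA (W : V n → ℝ) (φ ψ : 𝓢(V n, ℂ)) :
    inner ℂ (ioS φ) (schrA W ψ) = inner ℂ (ioS φ) (ioS ψ) +
      ∑ i, inner ℂ (ioS (pd i φ)) (ioS (pd i ψ)) + inner ℂ (ioS φ) (ioS (potS W ψ)) := by
  rw [schrA, LinearMap.comp_apply, schrS_eq, map_add, map_sub, inner_add_right, inner_sub_right,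
    inner_laplacian, sub_neg_eq_add]

variable {W : V n → ℝ} (hW : Function.HasTemperateGrowth fun x => (W x : ℂ)) (hW0 : ∀ x, 0 ≤ W x)

include hW in
theorem inner_potS (φ ψ : 𝓢(V n, ℂ)) :
    inner ℂ (ioS (potS W φ)) (ioS ψ) = inner ℂ (ioS φ) (ioS (potS W ψ)) := by
  rw [inner_ioS, inner_ioS]
  refine integral_congr_ae (Eventually.of_forall fun x => ?_)
  simp only [potS_apply hW]
  simp
  ring

include hW in
theorem schrA_symm (φ ψ : 𝓢(V n, ℂ)) :
    inner ℂ (schrA W φ) (ioS ψ) = inner ℂ (ioS φ) (schrA W ψ) := by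
  rw [← inner_conj_symm, inner_schrA, inner_schrA, map_add, map_add, map_sum, inner_conj_symm,
    inner_conj_symm, inner_potS hW]
  simp only [inner_conj_symm]

include hW in
theorem integrable_pot (φ : 𝓢(V n, ℂ)) : Integrable (fun x => W x * ‖φ x‖ ^ 2) := by
  have h := L2.integrable_inner (𝕜 := ℂ) (ioS φ) (ioS (potS W φ))
  refine h.re.congr ?_
  filter_upwards [ioS_ae φ, ioS_ae (potS W φ)] with x h1 h2
  rw [h1, h2, potS_apply hW]
  have : inner ℂ (φ x) (W x * φ x) = ((W x * ‖φ x‖ ^ 2 : ℝ) : ℂ) := by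
    rw [← smul_eq_mul, inner_smul_right, inner_self_eq_norm_sq_to_K]
    push_cast; rfl
  rw [this]
  exact RCLike.ofReal_re (K := ℂ) _

include hW in
theorem inner_potS_self (φ : 𝓢(V n, ℂ)) :
    inner ℂ (ioS φ) (ioS (potS W φ)) = ((∫ x, W x * ‖φ x‖ ^ 2 : ℝ) : ℂ) := by
  rw [inner_ioS]
  refine Eq.trans ?_ (integral_ofReal (𝕜 := ℂ))
  refine integral_congr_ae (Eventually.of_forall fun x => ?_)
  simp only [potS_apply hW]
  rw [← smul_eq_mul, inner_smul_right, inner_self_eq_norm_sq_to_K]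
  push_cast; rfl

include hW in
theorem re_inner_schrA (φ : 𝓢(V n, ℂ)) :
    RCLike.re (inner ℂ (ioS φ) (schrA W φ)) =
      ‖ioS φ‖ ^ 2 + ∑ i, ‖ioS (pd i φ)‖ ^ 2 + ∫ x, W x * ‖φ x‖ ^ 2 := by
  rw [inner_schrA, inner_potS_self hW, map_add, map_add, map_sum, inner_self_eq_norm_sq (𝕜 := ℂ)]
  simp only [inner_self_eq_norm_sq (𝕜 := ℂ)]
  congr 1

include hW hW0 in
theorem norm_ioS_sq_le (φ : 𝓢(V n, ℂ)) :
    ‖ioS φ‖ ^ 2 ≤ RCLike.re (inner ℂ (ioS φ) (schrA W φ)) := by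
  rw [re_inner_schrA hW]
  have h1 : 0 ≤ ∑ i, ‖ioS (pd i φ)‖ ^ 2 := Finset.sum_nonneg fun i _ => sq_nonneg _
  have h2 : 0 ≤ ∫ x, W x * ‖φ x‖ ^ 2 :=
    integral_nonneg fun x => mul_nonneg (hW0 x) (sq_nonneg _)
  linarith

/-- The form space of `1 - Δ + W`. -/
def schrForm : FormCompletion (ioS (n := n)) (schrA W) :=
  Classical.choice (exists_formCompletion _ _ ioS_injective (schrA_symm hW) (norm_ioS_sq_le hW hW0))

theorem norm_schrForm_sq (φ : 𝓢(V n, ℂ)) :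
    ‖(schrForm hW hW0).j φ‖ ^ 2 =
      ‖ioS φ‖ ^ 2 + ∑ i, ‖ioS (pd i φ)‖ ^ 2 + ∫ x, W x * ‖φ x‖ ^ 2 := by
  rw [FormCompletion.norm_j_sq, re_inner_schrA hW]

theorem norm_ioS_le_schrForm (φ : 𝓢(V n, ℂ)) : ‖ioS φ‖ ≤ ‖(schrForm hW hW0).j φ‖ := by
  rw [← (schrForm hW hW0).J_j]
  exact (schrForm hW hW0).norm_J_le _

theorem norm_pd_le_schrForm (i : Fin n) (φ : 𝓢(V n, ℂ)) :
    ‖ioS (pd i φ)‖ ≤ ‖(schrForm hW hW0).j φ‖ := by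
  refine le_of_sq_le_sq ?_ (norm_nonneg _)
  rw [norm_schrForm_sq]
  have h1 : ‖ioS (pd i φ)‖ ^ 2 ≤ ∑ i, ‖ioS (pd i φ)‖ ^ 2 :=
    Finset.single_le_sum (f := fun i => ‖ioS (pd i φ)‖ ^ 2) (fun i _ => sq_nonneg _)
      (Finset.mem_univ i)
  have h2 : 0 ≤ ∫ x, W x * ‖φ x‖ ^ 2 :=
    integral_nonneg fun x => mul_nonneg (hW0 x) (sq_nonneg _)
  nlinarith [sq_nonneg ‖ioS φ‖]

/-- The commutator contains only `φ` and its first derivatives, all controlled by the form norm. The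
n first-order terms with their factor 2 and the zeroth-order term make 2n + 1. -/
theorem norm_comm_le {η : 𝓢(V n, ℂ)} {c : ℝ} (hc : 0 ≤ c) (h1 : ∀ i x, ‖pd i η x‖ ≤ c)
    (h2 : ∀ x, ‖(Δ η) x‖ ≤ c) (φ : 𝓢(V n, ℂ)) :
    ‖ioS (comm η φ)‖ ≤ (2 * n + 1) * c * ‖(schrForm hW hW0).j φ‖ := by
  have e1 : ∀ i, ‖ioS (mulS (pd i η) (pd i φ))‖ ≤ c * ‖(schrForm hW hW0).j φ‖ := fun i =>
    (norm_ioS_le (ψ := pd i φ) fun x => by rw [mulS_apply, norm_mul]; gcongr; exact h1 i x).trans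
      (by gcongr; exact norm_pd_le_schrForm hW hW0 i φ)
  have e2 : ‖ioS (mulS (Δ η) φ)‖ ≤ c * ‖(schrForm hW hW0).j φ‖ :=
    (norm_ioS_le (ψ := φ) fun x => by rw [mulS_apply, norm_mul]; gcongr; exact h2 x).trans
      (by gcongr; exact norm_ioS_le_schrForm hW hW0 φ)
  rw [comm, map_add, map_smul, map_sum]
  have e3 : ‖∑ i, ioS (mulS (pd i η) (pd i φ))‖ ≤ ∑ _i : Fin n, c * ‖(schrForm hW hW0).j φ‖ :=
    norm_sum_le_of_le _ fun i _ => e1 i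
  rw [Finset.sum_const, Finset.card_univ, Fintype.card_fin, nsmul_eq_mul] at e3
  refine (norm_add_le _ _).trans ?_
  rw [norm_smul, Complex.norm_two]
  nlinarith

theorem schrS_mulS (W : V n → ℝ) (hW : Function.HasTemperateGrowth fun x => (W x : ℂ))
    (η φ : 𝓢(V n, ℂ)) : mulS η (schrS W φ) = schrS W (mulS η φ) + comm η φ := by
  rw [schrS_eq, schrS_eq, laplacian_mulS]
  have : potS W (mulS η φ) = mulS η (potS W φ) := by
    ext x
    simp only [potS_apply hW, mulS_apply]
    ring
  rw [this, map_add, map_sub]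
  abel

theorem exists_bound (η : 𝓢(V n, ℂ)) : ∀ x, ‖η x‖ ≤ SchwartzMap.seminorm ℂ 0 0 η :=
  SchwartzMap.norm_le_seminorm ℂ η

/-- Multiplication by a Schwartz function on `L²`. -/
def mulSL2 (η : 𝓢(V n, ℂ)) : L2 (V n) →L[ℂ] L2 (V n) :=
  mulL2 η η.continuous.measurable _ (exists_bound η)

theorem mulSL2_ae (η : 𝓢(V n, ℂ)) (h : L2 (V n)) : mulSL2 η h =ᵐ[volume] fun x => η x * h x :=
  mulL2_ae _ _ _ _ h

theorem mulSL2_ioS (η φ : 𝓢(V n, ℂ)) : mulSL2 η (ioS φ) = ioS (mulS η φ) := by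
  apply Lp.ext
  filter_upwards [mulSL2_ae η (ioS φ), ioS_ae φ, ioS_ae (mulS η φ)] with x h1 h2 h3
  rw [h1, h2, h3, mulS_apply]

theorem inner_mulSL2 {η : 𝓢(V n, ℂ)} (hη : ∀ x, (starRingEnd ℂ) (η x) = η x) (h : L2 (V n))
    (φ : 𝓢(V n, ℂ)) : inner ℂ (mulSL2 η h) (ioS φ) = inner ℂ h (ioS (mulS η φ)) := by
  rw [← mulSL2_ioS, mulSL2, inner_mulL2 _ _ _ _ hη]

theorem hasTemperateGrowth_zero : Function.HasTemperateGrowth fun x : V n => (((0 : V n → ℝ) x : ℝ) : ℂ) := by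
  have := Function.HasTemperateGrowth.const (E := V n) (0 : ℂ)
  simp [this]

theorem schrS_zero (φ : 𝓢(V n, ℂ)) : schrS 0 φ = φ - Δ φ := by
  rw [schrS_eq]
  have : potS (0 : V n → ℝ) φ = 0 := by
    ext x
    rw [potS_apply hasTemperateGrowth_zero]
    simp
  rw [this, add_zero]

/-- The form space of `1 - Δ`. -/
def freeForm (n : ℕ) : FormCompletion (ioS (n := n)) (schrA 0) :=
  schrForm hasTemperateGrowth_zero fun _ => le_rfl

/-- The operator 1 - Δ maps onto the Schwartz space, which is dense in L². -/
theorem eq_of_forall_inner_schrA_zero {u v : L2 (V n)}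
    (h : ∀ φ, inner ℂ u (schrA 0 φ) = inner ℂ v (schrA 0 φ)) : u = v := by
  have h1 : ∀ χ : 𝓢(V n, ℂ), inner ℂ u (ioS χ) = inner ℂ v (ioS χ) := fun χ => by
    obtain ⟨φ, hφ⟩ := one_sub_laplacian_surjective χ
    have := h φ
    rwa [schrA, LinearMap.comp_apply, schrS_zero, hφ] at this
  apply ext_inner_right ℂ
  intro w
  induction w using denseRange_ioS.induction_on with
  | hp => exact isClosed_eq (by fun_prop) (by fun_prop)
  | ih χ => exact h1 χ

include hW in
/-- A function orthogonal to the range of `1 - Δ + W` is, after localization, in the free form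
space. -/
theorem exists_freeForm_of_orthogonal {h : L2 (V n)} (hh : ∀ φ, inner ℂ h (schrA W φ) = 0)
    {η : 𝓢(V n, ℂ)} (hη : ∀ x, (starRingEnd ℂ) (η x) = η x) :
    ∃ ξ : (freeForm n).H, mulSL2 η h = (freeForm n).J ξ := by
  let c : ℝ := ∑ i, SchwartzMap.seminorm ℂ 0 0 (pd i η) + SchwartzMap.seminorm ℂ 0 0 (Δ η)
  have hs : ∀ i, 0 ≤ SchwartzMap.seminorm ℂ 0 0 (pd i η) := fun i => apply_nonneg _ _
  have hs' : 0 ≤ SchwartzMap.seminorm ℂ 0 0 (Δ η) := apply_nonneg _ _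
  have hc : 0 ≤ c := add_nonneg (Finset.sum_nonneg fun i _ => hs i) hs'
  have h1 : ∀ i x, ‖pd i η x‖ ≤ c := fun i x => by
    have e1 := exists_bound (pd i η) x
    have e2 := Finset.single_le_sum (f := fun i => SchwartzMap.seminorm ℂ 0 0 (pd i η))
      (fun i _ => hs i) (Finset.mem_univ i)
    linarith
  have h2 : ∀ x, ‖(Δ η) x‖ ≤ c := fun x => by
    have e1 := exists_bound (Δ η) x
    have e2 := Finset.sum_nonneg (s := Finset.univ) fun i _ => hs i
    linarith
  -- Moving `η` onto the test function leaves the commutator and the term with Wη. As Wη is again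
  -- Schwartz, hence bounded, both are bounded by the free form norm of `φ`, as Riesz representation
  -- requires.
  have h3 : ∀ φ, inner ℂ (mulSL2 η h) (schrA 0 φ) =
      inner ℂ h (ioS (comm η φ)) - inner ℂ h (ioS (mulS (potS W η) φ)) := fun φ => by
    have e1 : schrS W φ = schrS 0 φ + potS W φ := by rw [schrS_zero, schrS_eq]
    have e2 : mulS η (schrS 0 φ) = schrS W (mulS η φ) + comm η φ - mulS (potS W η) φ := by
      rw [← schrS_mulS W hW, e1, map_add]
      have : mulS η (potS W φ) = mulS (potS W η) φ := by
        ext x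
        simp only [mulS_apply, potS_apply hW]
        ring
      rw [this]
      abel
    have e3 := hh (mulS η φ)
    rw [schrA, LinearMap.comp_apply] at e3
    rw [schrA, LinearMap.comp_apply, inner_mulSL2 hη, e2, map_sub, map_add, inner_sub_right,
      inner_add_right, e3, zero_add]
  let M := SchwartzMap.seminorm ℂ 0 0 (potS W η)
  have hM : 0 ≤ M := apply_nonneg _ _
  obtain ⟨ξ, hξ⟩ := (freeForm n).exists_riesz (mulSL2 η h)
    (‖h‖ * ((2 * n + 1) * c) + ‖h‖ * M) (fun φ => by
      rw [h3]
      refine (norm_sub_le _ _).trans ?_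
      rw [add_mul]
      refine add_le_add ((norm_inner_le_norm _ _).trans ?_) ((norm_inner_le_norm _ _).trans ?_)
      · rw [mul_assoc]
        gcongr
        exact norm_comm_le hasTemperateGrowth_zero (fun _ => le_rfl) hc h1 h2 φ
      · rw [mul_assoc]
        gcongr
        refine (norm_ioS_le (ψ := φ) (c := M) fun x => ?_).trans ?_
        · rw [mulS_apply, norm_mul]
          gcongr
          exact exists_bound _ x
        · gcongr
          exact norm_ioS_le_schrForm hasTemperateGrowth_zero (fun _ => le_rfl) φ)
  exact ⟨ξ, eq_of_forall_inner_schrA_zero hξ⟩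

/-- Multiplication by a Schwartz function maps the free form space to that of `1 - Δ + W`. -/
theorem exists_norm_mulS_le (η : 𝓢(V n, ℂ)) : ∃ C : ℝ, 0 ≤ C ∧ ∀ φ,
    ‖(schrForm hW hW0).j (mulS η φ)‖ ≤ C * ‖(freeForm n).j φ‖ := by
  let c₀ := SchwartzMap.seminorm ℂ 0 0 η
  let c₁ := fun i => SchwartzMap.seminorm ℂ 0 0 (pd i η)
  let c₂ := SchwartzMap.seminorm ℂ 0 0 (potS W η)
  have hc₀ : 0 ≤ c₀ := apply_nonneg _ _
  have hc₁ : ∀ i, 0 ≤ c₁ i := fun i => apply_nonneg _ _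
  have hc₂ : 0 ≤ c₂ := apply_nonneg _ _
  let C2 : ℝ := c₀ ^ 2 + ∑ i, (c₁ i + c₀) ^ 2 + c₂ * c₀
  have hC2 : 0 ≤ C2 := add_nonneg (add_nonneg (sq_nonneg _) (Finset.sum_nonneg fun i _ =>
    sq_nonneg _)) (mul_nonneg hc₂ hc₀)
  refine ⟨√C2, Real.sqrt_nonneg _, fun φ => ?_⟩
  refine le_of_sq_le_sq ?_ (mul_nonneg (Real.sqrt_nonneg _) (norm_nonneg _))
  rw [mul_pow, Real.sq_sqrt hC2, norm_schrForm_sq]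
  set t := ‖(freeForm n).j φ‖
  have ht : 0 ≤ t := norm_nonneg _
  have f0 : ‖ioS φ‖ ≤ t := norm_ioS_le_schrForm _ _ φ
  have f1 : ∀ i, ‖ioS (pd i φ)‖ ≤ t := fun i => norm_pd_le_schrForm _ _ i φ
  have e0 : ‖ioS (mulS η φ)‖ ≤ c₀ * t :=
    (norm_ioS_le (ψ := φ) fun x => by
      rw [mulS_apply, norm_mul]; gcongr; exact exists_bound η x).trans (by gcongr)
  have e1 : ∀ i, ‖ioS (pd i (mulS η φ))‖ ≤ (c₁ i + c₀) * t := fun i => by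
    rw [pd_mulS, map_add, add_mul]
    refine (norm_add_le _ _).trans (add_le_add ?_ ?_)
    · exact (norm_ioS_le (ψ := φ) fun x => by
        rw [mulS_apply, norm_mul]; gcongr; exact exists_bound (pd i η) x).trans
          (mul_le_mul_of_nonneg_left f0 (hc₁ i))
    · exact (norm_ioS_le (ψ := pd i φ) fun x => by
        rw [mulS_apply, norm_mul]; gcongr; exact exists_bound η x).trans
          (mul_le_mul_of_nonneg_left (f1 i) hc₀)
  -- One of the two factors `η` absorbs the growth of W, the other is merely bounded.
  have e2 : ∫ x, W x * ‖mulS η φ x‖ ^ 2 ≤ c₂ * c₀ * t ^ 2 := by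
    calc ∫ x, W x * ‖mulS η φ x‖ ^ 2 ≤ ∫ x, c₂ * c₀ * ‖φ x‖ ^ 2 := by
          refine integral_mono (integrable_pot hW _) ((integrable_norm_sq φ).const_mul _)
            fun x => ?_
          have g1 : W x * ‖η x‖ ≤ c₂ := by
            have := exists_bound (potS W η) x
            rw [potS_apply hW, norm_mul, Complex.norm_real, Real.norm_of_nonneg (hW0 x)] at this
            exact this
          have g2 : ‖η x‖ ≤ c₀ := exists_bound η x
          simp only [mulS_apply, norm_mul, mul_pow]
          calc W x * (‖η x‖ ^ 2 * ‖φ x‖ ^ 2) = (W x * ‖η x‖) * ‖η x‖ * ‖φ x‖ ^ 2 := by ring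
            _ ≤ c₂ * c₀ * ‖φ x‖ ^ 2 := by gcongr
      _ = c₂ * c₀ * ‖ioS φ‖ ^ 2 := by rw [integral_const_mul, norm_ioS_sq]
      _ ≤ c₂ * c₀ * t ^ 2 := by gcongr
  calc _ ≤ (c₀ * t) ^ 2 + ∑ i, ((c₁ i + c₀) * t) ^ 2 + c₂ * c₀ * t ^ 2 := by
        gcongr with i
        exact e1 i
    _ = C2 * t ^ 2 := by
        simp only [C2, mul_pow, add_mul (_ + _), add_mul (c₀ ^ 2), Finset.sum_mul]

include hW hW0 in
/-- Essential self-adjointness: the range of `1 - Δ + W` on Schwartz functions is dense. -/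
theorem eq_zero_of_orthogonal {h : L2 (V n)} (hh : ∀ φ, inner ℂ h (schrA W φ) = 0) : h = 0 := by
  obtain ⟨B, hB, hcut⟩ := exists_cutoff n
  have hreal : ∀ {η : 𝓢(V n, ℂ)}, (∀ x, ∃ t : ℝ, 0 ≤ t ∧ t ≤ 1 ∧ η x = t) →
      ∀ x, (starRingEnd ℂ) (η x) = η x := fun hη x => by
    obtain ⟨t, -, -, ht⟩ := hη x
    rw [ht, Complex.conj_ofReal]
  have key : ∀ R : ℝ, 1 ≤ R → ∃ η : 𝓢(V n, ℂ), (∀ x, ‖x‖ ≤ R → η x = 1) ∧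
      ‖mulSL2 η h‖ ≤ ‖h‖ * ((2 * n + 1) * (B / R)) := by
    intro R hR
    have hR0 : 0 < R := by linarith
    obtain ⟨η, a1, a2, a3, a4, a5⟩ := hcut R hR
    -- The wider cutoff equals one on the support of `η`, so ηh = η(ζh): here ζh lies in the free
    -- form space, and multiplication by `η` carries that space into the form space of 1 - Δ + W.
    obtain ⟨ζ, b1, b2, b3, b4, b5⟩ := hcut (2 * R) (by linarith)
    refine ⟨η, a2, ?_⟩
    have hprod : ∀ x, η x * ζ x = η x := fun x => by
      rcases le_or_gt (2 * R) ‖x‖ with hx | hx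
      · rw [a3 x hx, zero_mul]
      · rw [b2 x hx.le, mul_one]
    obtain ⟨ξ, hξ⟩ := exists_freeForm_of_orthogonal hW hh (hreal b1)
    obtain ⟨C, hC, hmul⟩ := exists_norm_mulS_le hW hW0 η
    let m := ((schrForm hW hW0).j.comp (mulS η)).extendOfNorm (freeForm n).j
    have hm : ∀ φ, m ((freeForm n).j φ) = (schrForm hW hW0).j (mulS η φ) := fun φ =>
      LinearMap.extendOfNorm_eq (freeForm n).dense ⟨C, hmul⟩ φ
    have hm' : ∀ ξ, (schrForm hW hW0).J (m ξ) = mulSL2 η ((freeForm n).J ξ) := fun ξ => by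
      induction ξ using (freeForm n).dense.induction_on with
      | hp => exact isClosed_eq (by fun_prop) (by fun_prop)
      | ih φ => rw [hm, FormCompletion.J_j, FormCompletion.J_j, mulSL2_ioS]
    have e1 : mulSL2 η h = (schrForm hW hW0).J (m ξ) := by
      rw [hm', ← hξ]
      apply Lp.ext
      filter_upwards [mulSL2_ae η h, mulSL2_ae η (mulSL2 ζ h), mulSL2_ae ζ h] with x c1 c2 c3
      rw [c1, c2, c3, ← mul_assoc, hprod]
    -- Pairing ηh with Aφ moves `η` over and yields the pairings of h with A(ηφ), which vanishes,
    -- and with the commutator, which is O(1/R).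
    have e2 : ‖m ξ‖ ≤ ‖h‖ * ((2 * n + 1) * (B / R)) := by
      refine (schrForm hW hW0).norm_le_of_forall _ _ (by positivity) fun φ => ?_
      rw [← e1]
      have e3 := hh (mulS η φ)
      simp only [schrA, LinearMap.comp_apply] at e3 ⊢
      rw [inner_mulSL2 (hreal a1), schrS_mulS W hW, map_add, inner_add_right, e3, zero_add,
        mul_assoc]
      refine (norm_inner_le_norm _ _).trans ?_
      gcongr
      exact norm_comm_le hW hW0 (by positivity) a4 a5 φ
    rw [e1]
    exact ((schrForm hW hW0).norm_J_le _).trans e2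
  -- On a fixed ball the cutoff equals one for all large R, so the mass of `h` there is O(R⁻²),
  -- hence zero.
  have hball : ∀ ρ : ℝ, ∫⁻ x in Metric.ball (0 : V n) ρ, ‖h x‖ₑ ^ 2 = 0 := by
    intro ρ
    have hle : ∀ R : ℝ, max 1 ρ ≤ R → ∫⁻ x in Metric.ball (0 : V n) ρ, ‖h x‖ₑ ^ 2 ≤
        ENNReal.ofReal ((‖h‖ * ((2 * n + 1) * (B / R))) ^ 2) := by
      intro R hR
      obtain ⟨η, h1, h2⟩ := key R ((le_max_left _ _).trans hR)
      have h3 : ‖mulSL2 η h‖ₑ ^ 2 = ∫⁻ x, ‖mulSL2 η h x‖ₑ ^ 2 := by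
        have := eLpNorm_eq_lintegral_rpow_enorm_toReal (μ := volume) (f := mulSL2 η h)
          (p := 2) (by norm_num) (by norm_num)
        rw [Lp.enorm_def, this, ← ENNReal.rpow_natCast, ← ENNReal.rpow_mul]
        norm_num
      calc ∫⁻ x in Metric.ball (0 : V n) ρ, ‖h x‖ₑ ^ 2
          = ∫⁻ x in Metric.ball (0 : V n) ρ, ‖mulSL2 η h x‖ₑ ^ 2 := by
            refine setLIntegral_congr_fun_ae measurableSet_ball ?_
            filter_upwards [mulSL2_ae η h] with x hx hxρ
            rw [hx, h1 x, one_mul]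
            rw [mem_ball_zero_iff] at hxρ
            exact hxρ.le.trans ((le_max_right _ _).trans hR)
        _ ≤ ∫⁻ x, ‖mulSL2 η h x‖ₑ ^ 2 := setLIntegral_le_lintegral _ _
        _ = ‖mulSL2 η h‖ₑ ^ 2 := h3.symm
        _ = ENNReal.ofReal (‖mulSL2 η h‖ ^ 2) := by
            rw [← ofReal_norm, ENNReal.ofReal_pow (norm_nonneg _)]
        _ ≤ _ := by
            apply ENNReal.ofReal_le_ofReal
            gcongr
    have hlim : Tendsto (fun R : ℝ => ENNReal.ofReal ((‖h‖ * ((2 * n + 1) * (B / R))) ^ 2)) atTop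
        (𝓝 0) := by
      have h1 : Tendsto (fun R : ℝ => B / R) atTop (𝓝 0) := tendsto_const_nhds.div_atTop tendsto_id
      have h2 := ((h1.const_mul (2 * (n : ℝ) + 1)).const_mul ‖h‖).pow 2
      have h3 := (ENNReal.continuous_ofReal.tendsto _).comp h2
      simpa [Function.comp_def] using h3
    refine le_antisymm (ge_of_tendsto hlim ?_) zero_le
    filter_upwards [eventually_ge_atTop (max 1 ρ)] with R hR using hle R hR
  have hae : ∀ k : ℕ, ∀ᵐ x : V n, x ∈ Metric.ball (0 : V n) k → h x = 0 := fun k => by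
    have h1 := hball k
    rw [lintegral_eq_zero_iff' ((Lp.aestronglyMeasurable h).enorm.pow_const 2).restrict] at h1
    rw [← ae_restrict_iff' measurableSet_ball]
    filter_upwards [h1] with x hx
    simpa using hx
  apply Lp.ext
  rw [← ae_all_iff] at hae
  filter_upwards [hae, Lp.coeFn_zero ℂ 2 (volume : Measure (V n))] with x hx h0
  obtain ⟨k, hk⟩ := exists_nat_gt ‖x‖
  rw [h0, hx k (by simpa using hk)]
  rfl

end Schroedinger

/-! ### Compact resolvent and eigenbasis of confining Schrödinger operators. -/

section Schroedinger

open scoped LineDeriv Laplacian FourierTransform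

variable {n : ℕ}

instance secondCountableTopology_L2 : SecondCountableTopology (L2 (V n)) :=
  have : Fact ((2 : ℝ≥0∞) ≠ ∞) := ⟨by norm_num⟩
  Lp.SecondCountableTopology

/-- `b · 𝓕(a ·)` extends to a compact operator for Schwartz functions `a` and `b`. -/
theorem exists_compact_localization (a b : 𝓢(V n, ℂ)) :
    ∃ N : L2 (V n) →L[ℂ] L2 (V n), IsCompactOperator N ∧
      ∀ φ : 𝓢(V n, ℂ), N (ioS φ) = ioS (mulS b (𝓕 (mulS a φ))) := by
  -- Conjugated, because the inner product conjugates its first entry: pairing with `e ξ` is then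
  -- the Fourier integral of a times the argument.
  let e : V n → V n → ℂ := fun ξ x =>
    Complex.exp ((2 * Real.pi * inner ℝ x ξ : ℝ) * Complex.I) * (starRingEnd ℂ) (a x)
  have hexp : ∀ t : ℝ, ‖Complex.exp (t * Complex.I)‖ = 1 := Complex.norm_exp_ofReal_mul_I
  have hen : ∀ ξ x, ‖e ξ x‖ = ‖a x‖ := fun ξ x => by
    simp only [e]
    rw [norm_mul, hexp, one_mul, RCLike.norm_conj]
  have hec : Continuous (Function.uncurry e) := by
    have ha := a.continuous
    simp only [e, Function.uncurry_def]
    have h1 : Continuous fun p : V n × V n => inner ℝ p.2 p.1 := continuous_snd.inner continuous_fst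
    have h2 : Continuous fun p : V n × V n => (starRingEnd ℂ) (a p.2) :=
      Complex.continuous_conj.comp (ha.comp continuous_snd)
    fun_prop
  have hmem : ∀ ξ, MemLp (e ξ) 2 (volume : Measure (V n)) := fun ξ =>
    MemLp.of_le (a.memLp 2 volume)
      (hec.comp (Continuous.prodMk continuous_const continuous_id)).aestronglyMeasurable
      (Eventually.of_forall fun x => (hen ξ x).le)
  let E : V n → L2 (V n) := fun ξ => (hmem ξ).toLp
  have hE : ∀ ξ, ‖E ξ‖ ≤ ‖ioS a‖ := fun ξ => by
    refine Lp.norm_le_norm_of_ae_le ?_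
    filter_upwards [(hmem ξ).coeFn_toLp, ioS_ae a] with x h1 h2
    rw [h1, h2, hen]
  have hin : ∀ ξ (f : L2 (V n)), inner ℂ (E ξ) f = ∫ x, f x * (starRingEnd ℂ) (e ξ x) := fun ξ f => by
    rw [L2.inner_def]
    refine integral_congr_ae ?_
    filter_upwards [(hmem ξ).coeFn_toLp] with x h1
    rw [h1]
    rfl
  obtain ⟨N, hN, hN'⟩ := exists_isCompactOperator (b : V n → ℂ) (b.memLp 2 volume) E ‖ioS a‖ hE
    (fun f => by
      simp only [hin]
      refine StronglyMeasurable.aestronglyMeasurable ?_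
      refine StronglyMeasurable.integral_prod_right
        (f := fun ξ x => f x * (starRingEnd ℂ) (e ξ x)) ?_
      exact ((Lp.stronglyMeasurable f).comp_measurable measurable_snd).mul
        (Complex.continuous_conj.comp hec).stronglyMeasurable)
  refine ⟨N, hN, fun φ => ?_⟩
  apply Lp.ext
  filter_upwards [hN' (ioS φ), ioS_ae (mulS b (𝓕 (mulS a φ)))] with ξ h1 h2
  rw [h1, h2, mulS_apply, hin, SchwartzMap.fourier_coe, Real.fourier_eq']
  congr 1
  refine integral_congr_ae ?_
  filter_upwards [ioS_ae φ] with x h3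
  rw [h3, mulS_apply, smul_eq_mul]
  simp only [e]
  rw [map_mul, Complex.conj_conj, ← Complex.exp_conj, map_mul, Complex.conj_ofReal, Complex.conj_I]
  have : ((2 * Real.pi * inner ℝ x ξ : ℝ) : ℂ) * -Complex.I =
      ((-2 * Real.pi * inner ℝ x ξ : ℝ) : ℂ) * Complex.I := by
    push_cast
    ring
  rw [this]
  ring

variable {W : V n → ℝ} (hW : Function.HasTemperateGrowth fun x => (W x : ℂ)) (hW0 : ∀ x, 0 ≤ W x)

/-- By Plancherel the right side equals (2π)² times the left, and that factor is at least one. -/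
theorem fourier_norm_le (φ : 𝓢(V n, ℂ)) :
    ∫ ξ, ‖ξ‖ ^ 2 * ‖(𝓕 φ) ξ‖ ^ 2 ≤ ∑ i, ‖ioS (pd i φ)‖ ^ 2 := by
  have h1 : ∀ i, ‖ioS (pd i φ)‖ ^ 2 = ∫ ξ, (2 * Real.pi) ^ 2 * (ξ i ^ 2 * ‖(𝓕 φ) ξ‖ ^ 2) :=
    fun i => by
    rw [norm_ioS_sq, ← SchwartzMap.integral_norm_sq_fourier]
    refine integral_congr_ae (Eventually.of_forall fun ξ => ?_)
    simp only [pd]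
    rw [SchwartzMap.fourier_lineDerivOp_eq]
    have hg : (fun x : V n => inner ℝ x (EuclideanSpace.basisFun (Fin n) ℝ i)).HasTemperateGrowth :=
      Function.hasTemperateGrowth_inner_left _
    rw [smul_apply, SchwartzMap.smulLeftCLM_apply_apply hg, norm_smul, norm_smul, mul_pow, mul_pow]
    congr 1
    · simp [mul_pow, sq_abs]
    · congr 1
      rw [real_inner_comm, EuclideanSpace.basisFun_inner]
      simp
  have h2 : ∀ i, Integrable fun ξ : V n => ξ i ^ 2 * ‖(𝓕 φ) ξ‖ ^ 2 := fun i => by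
    have hg : (fun x : V n => inner ℝ x (EuclideanSpace.basisFun (Fin n) ℝ i)).HasTemperateGrowth :=
      Function.hasTemperateGrowth_inner_left _
    refine (integrable_norm_sq (SchwartzMap.smulLeftCLM ℂ
      (fun x : V n => inner ℝ x (EuclideanSpace.basisFun (Fin n) ℝ i)) (𝓕 φ))).congr
      (Eventually.of_forall fun ξ => ?_)
    simp only
    rw [SchwartzMap.smulLeftCLM_apply_apply hg, norm_smul, mul_pow, real_inner_comm,
      EuclideanSpace.basisFun_inner]
    simp
  have h3 : ∫ ξ, ‖ξ‖ ^ 2 * ‖(𝓕 φ) ξ‖ ^ 2 = ∑ i, ∫ ξ : V n, ξ i ^ 2 * ‖(𝓕 φ) ξ‖ ^ 2 := by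
    rw [← integral_finsetSum _ fun i _ => h2 i]
    refine integral_congr_ae (Eventually.of_forall fun ξ => ?_)
    simp only
    rw [EuclideanSpace.real_norm_sq_eq, Finset.sum_mul]
  rw [h3]
  refine Finset.sum_le_sum fun i _ => ?_
  rw [h1, integral_const_mul]
  have h4 : 0 ≤ ∫ ξ : V n, ξ i ^ 2 * ‖(𝓕 φ) ξ‖ ^ 2 := integral_nonneg fun ξ => by positivity
  have h5 : 1 ≤ (2 * Real.pi) ^ 2 := by
    have := Real.pi_gt_three
    nlinarith
  nlinarith

include hW hW0 in
-- A Rellich argument: a bound on the form norm makes tails small in space, because W confines, and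
-- in frequency, because of the gradient. Up to `ε` in the form norm, `φ` therefore agrees with its
-- image under the compact operator that cuts off in space and then in frequency.
theorem isCompactOperator_schr_resolvent {c : ℝ} (hc : ∀ x, ‖x‖ ^ 2 ≤ c * (W x + 1)) :
    IsCompactOperator (schrForm hW hW0).resolvent := by
  have hc0 : 0 ≤ c := by
    have := hc 0
    have := hW0 0
    simp at *
    by_contra h
    nlinarith
  obtain ⟨B, hB, hcut⟩ := exists_cutoff n
  refine (schrForm hW hW0).isCompactOperator_resolvent fun ε hε => ?_
  -- The frequency error is at most t/R and the spatial error at most √c·t/R, with t the form norm;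
  -- this R makes their sum at most εt.
  let R : ℝ := max 1 ((1 + √c) / ε)
  have hR1 : 1 ≤ R := le_max_left _ _
  have hR0 : 0 < R := by linarith
  have hRε : (1 + √c) / R ≤ ε := by
    rw [div_le_comm₀ hR0 hε]
    exact le_max_right _ _
  obtain ⟨η, a1, a2, a3, -, -⟩ := hcut R hR1
  obtain ⟨N, hN, hN'⟩ := exists_compact_localization η η
  let FT := Lp.fourierTransformₗᵢ (V n) ℂ
  refine ⟨FT.symm.toContinuousLinearEquiv.toContinuousLinearMap.comp N,
    hN.continuous_comp FT.symm.continuous, fun φ => ?_⟩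
  have hFT : FT (ioS φ) = ioS (𝓕 φ) := SchwartzMap.toLp_fourier_eq φ
  have h0 : ‖ioS φ - FT.symm (N (ioS φ))‖ = ‖ioS (𝓕 φ) - ioS (mulS η (𝓕 (mulS η φ)))‖ := by
    rw [← FT.norm_map, map_sub, LinearIsometryEquiv.apply_symm_apply, hFT, hN']
  have hη : ∀ x, ‖1 - η x‖ ≤ ‖x‖ / R ∧ ‖η x‖ ≤ 1 := fun x => by
    obtain ⟨t, t0, t1, ht⟩ := a1 x
    constructor
    · rcases le_or_gt ‖x‖ R with hx | hx
      · rw [a2 x hx, sub_self, norm_zero]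
        positivity
      · have e1 : 1 ≤ ‖x‖ / R := (one_le_div hR0).mpr hx.le
        refine le_trans ?_ e1
        rw [ht, ← Complex.ofReal_one, ← Complex.ofReal_sub, Complex.norm_real, Real.norm_eq_abs,
          abs_le]
        constructor <;> linarith
    · rw [ht, Complex.norm_real, Real.norm_eq_abs, abs_le]
      constructor <;> linarith
  -- Chebyshev's inequality: 1 - η vanishes for |x| ≤ R and is at most |x|/R everywhere.
  have hlow : ∀ ψ : 𝓢(V n, ℂ), ∀ q : ℝ, Integrable (fun x => ‖x‖ ^ 2 * ‖ψ x‖ ^ 2) →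
      ∫ x, ‖x‖ ^ 2 * ‖ψ x‖ ^ 2 ≤ q ^ 2 → 0 ≤ q → ‖ioS (ψ - mulS η ψ)‖ ≤ q / R := by
    intro ψ q hint hq hq0
    refine le_of_sq_le_sq ?_ (by positivity)
    rw [norm_ioS_sq, div_pow]
    calc ∫ x, ‖(ψ - mulS η ψ) x‖ ^ 2 ≤ ∫ x, (1 / R ^ 2) * (‖x‖ ^ 2 * ‖ψ x‖ ^ 2) := by
          refine integral_mono (integrable_norm_sq _) (hint.const_mul _) fun x => ?_
          simp only [sub_apply, mulS_apply]
          have : ψ x - η x * ψ x = (1 - η x) * ψ x := by ring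
          rw [this, norm_mul, mul_pow]
          have h1 := (hη x).1
          calc ‖1 - η x‖ ^ 2 * ‖ψ x‖ ^ 2 ≤ (‖x‖ / R) ^ 2 * ‖ψ x‖ ^ 2 := by gcongr
            _ = _ := by rw [div_pow]; ring
      _ = (1 / R ^ 2) * ∫ x, ‖x‖ ^ 2 * ‖ψ x‖ ^ 2 := integral_const_mul _ _
      _ ≤ (1 / R ^ 2) * q ^ 2 := by gcongr
      _ = q ^ 2 / R ^ 2 := by ring
  have hnx : ∀ ψ : 𝓢(V n, ℂ), Integrable (fun x => ‖x‖ ^ 2 * ‖ψ x‖ ^ 2) := fun ψ => by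
    have ht : Function.HasTemperateGrowth fun x : V n => (((‖x‖ ^ 2 : ℝ)) : ℂ) :=
      Function.Complex.hasTemperateGrowth_ofReal.comp (Function.hasTemperateGrowth_norm_sq (V n))
    exact integrable_pot ht ψ
  set t := ‖(schrForm hW hW0).j φ‖
  have ht : t ^ 2 = _ := norm_schrForm_sq hW hW0 φ
  have hpot : 0 ≤ ∫ x, W x * ‖φ x‖ ^ 2 :=
    integral_nonneg fun x => mul_nonneg (hW0 x) (sq_nonneg _)
  have hgr : 0 ≤ ∑ i, ‖ioS (pd i φ)‖ ^ 2 := Finset.sum_nonneg fun i _ => sq_nonneg _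
  have ht0 : 0 ≤ t := norm_nonneg _
  have hA : ‖ioS (𝓕 φ - mulS η (𝓕 φ))‖ ≤ t / R := by
    refine hlow _ _ (hnx _) ((fourier_norm_le φ).trans ?_) ht0
    rw [ht]
    linarith [sq_nonneg ‖ioS φ‖]
  have hBd : ‖ioS (φ - mulS η φ)‖ ≤ (√c * t) / R := by
    refine hlow _ _ (hnx _) ?_ (by positivity)
    rw [mul_pow, Real.sq_sqrt hc0, ht]
    calc ∫ x, ‖x‖ ^ 2 * ‖φ x‖ ^ 2 ≤ ∫ x, c * (W x * ‖φ x‖ ^ 2 + ‖φ x‖ ^ 2) := by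
          refine integral_mono (hnx φ)
            (((integrable_pot hW φ).add (integrable_norm_sq φ)).const_mul c) fun x => ?_
          calc ‖x‖ ^ 2 * ‖φ x‖ ^ 2 ≤ (c * (W x + 1)) * ‖φ x‖ ^ 2 := by gcongr; exact hc x
            _ = _ := by ring
      _ = c * ((∫ x, W x * ‖φ x‖ ^ 2) + ‖ioS φ‖ ^ 2) := by
          rw [integral_const_mul, integral_add (integrable_pot hW φ) (integrable_norm_sq φ),
            norm_ioS_sq]
      _ ≤ _ := mul_le_mul_of_nonneg_left (by linarith) hc0
  have hsplit : 𝓕 φ - mulS η (𝓕 (mulS η φ)) =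
      (𝓕 φ - mulS η (𝓕 φ)) + mulS η (𝓕 (φ - mulS η φ)) := by
    have : 𝓕 (φ - mulS η φ) = 𝓕 φ - 𝓕 (mulS η φ) :=
      map_sub (FourierTransform.fourierCLE ℂ 𝓢(V n, ℂ)) _ _
    rw [this, map_sub]
    abel
  have hC : ‖ioS (mulS η (𝓕 (φ - mulS η φ)))‖ ≤ 1 * ‖ioS (𝓕 (φ - mulS η φ))‖ :=
    norm_ioS_le fun x => by
      rw [mulS_apply, norm_mul]
      gcongr
      exact (hη x).2
  have hD : ‖ioS (𝓕 (φ - mulS η φ))‖ = ‖ioS (φ - mulS η φ)‖ :=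
    SchwartzMap.norm_fourier_toL2_eq _
  change ‖ioS φ - FT.symm (N (ioS φ))‖ ≤ ε * t
  rw [h0, ← map_sub, hsplit, map_add]
  calc _ ≤ t / R + (√c * t) / R := by
        refine (norm_add_le _ _).trans (add_le_add hA ?_)
        rw [one_mul, hD] at hC
        exact hC.trans hBd
    _ = (1 + √c) / R * t := by ring
    _ ≤ ε * t := by gcongr

include hW hW0 in
-- The difference of the two sides is orthogonal to the range of 1 - Δ + W, so essential
-- self-adjointness kills it. This promotes a distributional eigenvector to an eigenvector of the
-- resolvent.
theorem resolvent_eigen {h : L2 (V n)} {ν : ℝ}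
    (hh : ∀ φ, inner ℂ h (schrA W φ) = ((ν + 1 : ℝ) : ℂ) * inner ℂ h (ioS φ)) :
    h = ((ν + 1 : ℝ) : ℂ) • (schrForm hW hW0).resolvent h := by
  rw [← sub_eq_zero]
  refine eq_zero_of_orthogonal hW hW0 fun φ => ?_
  rw [inner_sub_left, inner_smul_left, FormCompletion.inner_resolvent, hh, Complex.conj_ofReal,
    sub_self]

include hW hW0 in
/-- Weak eigenvectors with distinct eigenvalues are orthogonal. -/
theorem inner_eq_zero_of_eigen {h g : L2 (V n)} {ν μ : ℝ} (hne : ν ≠ μ)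
    (hh : ∀ φ, inner ℂ h (schrA W φ) = ((ν + 1 : ℝ) : ℂ) * inner ℂ h (ioS φ))
    (hg : ∀ φ, inner ℂ g (schrA W φ) = ((μ + 1 : ℝ) : ℂ) * inner ℂ g (ioS φ)) :
    inner ℂ h g = 0 := by
  have h1 := resolvent_eigen hW hW0 hh
  have h2 := resolvent_eigen hW hW0 hg
  set R := (schrForm hW hW0).resolvent
  have h3 : inner ℂ h g = ((ν + 1 : ℝ) : ℂ) * inner ℂ (R h) g := by
    conv_lhs => rw [h1]
    rw [inner_smul_left, Complex.conj_ofReal]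
  have h4 : inner ℂ h g = ((μ + 1 : ℝ) : ℂ) * inner ℂ (R h) g := by
    conv_lhs => rw [h2]
    rw [inner_smul_right, ← (schrForm hW hW0).resolvent_symm]
  have h5 : ((ν : ℂ) - μ) * inner ℂ (R h) g = 0 := by
    have := h3.symm.trans h4
    push_cast at this
    linear_combination this
  have h6 : (ν : ℂ) - μ ≠ 0 := sub_ne_zero.mpr (by exact_mod_cast hne)
  rw [h3, (mul_eq_zero.mp h5).resolve_left h6, mul_zero]

include hW hW0 in
/-- A confining Schrödinger operator has a countable Hilbert basis of eigenvectors. -/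
theorem exists_eigenbasis {c : ℝ} (hc : ∀ x, ‖x‖ ^ 2 ≤ c * (W x + 1)) :
    ∃ (ι : Type) (_ : Countable ι) (b : HilbertBasis ι ℂ (L2 (V n))) (ν : ι → ℝ),
      ∀ i φ, inner ℂ (b i) (schrA W φ) = ((ν i + 1 : ℝ) : ℂ) * inner ℂ (b i) (ioS φ) := by
  obtain ⟨ι, hι, b, μ, hb⟩ := exists_hilbertBasis_eigenvectors (schrForm hW hW0).resolvent
    (isCompactOperator_schr_resolvent hW hW0 hc) (schrForm hW hW0).resolvent_symm (fun u hu => by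
      have h1 : ∀ φ, inner ℂ u (ioS φ) = 0 := fun φ => by
        rw [← (schrForm hW hW0).inner_resolvent, hu, inner_zero_left]
      exact denseRange_ioS.eq_zero_of_inner_left ℂ h1)
  -- The resolvent inverts 1 - Δ + W, whence the inverse and the shift by one.
  refine ⟨ι, hι, b, fun i => (μ i)⁻¹ - 1, fun i φ => ?_⟩
  obtain ⟨h1, h2⟩ := hb i
  have h3 := (schrForm hW hW0).inner_resolvent (b i) φ
  rw [h2, inner_smul_left, Complex.conj_ofReal] at h3
  have h4 : (μ i : ℂ) ≠ 0 := by exact_mod_cast h1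
  rw [← h3]
  push_cast
  field_simp
  ring

end Schroedinger

/-! ### Homogeneity and growth of the potentials. -/

section Potential

variable {n₁ n₂ : ℕ}

theorem potential_nonneg (p : PotentialType) (κ : ℕ) (x : V n₁) : 0 ≤ potential p κ x := by
  cases p with
  | radial => exact pow_nonneg (norm_nonneg _) _
  | separable => exact Finset.sum_nonneg fun j _ => (even_two_mul κ).pow_nonneg _

theorem potential_smul (p : PotentialType) (κ : ℕ) (t : ℝ) (x : V n₁) :
    potential p κ (t • x) = t ^ (2 * κ) * potential p κ x := by
  cases p with
  | radial =>
    simp only [potential, norm_smul, mul_pow, Real.norm_eq_abs]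
    rw [pow_mul |t|, sq_abs, ← pow_mul]
  | separable => simp [potential, mul_pow, Finset.mul_sum]

theorem potential_hasTemperateGrowth (p : PotentialType) (κ : ℕ) :
    (fun x : V n₁ => potential p κ x).HasTemperateGrowth := by
  cases p with
  | radial =>
    simp only [potential, pow_mul]
    exact (Function.hasTemperateGrowth_norm_sq (V n₁)).pow κ
  | separable =>
    simp only [potential]
    refine Function.HasTemperateGrowth.sum fun j _ => ?_
    exact (EuclideanSpace.proj (𝕜 := ℝ) j : V n₁ →L[ℝ] ℝ).hasTemperateGrowth.pow _

theorem scaledPotential_hasTemperateGrowth (p : PotentialType) (κ : ℕ) (a : ℝ) :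
    Function.HasTemperateGrowth fun x : V n₁ => ((a * potential p κ x : ℝ) : ℂ) :=
  Function.Complex.hasTemperateGrowth_ofReal.comp
    ((Function.HasTemperateGrowth.const a).mul (potential_hasTemperateGrowth p κ))

/-- From a ≤ a^κ + 1 with a = |x|², or with a = x_i² for each i; in the second case n₁ ones add up,
hence the constant. -/
theorem norm_sq_le_potential (p : PotentialType) {κ : ℕ} (hκ : 1 ≤ κ) (x : V n₁) :
    ‖x‖ ^ 2 ≤ ((n₁ : ℝ) + 1) * (potential p κ x + 1) := by
  have key : ∀ a : ℝ, 0 ≤ a → a ≤ a ^ κ + 1 := fun a ha => by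
    rcases le_total a 1 with h | h
    · have := pow_nonneg ha κ
      linarith
    · have := le_self_pow₀ h (by omega : κ ≠ 0)
      linarith
  have hn : (0 : ℝ) ≤ n₁ := Nat.cast_nonneg _
  have hp := potential_nonneg p κ x
  cases p with
  | radial =>
    have h := key (‖x‖ ^ 2) (sq_nonneg _)
    simp only [potential] at *
    rw [← pow_mul] at h
    nlinarith
  | separable =>
    rw [EuclideanSpace.real_norm_sq_eq]
    have h : ∑ i, x i ^ 2 ≤ ∑ i : Fin n₁, (x i ^ (2 * κ) + 1) :=
      Finset.sum_le_sum fun i _ => by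
        rw [pow_mul]
        exact key _ (sq_nonneg _)
    rw [Finset.sum_add_distrib] at h
    simp only [potential] at *
    simp at h
    nlinarith

end Potential

/-! ### Weak eigenvectors and dilations of test functions. -/

section Eigenvectors

open scoped LineDeriv Laplacian

variable {n : ℕ}

/-- Complex conjugation of Schwartz functions. -/
def conjS (φ : 𝓢(V n, ℂ)) : 𝓢(V n, ℂ) :=
  SchwartzMap.postcompCLM (𝕜 := ℝ) (Complex.conjCLE : ℂ →L[ℝ] ℂ) φ

theorem conjS_apply (φ : 𝓢(V n, ℂ)) (x : V n) : conjS φ x = (starRingEnd ℂ) (φ x) := rfl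

theorem conjS_conjS (φ : 𝓢(V n, ℂ)) : conjS (conjS φ) = φ := by
  ext x
  simp [conjS_apply]

theorem laplacian_conjS (φ : 𝓢(V n, ℂ)) (x : V n) :
    (Δ (conjS φ)) x = (starRingEnd ℂ) ((Δ φ) x) := by
  rw [SchwartzMap.laplacian_apply, SchwartzMap.laplacian_apply]
  exact congrFun (InnerProductSpace.laplacian_CLE_comp_left (f := (φ : V n → ℂ))
    (l := Complex.conjCLE)) x

/-- The eigenvalue equation pairs bilinearly, the inner product sesquilinearly. Conjugating test
functions passes between the two, and is harmless because Δ, W and ν are real. -/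
theorem integral_mul_eq (h : L2 (V n)) (φ : 𝓢(V n, ℂ)) :
    ∫ x, h x * φ x = (starRingEnd ℂ) (inner ℂ h (ioS (conjS φ))) := by
  rw [L2.inner_def, ← integral_conj]
  refine integral_congr_ae ?_
  filter_upwards [ioS_ae (conjS φ)] with x hx
  rw [hx, conjS_apply]
  simp
  ring

/-- The weak eigenvalue equation in terms of the operator `1 - Δ + W`. -/
theorem isEigenvector_iff {n₂ : ℕ} (p : PotentialType) (κ : ℕ) (lam : V n₂) (ν : ℝ)
    (h : L2 (V n)) : IsEigenvector p κ lam ν h ↔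
      ∀ φ, inner ℂ h (schrA (fun x => ‖lam‖ ^ 2 * potential p κ x) φ) =
        ((ν + 1 : ℝ) : ℂ) * inner ℂ h (ioS φ) := by
  set W : V n → ℝ := fun x => ‖lam‖ ^ 2 * potential p κ x
  have hW : Function.HasTemperateGrowth fun x => (W x : ℂ) :=
    scaledPotential_hasTemperateGrowth p κ _
  have h1 : ∀ φ : 𝓢(V n, ℂ), ∫ x, h x * (-(Laplacian.laplacian (φ : V n → ℂ) x)
        + ((‖lam‖ ^ 2 * potential p κ x : ℝ) : ℂ) * φ x) =
      (starRingEnd ℂ) (inner ℂ h (schrA W (conjS φ)) - inner ℂ h (ioS (conjS φ))) := fun φ => by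
    have e1 : schrS W (conjS φ) - conjS φ = conjS (schrS W φ - φ) := by
      ext x
      simp only [schrS_eq, sub_apply, add_apply, conjS_apply, laplacian_conjS, potS_apply hW]
      simp
    rw [schrA, LinearMap.comp_apply, ← inner_sub_right, ← map_sub, e1, ← integral_mul_eq]
    refine integral_congr_ae (Eventually.of_forall fun x => ?_)
    simp only [schrS_eq, sub_apply, add_apply, potS_apply hW, SchwartzMap.laplacian_apply]
    ring
  have h2 : ∀ φ : 𝓢(V n, ℂ), (∫ x, h x * (-(Laplacian.laplacian (φ : V n → ℂ) x)
        + ((‖lam‖ ^ 2 * potential p κ x : ℝ) : ℂ) * φ x) = (ν : ℂ) * ∫ x, h x * φ x) ↔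
      inner ℂ h (schrA W (conjS φ)) = ((ν + 1 : ℝ) : ℂ) * inner ℂ h (ioS (conjS φ)) := fun φ => by
    rw [h1, integral_mul_eq]
    have : (ν : ℂ) = (starRingEnd ℂ) ν := (Complex.conj_ofReal ν).symm
    conv_lhs => rw [this]
    rw [← map_mul, (starRingEnd ℂ).injective.eq_iff, sub_eq_iff_eq_add]
    push_cast
    rw [add_mul, one_mul]
  constructor
  · intro hh φ
    have := (h2 (conjS φ)).mp (hh _)
    rwa [conjS_conjS] at this
  · intro hh φ
    exact (h2 φ).mpr (hh _)

/-- Dilation of Schwartz functions. -/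
def dilS (a : ℝ) (ha : a ≠ 0) : 𝓢(V n, ℂ) →L[ℂ] 𝓢(V n, ℂ) :=
  SchwartzMap.compCLMOfContinuousLinearEquiv ℂ (ContinuousLinearEquiv.smulLeft (Units.mk0 a ha))

theorem dilS_apply (a : ℝ) (ha : a ≠ 0) (φ : 𝓢(V n, ℂ)) (x : V n) : dilS a ha φ x = φ (a • x) :=
  rfl

theorem pd_dilS (a : ℝ) (ha : a ≠ 0) (i : Fin n) (φ : 𝓢(V n, ℂ)) :
    pd i (dilS a ha φ) = a • dilS a ha (pd i φ) := by
  ext x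
  simp only [pd, dilS]
  rw [SchwartzMap.lineDerivOp_compCLMOfContinuousLinearEquiv]
  have : (ContinuousLinearEquiv.smulLeft (Units.mk0 a ha) : V n ≃L[ℝ] V n)
      (EuclideanSpace.basisFun (Fin n) ℝ i) = a • EuclideanSpace.basisFun (Fin n) ℝ i := rfl
  rw [this, LineDeriv.lineDerivOp_left_smul]
  simp

theorem laplacian_dilS (a : ℝ) (ha : a ≠ 0) (φ : 𝓢(V n, ℂ)) (x : V n) :
    (Δ (dilS a ha φ)) x = ((a ^ 2 : ℝ) : ℂ) * (Δ φ) (a • x) := by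
  have h1 : ∀ i, ∀ (ψ : 𝓢(V n, ℂ)), pd i (a • ψ) = a • pd i ψ := fun i ψ =>
    LineDeriv.lineDerivOp_smul _ _ _
  rw [laplacian_eq, laplacian_eq, sum_apply, sum_apply, Finset.mul_sum]
  refine Finset.sum_congr rfl fun i _ => ?_
  rw [pd_dilS, h1, pd_dilS, smul_apply, smul_apply, dilS_apply, smul_smul, ← sq]
  rfl

end Eigenvectors

/-! ### Unitary dilations of L² and of eigenbases. -/

section Dilation

open scoped Laplacian

variable {n : ℕ}

/-- The `L²`-normalized dilation of a function. -/
def dil (t : ℝ) (u : V n → ℂ) (x : V n) : ℂ := ((t ^ ((n : ℝ) / 2) : ℝ) : ℂ) * u (t • x)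

theorem memLp_comp_smul {t : ℝ} (ht : 0 < t) (h : L2 (V n)) :
    MemLp (fun x => h (t • x)) 2 (volume : Measure (V n)) := by
  have hmap : Measure.map (fun x : V n => t • x) volume =
      ENNReal.ofReal |(t ^ Module.finrank ℝ (V n))⁻¹| • volume :=
    Measure.map_addHaar_smul volume ht.ne'
  have h1 : MemLp h 2 (Measure.map (fun x : V n => t • x) volume) := by
    rw [hmap]
    exact (Lp.memLp h).smul_measure ENNReal.ofReal_ne_top
  exact h1.comp_of_map (measurable_const_smul t).aemeasurable

theorem memLp_dil {t : ℝ} (ht : 0 < t) (h : L2 (V n)) :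
    MemLp (dil t h) 2 (volume : Measure (V n)) :=
  (memLp_comp_smul ht h).const_mul _

/-- The dilation of an element of `L²`. -/
def dilL2 {t : ℝ} (ht : 0 < t) (h : L2 (V n)) : L2 (V n) := (memLp_dil ht h).toLp

theorem dilL2_ae {t : ℝ} (ht : 0 < t) (h : L2 (V n)) : dilL2 ht h =ᵐ[volume] dil t h :=
  (memLp_dil ht h).coeFn_toLp

theorem rpow_half_sq {t : ℝ} (ht : 0 < t) : t ^ ((n : ℝ) / 2) * t ^ ((n : ℝ) / 2) = t ^ n := by
  rw [← Real.rpow_add ht, add_halves, Real.rpow_natCast]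

theorem integral_comp_smul_pos {t : ℝ} (ht : 0 < t) (u : V n → ℂ) :
    ∫ x, u (t • x) = ((t ^ n)⁻¹ : ℝ) * ∫ x, u x := by
  rw [Measure.integral_comp_smul, abs_of_pos (by positivity), finrank_euclideanSpace_fin]
  rfl

theorem inner_dilL2 {t : ℝ} (ht : 0 < t) (h g : L2 (V n)) :
    inner ℂ (dilL2 ht h) (dilL2 ht g) = inner ℂ h g := by
  have h1 : inner ℂ (dilL2 ht h) (dilL2 ht g) =
      ∫ x, (t ^ n : ℝ) * (fun y => inner ℂ (h y) (g y)) (t • x) := by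
    rw [L2.inner_def]
    refine integral_congr_ae ?_
    filter_upwards [dilL2_ae ht h, dilL2_ae ht g] with x e1 e2
    rw [e1, e2, dil, dil, ← rpow_half_sq ht]
    simp
    ring
  rw [h1, integral_const_mul, integral_comp_smul_pos ht fun y => inner ℂ (h y) (g y), L2.inner_def, ← mul_assoc,
    ← Complex.ofReal_mul, mul_inv_cancel₀ (by positivity), Complex.ofReal_one, one_mul]

theorem inner_dilL2_left {t : ℝ} (ht : 0 < t) (h g : L2 (V n)) :
    inner ℂ (dilL2 ht h) g = inner ℂ h (dilL2 (inv_pos.mpr ht) g) := by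
  have h1 : inner ℂ (dilL2 ht h) g = ∫ x, ((t ^ ((n : ℝ) / 2) : ℝ) : ℂ) *
      (fun y => inner ℂ (h y) (g (t⁻¹ • y))) (t • x) := by
    rw [L2.inner_def]
    refine integral_congr_ae ?_
    filter_upwards [dilL2_ae ht h] with x e1
    rw [e1, dil]
    simp [smul_smul, inv_mul_cancel₀ ht.ne']
    ring
  have h2 : inner ℂ h (dilL2 (inv_pos.mpr ht) g) = ∫ x, ((t⁻¹ ^ ((n : ℝ) / 2) : ℝ) : ℂ) *
      (fun y => inner ℂ (h y) (g (t⁻¹ • y))) x := by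
    rw [L2.inner_def]
    refine integral_congr_ae ?_
    filter_upwards [dilL2_ae (inv_pos.mpr ht) g] with x e1
    rw [e1, dil]
    simp
    ring
  rw [h1, h2, integral_const_mul, integral_const_mul,
    integral_comp_smul_pos ht fun y => inner ℂ (h y) (g (t⁻¹ • y)), ← mul_assoc, ← Complex.ofReal_mul]
  congr 2
  rw [← rpow_half_sq ht, Real.inv_rpow ht.le, mul_inv, ← mul_assoc, mul_inv_cancel₀ (by positivity),
    one_mul]

theorem dilL2_eq_zero {t : ℝ} (ht : 0 < t) {h : L2 (V n)} (h0 : dilL2 ht h = 0) : h = 0 := by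
  have := inner_dilL2 ht h h
  rw [h0, inner_zero_left] at this
  exact inner_self_eq_zero.mp this.symm

/-- The dilation of a Hilbert basis. -/
def dilBasis {ι : Type} {t : ℝ} (ht : 0 < t) (b : HilbertBasis ι ℂ (L2 (V n))) :
    HilbertBasis ι ℂ (L2 (V n)) :=
  HilbertBasis.mkOfOrthogonalEqBot (v := fun k => dilL2 ht (b k))
    (by
      classical
      rw [orthonormal_iff_ite]
      intro i j
      rw [inner_dilL2]
      exact orthonormal_iff_ite.mp b.orthonormal i j)
    (by
      rw [eq_bot_iff]
      intro g hg
      rw [Submodule.mem_orthogonal] at hg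
      have h1 : ∀ k, inner ℂ (b k) (dilL2 (inv_pos.mpr ht) g) = 0 := fun k => by
        rw [← inner_dilL2_left ht]
        exact hg _ (Submodule.subset_span ⟨k, rfl⟩)
      have h2 : dilL2 (inv_pos.mpr ht) g = 0 := by
        have h3 := b.hasSum_repr (dilL2 (inv_pos.mpr ht) g)
        simp only [b.repr_apply_apply, h1, zero_smul] at h3
        exact h3.unique hasSum_zero
      exact dilL2_eq_zero _ h2)

theorem dilBasis_apply {ι : Type} {t : ℝ} (ht : 0 < t) (b : HilbertBasis ι ℂ (L2 (V n))) (k : ι) :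
    dilBasis ht b k = dilL2 ht (b k) := by
  rw [dilBasis, HilbertBasis.coe_mkOfOrthogonalEqBot]

/-- Dilations map eigenvectors to eigenvectors. -/
theorem isEigenvector_dilL2 {n₂ : ℕ} {p : PotentialType} {κ : ℕ} {lam₀ lam : V n₂} {ν t : ℝ}
    (ht : 0 < t) (hlam₀ : ‖lam₀‖ = 1) (hlam : ‖lam‖ = t ^ (κ + 1)) {h : L2 (V n)}
    (hh : IsEigenvector p κ lam₀ ν h) : IsEigenvector p κ lam (t ^ 2 * ν) (dilL2 ht h) := by
  intro φ
  -- With ψ(tx) = φ(x), the Laplacian at tx carries t⁻² and the potential t^{2κ}; since |λ|² =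
  -- t^{2κ+2}, the common factor t² comes out of both terms.
  let ψ : 𝓢(V n, ℂ) := dilS t⁻¹ (inv_ne_zero ht.ne') φ
  have hψ : ∀ x, ψ (t • x) = φ x := fun x => by
    simp only [ψ]
    rw [dilS_apply, smul_smul, inv_mul_cancel₀ ht.ne', one_smul]
  have hΔψ : ∀ x, (Δ (ψ : V n → ℂ)) (t • x) = ((t⁻¹ ^ 2 : ℝ) : ℂ) * (Δ (φ : V n → ℂ)) x := fun x => by
    rw [← SchwartzMap.laplacian_apply, ← SchwartzMap.laplacian_apply, laplacian_dilS, smul_smul,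
      inv_mul_cancel₀ ht.ne', one_smul]
  have h1 := hh ψ
  have h2 : ∫ x, dilL2 ht h x * φ x =
      (((t ^ ((n : ℝ) / 2) : ℝ) : ℂ) * ((t ^ n)⁻¹ : ℝ)) * ∫ x, h x * ψ x := by
    rw [mul_assoc, ← integral_comp_smul_pos ht, ← integral_const_mul]
    refine integral_congr_ae ?_
    filter_upwards [dilL2_ae ht h] with x e1
    rw [e1, dil, hψ]
    ring
  have h3 : ∫ x, dilL2 ht h x * (-(Δ (φ : V n → ℂ) x)
        + ((‖lam‖ ^ 2 * potential p κ x : ℝ) : ℂ) * φ x) =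
      (((t ^ ((n : ℝ) / 2) : ℝ) : ℂ) * ((t ^ n)⁻¹ : ℝ)) * ((t ^ 2 : ℝ) *
        ∫ x, h x * (-(Δ (ψ : V n → ℂ) x) + ((‖lam₀‖ ^ 2 * potential p κ x : ℝ) : ℂ) * ψ x)) := by
    rw [mul_assoc, mul_left_comm (((t ^ n)⁻¹ : ℝ) : ℂ), ← integral_comp_smul_pos ht,
      ← integral_const_mul, ← integral_const_mul]
    refine integral_congr_ae ?_
    filter_upwards [dilL2_ae ht h] with x e1
    rw [e1, dil, hψ, hΔψ, hlam, hlam₀, potential_smul]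
    have ht' : (t : ℂ) ≠ 0 := by exact_mod_cast ht.ne'
    push_cast
    field_simp
    ring
  rw [h2, h3, h1]
  push_cast
  ring

end Dilation

/-! ### Projections of the fibre operators in an eigenbasis. -/

section Fiber

variable {n₁ n₂ : ℕ}

/-- In terms of an eigenbasis, the fiber projection selects the coordinates with eigenvalue in
the given set. -/
theorem hasSum_inner_fiberProj (p : PotentialType) (κ : ℕ) (I : Set ℝ) (lam : V n₂) {ι : Type}
    (b : HilbertBasis ι ℂ (L2 (V n₁))) (ν : ι → ℝ) (hb : ∀ k, IsEigenvector p κ lam (ν k) (b k))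
    (G F : L2 (V n₁)) :
    HasSum ({k | ν k ∈ I}.indicator fun k => inner ℂ G (b k) * inner ℂ (b k) F)
      (inner ℂ G (fiberProj p κ I lam F)) := by
  refine hasSum_inner_starProjection b _ _ (fun k hk => ?_) (fun k hk => ?_) G F
  · exact Submodule.le_topologicalClosure _ (Submodule.subset_span ⟨ν k, hk, hb k⟩)
  · rw [Submodule.orthogonal_closure, Submodule.mem_orthogonal]
    intro u hu
    induction hu using Submodule.span_induction with
    | mem u hu =>
      obtain ⟨μ, hμ, hu⟩ := hu
      have hne : μ ≠ ν k := fun h => hk (show ν k ∈ I from h ▸ hμ)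
      exact inner_eq_zero_of_eigen (scaledPotential_hasTemperateGrowth p κ _)
        (fun x => mul_nonneg (sq_nonneg _) (potential_nonneg p κ x)) hne
        ((isEigenvector_iff p κ lam μ u).mp hu) ((isEigenvector_iff p κ lam _ _).mp (hb k))
    | zero => exact inner_zero_left _
    | add u v _ _ hu hv => rw [inner_add_left, hu, hv, add_zero]
    | smul c u _ hu => rw [inner_smul_left, hu, mul_zero]

theorem exists_eigenbasis_unit (p : PotentialType) {κ : ℕ} (hκ : 1 ≤ κ) (lam₀ : V n₂)
    (hlam₀ : ‖lam₀‖ = 1) : ∃ (ι : Type) (_ : Countable ι) (b : HilbertBasis ι ℂ (L2 (V n₁)))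
      (ν : ι → ℝ), ∀ k, IsEigenvector p κ lam₀ (ν k) (b k) := by
  obtain ⟨ι, hι, b, ν, hb⟩ := exists_eigenbasis (n := n₁)
    (scaledPotential_hasTemperateGrowth p κ (‖lam₀‖ ^ 2))
    (fun x => mul_nonneg (sq_nonneg _) (potential_nonneg p κ x)) (c := (n₁ : ℝ) + 1) (fun x => by
      rw [hlam₀, one_pow, one_mul]
      exact norm_sq_le_potential p hκ x)
  exact ⟨ι, hι, b, ν, fun k => (isEigenvector_iff p κ lam₀ _ _).mpr (hb k)⟩

end Fiber

/-! ### The partial Fourier transform on Schwartz functions. -/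

section PartialFourier

open scoped FourierTransform

variable {n₁ n₂ : ℕ}

theorem exists_decay (f : 𝓢(Sp n₁ n₂, ℂ)) (a b : ℕ) : ∃ C : ℝ, 0 ≤ C ∧ ∀ x' x'',
    ‖f (x', x'')‖ ≤ C * (((1 + ‖x'‖) ^ a)⁻¹ * ((1 + ‖x''‖) ^ b)⁻¹) := by
  refine ⟨2 ^ (a + b) * ((Finset.Iic (a + b, 0)).sup
    (fun m => SchwartzMap.seminorm ℂ m.1 m.2)) f, by positivity, fun x' x'' => ?_⟩
  have h := SchwartzMap.one_add_le_sup_seminorm_apply (𝕜 := ℂ) (m := (a + b, 0)) (k := a + b)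
    (n := 0) le_rfl le_rfl f (x', x'')
  rw [norm_iteratedFDeriv_zero] at h
  have h1 : ‖x'‖ ≤ ‖(x', x'')‖ := norm_fst_le (x', x'')
  have h2 : ‖x''‖ ≤ ‖(x', x'')‖ := norm_snd_le (x', x'')
  rw [← mul_inv, ← div_eq_mul_inv, le_div_iff₀ (by positivity)]
  refine le_trans ?_ h
  rw [mul_comm, pow_add]
  gcongr

/-- The restriction of a Schwartz function to `{x'} × ℝ^{n₂}`. -/
def sliceS (f : 𝓢(Sp n₁ n₂, ℂ)) (x' : V n₁) : 𝓢(V n₂, ℂ) :=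
  SchwartzMap.compCLM ℂ (g := fun x'' : V n₂ => ((x', x'') : Sp n₁ n₂))
    (by
      have h : (fun x'' : V n₂ => ((x', x'') : Sp n₁ n₂)) =
          fun x'' => ((x', 0) : Sp n₁ n₂) + ContinuousLinearMap.inr ℝ (V n₁) (V n₂) x'' := by
        ext x'' <;> simp
      rw [h]
      exact (Function.HasTemperateGrowth.const _).add
        (ContinuousLinearMap.inr ℝ (V n₁) (V n₂)).hasTemperateGrowth)
    ⟨1, 1, fun x'' => by
      have := norm_snd_le ((x', x'') : Sp n₁ n₂)
      simp only [pow_one, one_mul]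
      linarith⟩ f

theorem sliceS_apply (f : 𝓢(Sp n₁ n₂, ℂ)) (x' : V n₁) (x'' : V n₂) :
    sliceS f x' x'' = f (x', x'') := rfl

theorem partialFourier_eq (f : 𝓢(Sp n₁ n₂, ℂ)) (lam : V n₂) (x' : V n₁) :
    partialFourier f lam x' =
      (((2 * Real.pi) ^ n₂ : ℝ) : ℂ)⁻¹ * 𝓕 (sliceS f x') (-(2 * Real.pi)⁻¹ • lam) := by
  rw [partialFourier, SchwartzMap.fourier_coe, Real.fourier_eq']
  congr 1
  refine integral_congr_ae (Eventually.of_forall fun x'' => ?_)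
  simp only [sliceS_apply]
  rw [smul_eq_mul, mul_comm, mul_comm Complex.I]
  congr 4
  rw [inner_smul_right, real_inner_comm]
  have := Real.pi_pos
  field_simp

theorem continuous_partialFourier_integrand (f : 𝓢(Sp n₁ n₂, ℂ)) :
    Continuous fun q : (V n₂ × V n₁) × V n₂ =>
      f (q.1.2, q.2) * Complex.exp (Complex.I * ((inner ℝ q.1.1 q.2 : ℝ) : ℂ)) := by
  have h1 := f.continuous
  have h2 : Continuous fun q : (V n₂ × V n₁) × V n₂ => inner ℝ q.1.1 q.2 :=
    (continuous_fst.comp continuous_fst).inner continuous_snd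
  fun_prop

theorem stronglyMeasurable_partialFourier (f : 𝓢(Sp n₁ n₂, ℂ)) :
    StronglyMeasurable (Function.uncurry (partialFourier (f : Sp n₁ n₂ → ℂ))) := by
  have h := (continuous_partialFourier_integrand f).stronglyMeasurable.integral_prod_right'
    (ν := volume)
  exact h.const_mul ((((2 * Real.pi) ^ n₂ : ℝ) : ℂ)⁻¹)

theorem integrable_inv_pow (n : ℕ) : Integrable fun x : V n => ((1 + ‖x‖) ^ (n + 1))⁻¹ := by
  have h := integrable_one_add_norm (E := V n) (μ := volume) (r := (n : ℝ) + 1) (by simp)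
  refine h.congr (Eventually.of_forall fun x => ?_)
  simp only
  rw [Real.rpow_neg (by positivity)]
  congr 1
  exact_mod_cast Real.rpow_natCast (1 + ‖x‖) (n + 1)

theorem memLp_partialFourier (f : 𝓢(Sp n₁ n₂, ℂ)) (lam : V n₂) :
    MemLp (partialFourier f lam) 2 (volume : Measure (V n₁)) := by
  obtain ⟨C, hC, hf⟩ := exists_decay f (n₁ + 1) (n₂ + 1)
  set D : ℝ := ∫ x'' : V n₂, ((1 + ‖x''‖) ^ (n₂ + 1))⁻¹
  have hg : MemLp (fun x : V n₁ => ((1 + ‖x‖) ^ (n₁ + 1))⁻¹) 2 (volume : Measure (V n₁)) := by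
    rw [memLp_two_iff_integrable_sq (integrable_inv_pow n₁).1]
    refine (integrable_inv_pow n₁).mono' ((integrable_inv_pow n₁).1.pow 2)
      (Eventually.of_forall fun x => ?_)
    have h0 : (0 : ℝ) ≤ ((1 + ‖x‖) ^ (n₁ + 1))⁻¹ := by positivity
    have h1 : ((1 + ‖x‖) ^ (n₁ + 1))⁻¹ ≤ (1 : ℝ) :=
      inv_le_one_of_one_le₀ (one_le_pow₀ (by linarith [norm_nonneg x]))
    rw [Real.norm_of_nonneg (by positivity), sq]
    exact mul_le_of_le_one_left h0 h1
  refine MemLp.of_le_mul (c := ((2 * Real.pi) ^ n₂)⁻¹ * (C * D)) hg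
    ((stronglyMeasurable_partialFourier f).comp_measurable
      (measurable_prodMk_left (x := lam))).aestronglyMeasurable (Eventually.of_forall fun x' => ?_)
  rw [partialFourier, norm_mul, norm_inv, Complex.norm_real, Real.norm_of_nonneg (by positivity),
    mul_assoc]
  gcongr
  have h0 : (0 : ℝ) ≤ ((1 + ‖x'‖) ^ (n₁ + 1))⁻¹ := by positivity
  rw [Real.norm_of_nonneg h0]
  calc ‖∫ x'' : V n₂, f (x', x'') * Complex.exp (Complex.I * ((inner ℝ lam x'' : ℝ) : ℂ))‖
      ≤ ∫ x'' : V n₂, C * ((1 + ‖x'‖) ^ (n₁ + 1))⁻¹ * ((1 + ‖x''‖) ^ (n₂ + 1))⁻¹ := by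
        refine norm_integral_le_of_norm_le ((integrable_inv_pow n₂).const_mul _)
          (Eventually.of_forall fun x'' => ?_)
        rw [norm_mul, mul_comm Complex.I, Complex.norm_exp_ofReal_mul_I, mul_one, mul_assoc]
        exact hf x' x''
    _ = _ := by rw [integral_const_mul]; ring

theorem toL2_partialFourier (f : 𝓢(Sp n₁ n₂, ℂ)) (lam : V n₂) :
    toL2 (partialFourier f lam) = (memLp_partialFourier f lam).toLp := by
  rw [toL2, dif_pos (memLp_partialFourier f lam)]

theorem integrable_partialFourier (f : 𝓢(Sp n₁ n₂, ℂ)) (lam : V n₂) (x' : V n₁) :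
    Integrable fun x'' : V n₂ =>
      f (x', x'') * Complex.exp (Complex.I * ((inner ℝ lam x'' : ℝ) : ℂ)) := by
  refine (sliceS f x').integrable.mono
    (((continuous_partialFourier_integrand f).comp (g := _) (f := fun x'' : V n₂ =>
      (((lam, x'), x'') : (V n₂ × V n₁) × V n₂)) (by fun_prop)).aestronglyMeasurable)
    (Eventually.of_forall fun x'' => ?_)
  rw [norm_mul, mul_comm Complex.I, Complex.norm_exp_ofReal_mul_I, mul_one]
  rfl

theorem partialFourier_add (f g : 𝓢(Sp n₁ n₂, ℂ)) (lam : V n₂) (x' : V n₁) :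
    partialFourier (f + g : 𝓢(Sp n₁ n₂, ℂ)) lam x' =
      partialFourier f lam x' + partialFourier g lam x' := by
  simp only [partialFourier, add_apply, add_mul]
  rw [integral_add (integrable_partialFourier f lam x') (integrable_partialFourier g lam x'),
    mul_add]

theorem partialFourier_smul (c : ℂ) (f : 𝓢(Sp n₁ n₂, ℂ)) (lam : V n₂) (x' : V n₁) :
    partialFourier (c • f : 𝓢(Sp n₁ n₂, ℂ)) lam x' = c * partialFourier f lam x' := by
  simp only [partialFourier, smul_apply, smul_eq_mul, mul_assoc]
  rw [integral_const_mul]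
  ring

/-- Plancherel in x'' for fixed x'. The squared prefactor gives (2π)^{-2n₂}, and rescaling the
frequencies by -(2π)⁻¹ gives back (2π)^{n₂}. -/
theorem lintegral_partialFourier_sq (f : 𝓢(Sp n₁ n₂, ℂ)) (x' : V n₁) :
    ∫⁻ lam : V n₂, ‖partialFourier f lam x'‖ₑ ^ 2 =
      ENNReal.ofReal ((2 * Real.pi) ^ n₂)⁻¹ * ∫⁻ x'' : V n₂, ‖f (x', x'')‖ₑ ^ 2 := by
  have hpi := Real.pi_pos
  have e : ∀ z : ℂ, ‖z‖ₑ ^ 2 = ENNReal.ofReal (‖z‖ ^ 2) := fun z => by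
    rw [← ofReal_norm, ENNReal.ofReal_pow (norm_nonneg _)]
  set a : ℝ := -(2 * Real.pi)⁻¹ with ha
  have ha0 : a ≠ 0 := by simp [ha, hpi.ne']
  have h1 : ∀ lam, ‖partialFourier f lam x'‖ ^ 2 =
      (((2 * Real.pi) ^ n₂)⁻¹) ^ 2 * ‖dilS a ha0 (𝓕 (sliceS f x')) lam‖ ^ 2 := fun lam => by
    rw [partialFourier_eq, norm_mul, norm_inv, Complex.norm_real,
      Real.norm_of_nonneg (by positivity), mul_pow, dilS_apply]
  have h2 : ∫ lam : V n₂, ‖dilS a ha0 (𝓕 (sliceS f x')) lam‖ ^ 2 =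
      (2 * Real.pi) ^ n₂ * ∫ x'', ‖sliceS f x' x''‖ ^ 2 := by
    rw [← SchwartzMap.integral_norm_sq_fourier (sliceS f x')]
    simp only [dilS_apply]
    rw [Measure.integral_comp_smul volume (fun ξ => ‖(𝓕 (sliceS f x') : 𝓢(V n₂, ℂ)) ξ‖ ^ 2) a,
      finrank_euclideanSpace_fin, smul_eq_mul]
    congr 1
    rw [abs_inv, abs_pow, ha, abs_neg, abs_of_pos (by positivity), inv_pow, inv_inv]
  simp only [e, h1]
  rw [← ofReal_integral_eq_lintegral_ofReal ((integrable_norm_sq _).const_mul _)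
    (Eventually.of_forall fun _ => by positivity), integral_const_mul, h2]
  have h3 := ofReal_integral_eq_lintegral_ofReal (integrable_norm_sq (sliceS f x'))
    (Eventually.of_forall fun _ => by positivity)
  simp only [sliceS_apply] at h3
  rw [← h3, ← ENNReal.ofReal_mul (by positivity)]
  congr 1
  simp only [sliceS_apply]
  field_simp

theorem lintegral_norm_toL2_partialFourier (f : 𝓢(Sp n₁ n₂, ℂ)) :
    ∫⁻ lam : V n₂, ‖toL2 (partialFourier f lam)‖ₑ ^ 2 =
      ENNReal.ofReal ((2 * Real.pi) ^ n₂)⁻¹ * ‖f.toLp 2 volume‖ₑ ^ 2 := by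
  have hsq : ∀ {α : Type} [MeasureSpace α] (g : L2 α) (u : α → ℂ), g =ᵐ[volume] u →
      ‖g‖ₑ ^ 2 = ∫⁻ x, ‖u x‖ₑ ^ 2 := fun g u hu => by
    rw [Lp.enorm_def, eLpNorm_eq_lintegral_rpow_enorm_toReal (by norm_num) (by norm_num),
      ← ENNReal.rpow_natCast, ← ENNReal.rpow_mul]
    norm_num
    exact lintegral_congr_ae (hu.mono fun x hx => by simp only [hx])
  have h1 : ∀ lam, ‖toL2 (partialFourier f lam)‖ₑ ^ 2 =
      ∫⁻ x', ‖partialFourier f lam x'‖ₑ ^ 2 := fun lam => by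
    rw [toL2_partialFourier]
    exact hsq _ _ (memLp_partialFourier f lam).coeFn_toLp
  simp only [h1]
  have hm : Measurable fun q : V n₂ × V n₁ => ‖partialFourier f q.1 q.2‖ₑ ^ 2 :=
    (stronglyMeasurable_partialFourier f).enorm.pow_const 2
  rw [lintegral_lintegral_swap hm.aemeasurable]
  simp only [lintegral_partialFourier_sq]
  have hm2 : Measurable fun x : Sp n₁ n₂ => ‖f x‖ₑ ^ 2 := by
    have := f.continuous.measurable
    fun_prop
  rw [lintegral_const_mul _ hm2.lintegral_prod_right', hsq _ _ (f.coeFn_toLp 2 volume),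
    Measure.volume_eq_prod, lintegral_prod _ hm2.aemeasurable]

end PartialFourier

/-! ### Square sums and strong convergence of multiplication operators. -/

/-- An index type with the counting measure. -/
def Idx (ι : Type) : Type := ι

instance (ι : Type) : MeasureSpace (Idx ι) where
  toMeasurableSpace := ⊤
  volume := @Measure.count ι ⊤

instance (ι : Type) : DiscreteMeasurableSpace (Idx ι) := ⟨fun _ => trivial⟩

instance (ι : Type) [h : Countable ι] : Countable (Idx ι) := h

theorem volume_idx (ι : Type) : (volume : Measure (Idx ι)) = Measure.count := rfl

theorem enorm_sq_eq_lintegral {α : Type} [MeasureSpace α] (g : L2 α) (u : α → ℂ)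
    (hu : g =ᵐ[volume] u) : ‖g‖ₑ ^ 2 = ∫⁻ x, ‖u x‖ₑ ^ 2 := by
  rw [Lp.enorm_def, eLpNorm_eq_lintegral_rpow_enorm_toReal (by norm_num) (by norm_num),
    ← ENNReal.rpow_natCast, ← ENNReal.rpow_mul]
  norm_num
  exact lintegral_congr_ae (hu.mono fun x hx => by simp only [hx])

theorem tsum_enorm_inner_sq {ι L : Type} [NormedAddCommGroup L] [InnerProductSpace ℂ L]
    (b : HilbertBasis ι ℂ L) (v : L) : ∑' k, ‖inner ℂ (b k) v‖ₑ ^ 2 = ‖v‖ₑ ^ 2 := by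
  have h1 := (b.hasSum_inner_mul_inner v v).mapL (RCLike.reCLM (K := ℂ))
  have h2 : ∀ k, RCLike.reCLM (K := ℂ) (inner ℂ v (b k) * inner ℂ (b k) v) =
      ‖inner ℂ (b k) v‖ ^ 2 := fun k => by
    rw [← inner_conj_symm, mul_comm, RCLike.mul_conj]
    rw [RCLike.reCLM_apply, ← RCLike.ofReal_pow, RCLike.ofReal_re]
  have h3 : RCLike.reCLM (K := ℂ) (inner ℂ v v) = ‖v‖ ^ 2 := by
    rw [RCLike.reCLM_apply, inner_self_eq_norm_sq (𝕜 := ℂ)]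
  simp only [h2, h3] at h1
  have e : ∀ {E : Type} [NormedAddCommGroup E] (z : E), ‖z‖ₑ ^ 2 = ENNReal.ofReal (‖z‖ ^ 2) :=
    fun z => by rw [← ofReal_norm, ENNReal.ofReal_pow (norm_nonneg _)]
  simp only [e]
  rw [← ENNReal.ofReal_tsum_of_nonneg (fun k => sq_nonneg _) h1.summable, h1.tsum_eq]

/-- Multiplication operators by uniformly bounded functions converging pointwise to `1` converge
strongly to the identity. -/
theorem tendsto_mulL2 {α : Type} [MeasureSpace α] (m : ℕ → α → ℂ) (hm : ∀ N, Measurable (m N))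
    (hC : ∀ N x, ‖m N x‖ ≤ 1) (hlim : ∀ x, ∀ᶠ N in atTop, m N x = 1) (G : L2 α) :
    Tendsto (fun N => mulL2 (m N) (hm N) 1 (hC N) G) atTop (𝓝 G) := by
  rw [tendsto_iff_edist_tendsto_0]
  have hd : ∀ N, edist (mulL2 (m N) (hm N) 1 (hC N) G) G =
      (∫⁻ x, ‖(m N x - 1) * G x‖ₑ ^ 2) ^ (1 / 2 : ℝ) := fun N => by
    rw [Lp.edist_def, eLpNorm_eq_lintegral_rpow_enorm_toReal (by norm_num) (by norm_num)]
    congr 1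
    refine lintegral_congr_ae ?_
    filter_upwards [mulL2_ae (m N) (hm N) 1 (hC N) G] with x h1
    rw [Pi.sub_apply, h1, sub_mul, one_mul]
    norm_num
  simp only [hd]
  have hz : (0 : ℝ≥0∞) = 0 ^ (1 / 2 : ℝ) := by simp
  rw [hz]
  refine (ENNReal.continuous_rpow_const.tendsto _).comp ?_
  rw [show (0 : ℝ≥0∞) = ∫⁻ _ : α, 0 by simp]
  refine tendsto_lintegral_of_dominated_convergence' (fun x => ‖(2 : ℂ) * G x‖ₑ ^ 2)
    (fun N => ?_) (fun N => Eventually.of_forall fun x => ?_) ?_ (Eventually.of_forall fun x => ?_)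
  · exact ((((hm N).sub_const 1).aestronglyMeasurable.mul
      (Lp.aestronglyMeasurable G)).enorm).pow_const 2
  · simp only
    gcongr
    rw [enorm_le_iff_norm_le, norm_mul, norm_mul]
    gcongr
    rw [Complex.norm_two]
    have := hC N x
    have := norm_sub_le (m N x) 1
    simp at this
    linarith
  · have h := ((Lp.memLp G).const_mul 2).eLpNorm_lt_top
    rw [eLpNorm_lt_top_iff_lintegral_rpow_enorm_lt_top (by norm_num) (by norm_num)] at h
    simpa using h.ne
  · refine tendsto_const_nhds.congr' ?_
    filter_upwards [hlim x] with N hN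
    simp [hN]

/-! ### Diagonalisation of the Grushin operator. -/

section Spectral

variable {n₁ n₂ : ℕ}

/-- The dilation parameter of the fiber operator at `lam`. -/
def scale (κ : ℕ) (lam : V n₂) : ℝ := ‖lam‖ ^ (1 / ((κ : ℝ) + 1))

theorem scale_pos (κ : ℕ) {lam : V n₂} (h : lam ≠ 0) : 0 < scale κ lam :=
  Real.rpow_pos_of_pos (norm_pos_iff.mpr h) _

theorem scale_pow (κ : ℕ) (lam : V n₂) : ‖lam‖ = scale κ lam ^ (κ + 1) := by
  rw [scale, ← Real.rpow_natCast, ← Real.rpow_mul (norm_nonneg _)]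
  push_cast
  rw [one_div, inv_mul_cancel₀ (by positivity), Real.rpow_one]

theorem measurable_scale (κ : ℕ) : Measurable (scale (n₂ := n₂) κ) :=
  measurable_norm.pow_const _

variable {ι : Type} [Countable ι] (κ : ℕ) (b : HilbertBasis ι ℂ (L2 (V n₁)))

/-- The coordinates of a Schwartz function in the spectral decomposition. -/
def coef (f : 𝓢(Sp n₁ n₂, ℂ)) (q : V n₂ × Idx ι) : ℂ :=
  ((√((2 * Real.pi) ^ n₂) : ℝ) : ℂ) *
    ∫ x, partialFourier f q.1 x * (starRingEnd ℂ) (dil (scale κ q.1) (b q.2) x)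

/-- The coordinates are explicit integrals of chosen representatives rather than inner products in
L², so that measurability in λ follows from that of parametrised integrals. -/
theorem measurable_coef (f : 𝓢(Sp n₁ n₂, ℂ)) : Measurable (coef κ b f) := by
  refine measurable_from_prod_countable_left fun k => ?_
  simp only [coef]
  refine Measurable.const_mul ?_ _
  refine StronglyMeasurable.measurable ?_
  refine StronglyMeasurable.integral_prod_right (f := fun (lam : V n₂) (x : V n₁) =>
    partialFourier f lam x * (starRingEnd ℂ) (dil (scale κ lam) (b k) x)) ?_
  refine (stronglyMeasurable_partialFourier f).mul ?_
  refine Measurable.stronglyMeasurable ?_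
  have h1 : Measurable (b k : V n₁ → ℂ) := (Lp.stronglyMeasurable (b k)).measurable
  have h2 : Measurable fun q : V n₂ × V n₁ => scale κ q.1 :=
    (measurable_scale κ).comp measurable_fst
  simp only [dil]
  have h3 : Measurable fun q : V n₂ × V n₁ => scale κ q.1 • q.2 := h2.smul measurable_snd
  refine Complex.continuous_conj.measurable.comp (Measurable.mul ?_ (h1.comp h3))
  exact Complex.measurable_ofReal.comp (h2.pow_const _)

omit [Countable ι] in
theorem coef_eq (f : 𝓢(Sp n₁ n₂, ℂ)) {lam : V n₂} (h : lam ≠ 0) (k : ι) :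
    coef κ b f (lam, k) = ((√((2 * Real.pi) ^ n₂) : ℝ) : ℂ) *
      inner ℂ (dilBasis (scale_pos κ h) b k) (toL2 (partialFourier f lam)) := by
  rw [coef, L2.inner_def, toL2_partialFourier, dilBasis_apply]
  congr 1
  refine integral_congr_ae ?_
  filter_upwards [dilL2_ae (scale_pos κ h) (b k), (memLp_partialFourier f lam).coeFn_toLp]
    with x h1 h2
  rw [h1, h2]
  rfl

omit [Countable ι] in
theorem coef_add (f g : 𝓢(Sp n₁ n₂, ℂ)) {lam : V n₂} (h : lam ≠ 0) (k : ι) :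
    coef κ b (f + g) (lam, k) = coef κ b f (lam, k) + coef κ b g (lam, k) := by
  rw [coef_eq κ b _ h, coef_eq κ b _ h, coef_eq κ b _ h, ← mul_add, ← inner_add_right]
  congr 2
  simp only [toL2_partialFourier]
  rw [← MemLp.toLp_add]
  congr 1
  funext x
  exact partialFourier_add f g lam x

omit [Countable ι] in
theorem coef_smul (c : ℂ) (f : 𝓢(Sp n₁ n₂, ℂ)) {lam : V n₂} (h : lam ≠ 0) (k : ι) :
    coef κ b (c • f) (lam, k) = c * coef κ b f (lam, k) := by
  have e : toL2 (partialFourier (c • f : 𝓢(Sp n₁ n₂, ℂ)) lam) = c • toL2 (partialFourier f lam) := by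
    simp only [toL2_partialFourier]
    rw [← MemLp.toLp_const_smul]
    congr 1
    funext x
    exact partialFourier_smul c f lam x
  rw [coef_eq κ b _ h, coef_eq κ b _ h, e, inner_smul_right]
  ring

theorem ae_ne_zero (hn₂ : 1 ≤ n₂) : ∀ᵐ lam : V n₂, lam ≠ 0 := by
  have : Nonempty (Fin n₂) := ⟨⟨0, hn₂⟩⟩
  exact compl_mem_ae_iff.mpr (measure_singleton 0)

omit [Countable ι] in
theorem ae_fst_ne_zero (hn₂ : 1 ≤ n₂) :
    ∀ᵐ q : V n₂ × Idx ι, q.1 ≠ 0 :=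
  Measure.quasiMeasurePreserving_fst.ae (ae_ne_zero hn₂)

/-- Parseval in each fibre, then Plancherel in λ; the square root in `coef` cancels the Plancherel
constant. The frequency λ = 0, where the dilation degenerates, is a null set because n₂ ≥ 1. -/
theorem lintegral_coef_sq (hn₂ : 1 ≤ n₂) (f : 𝓢(Sp n₁ n₂, ℂ)) :
    ∫⁻ q, ‖coef κ b f q‖ₑ ^ 2 = ‖f.toLp 2 volume‖ₑ ^ 2 := by
  have hpi : 0 < (2 * Real.pi) ^ n₂ := by positivity
  have h1 : ∀ᵐ lam : V n₂, ∫⁻ k : Idx ι, ‖coef κ b f (lam, k)‖ₑ ^ 2 =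
      ENNReal.ofReal ((2 * Real.pi) ^ n₂) * ‖toL2 (partialFourier f lam)‖ₑ ^ 2 := by
    filter_upwards [ae_ne_zero hn₂] with lam hlam
    rw [volume_idx, lintegral_count, ← tsum_enorm_inner_sq (dilBasis (scale_pos κ hlam) b),
      ← ENNReal.tsum_mul_left]
    refine tsum_congr fun k => ?_
    rw [coef_eq κ b f hlam k, enorm_mul, mul_pow]
    congr 1
    rw [← ofReal_norm, Complex.norm_real, ← ENNReal.ofReal_pow (norm_nonneg _), Real.norm_eq_abs,
      sq_abs, Real.sq_sqrt hpi.le]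
  rw [Measure.volume_eq_prod, lintegral_prod _ ((measurable_coef κ b f).enorm.pow_const 2).aemeasurable,
    lintegral_congr_ae h1, lintegral_const_mul' _ _ ENNReal.ofReal_ne_top,
    lintegral_norm_toL2_partialFourier, ← mul_assoc, ← ENNReal.ofReal_mul hpi.le,
    mul_inv_cancel₀ hpi.ne', ENNReal.ofReal_one, one_mul]

theorem memLp_coef (hn₂ : 1 ≤ n₂) (f : 𝓢(Sp n₁ n₂, ℂ)) :
    MemLp (coef κ b f) 2 (volume : Measure (V n₂ × Idx ι)) := by
  refine ⟨(measurable_coef κ b f).aestronglyMeasurable, ?_⟩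
  rw [eLpNorm_lt_top_iff_lintegral_rpow_enorm_lt_top (by norm_num) (by norm_num)]
  have h := lintegral_coef_sq κ b hn₂ f
  have h2 : ‖f.toLp 2 volume‖ₑ ^ 2 < ∞ := ENNReal.pow_lt_top enorm_lt_top
  rw [← h] at h2
  simpa using h2

/-- The spectral decomposition of Schwartz functions. -/
def coefL2 (hn₂ : 1 ≤ n₂) : 𝓢(Sp n₁ n₂, ℂ) →ₗ[ℂ] L2 (V n₂ × Idx ι) where
  toFun f := (memLp_coef κ b hn₂ f).toLp
  map_add' f g := by
    rw [← MemLp.toLp_add]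
    refine (MemLp.toLp_eq_toLp_iff _ _).mpr ?_
    filter_upwards [ae_fst_ne_zero (ι := ι) hn₂] with q hq
    exact coef_add κ b f g hq q.2
  map_smul' c f := by
    rw [RingHom.id_apply, ← MemLp.toLp_const_smul]
    refine (MemLp.toLp_eq_toLp_iff _ _).mpr ?_
    filter_upwards [ae_fst_ne_zero (ι := ι) hn₂] with q hq
    exact coef_smul κ b c f hq q.2

theorem coefL2_ae (hn₂ : 1 ≤ n₂) (f : 𝓢(Sp n₁ n₂, ℂ)) :
    coefL2 κ b hn₂ f =ᵐ[volume] coef κ b f :=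
  (memLp_coef κ b hn₂ f).coeFn_toLp

theorem norm_coefL2 (hn₂ : 1 ≤ n₂) (f : 𝓢(Sp n₁ n₂, ℂ)) :
    ‖coefL2 κ b hn₂ f‖ = ‖f.toLp 2 (volume : Measure (Sp n₁ n₂))‖ := by
  have h : ‖coefL2 κ b hn₂ f‖ₑ ^ 2 = ‖f.toLp 2 (volume : Measure (Sp n₁ n₂))‖ₑ ^ 2 := by
    rw [enorm_sq_eq_lintegral _ _ (coefL2_ae κ b hn₂ f), lintegral_coef_sq κ b hn₂]
  have h2 := (ENNReal.pow_right_strictMono (n := 2) (by norm_num)).injective h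
  rw [← toReal_enorm, ← toReal_enorm, h2]

theorem denseRange_toLp_Sp :
    DenseRange (SchwartzMap.toLpCLM ℂ ℂ 2 (volume : Measure (Sp n₁ n₂))).toLinearMap := by
  have hH : (volume : Measure (Sp n₁ n₂)).IsAddHaarMeasure :=
    inferInstanceAs ((volume : Measure (V n₁)).prod (volume : Measure (V n₂))).IsAddHaarMeasure
  exact SchwartzMap.denseRange_toLpCLM (F := ℂ) ENNReal.ofNat_ne_top

/-- The spectral decomposition on `L²`. -/
def decomp (hn₂ : 1 ≤ n₂) : L2 (Sp n₁ n₂) →L[ℂ] L2 (V n₂ × Idx ι) :=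
  (coefL2 κ b hn₂).extendOfNorm (SchwartzMap.toLpCLM ℂ ℂ 2 (volume : Measure (Sp n₁ n₂))).toLinearMap

theorem decomp_toLp (hn₂ : 1 ≤ n₂) (f : 𝓢(Sp n₁ n₂, ℂ)) :
    decomp κ b hn₂ (f.toLp 2 volume) = coefL2 κ b hn₂ f :=
  LinearMap.extendOfNorm_eq denseRange_toLp_Sp
    ⟨1, fun f => by rw [one_mul]; exact (norm_coefL2 κ b hn₂ f).le⟩ f

theorem norm_decomp (hn₂ : 1 ≤ n₂) (F : L2 (Sp n₁ n₂)) : ‖decomp κ b hn₂ F‖ = ‖F‖ := by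
  induction F using denseRange_toLp_Sp.induction_on with
  | hp => exact isClosed_eq (by fun_prop) (by fun_prop)
  | ih f => exact (congrArg norm (decomp_toLp κ b hn₂ f)).trans (norm_coefL2 κ b hn₂ f)

/-- An isometry D satisfies D*D = 1. Surjectivity of the decomposition is not needed. -/
theorem adjoint_decomp (hn₂ : 1 ≤ n₂) (F : L2 (Sp n₁ n₂)) :
    (decomp κ b hn₂).adjoint (decomp κ b hn₂ F) = F := by
  have h := (ContinuousLinearMap.norm_map_iff_adjoint_comp_self (decomp κ b hn₂)).mp
    (norm_decomp κ b hn₂)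
  exact congrArg (fun A : L2 (Sp n₁ n₂) →L[ℂ] L2 (Sp n₁ n₂) => A F) h

variable (ν : ι → ℝ)

/-- The spectral multiplier of a set. -/
def specInd (I : Set ℝ) (q : V n₂ × Idx ι) : ℂ :=
  {q : V n₂ × Idx ι | scale κ q.1 ^ 2 * ν q.2 ∈ I}.indicator 1 q

omit [Countable ι] in
theorem norm_specInd_le (I : Set ℝ) (q : V n₂ × Idx ι) : ‖specInd κ ν I q‖ ≤ 1 := by
  rw [specInd, Set.indicator]
  split_ifs <;> simp

theorem measurable_specInd {I : Set ℝ} (hI : MeasurableSet I) :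
    Measurable (specInd (n₂ := n₂) κ ν I) := by
  refine measurable_from_prod_countable_left fun k => ?_
  have h : Measurable fun lam : V n₂ => scale κ lam ^ 2 * ν k :=
    ((measurable_scale κ).pow_const 2).mul_const _
  exact (measurable_const (a := (1 : ℂ))).indicator (h hI)

/-- The spectral projection of a set, through the spectral decomposition. -/
def specProj (hn₂ : 1 ≤ n₂) {I : Set ℝ} (hI : MeasurableSet I) :
    L2 (Sp n₁ n₂) →L[ℂ] L2 (Sp n₁ n₂) :=
  (decomp κ b hn₂).adjoint.comp ((mulL2 (specInd κ ν I) (measurable_specInd κ ν hI) 1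
    (norm_specInd_le κ ν I)).comp (decomp κ b hn₂))

/-- This supplies the existence of 1_I(G). By Fubini the pairing is an integral over λ of sums over
the dilated basis; its eigenvalues at λ are ν_k times the squared dilation factor, so for almost
every λ the sum is the matrix coefficient of the fibre projection. -/
theorem isSpectralProjection_specProj (p : PotentialType) (hn₂ : 1 ≤ n₂) {lam₀ : V n₂}
    (hlam₀ : ‖lam₀‖ = 1) (hb : ∀ k, IsEigenvector p κ lam₀ (ν k) (b k)) {I : Set ℝ}
    (hI : MeasurableSet I) : IsSpectralProjection p κ I (specProj κ b ν hn₂ hI) := by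
  intro f g
  have hpi : 0 < (2 * Real.pi) ^ n₂ := by positivity
  set M := mulL2 (specInd (n₂ := n₂) κ ν I) (measurable_specInd κ ν hI) 1 (norm_specInd_le κ ν I)
  have h1 : inner ℂ (g.toLp 2 volume) (specProj κ b ν hn₂ hI (f.toLp 2 volume)) =
      inner ℂ (coefL2 κ b hn₂ g) (M (coefL2 κ b hn₂ f)) := by
    rw [specProj, ContinuousLinearMap.comp_apply, ContinuousLinearMap.comp_apply,
      ContinuousLinearMap.adjoint_inner_right, decomp_toLp, decomp_toLp]
  set u : V n₂ × Idx ι → ℂ := fun q => specInd κ ν I q *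
    (coef κ b f q * (starRingEnd ℂ) (coef κ b g q))
  have hae : (fun q => inner ℂ (coefL2 κ b hn₂ g q) (M (coefL2 κ b hn₂ f) q)) =ᵐ[volume] u := by
    filter_upwards [coefL2_ae κ b hn₂ g, coefL2_ae κ b hn₂ f,
      mulL2_ae (specInd (n₂ := n₂) κ ν I) (measurable_specInd κ ν hI) 1 (norm_specInd_le κ ν I)
        (coefL2 κ b hn₂ f)] with q e1 e2 e3
    rw [e1, e3, e2]
    simp [u]
    ring
  have hint : Integrable u volume := (L2.integrable_inner (𝕜 := ℂ) _ _).congr hae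
  rw [h1, L2.inner_def, integral_congr_ae hae, ← integral_const_mul]
  rw [Measure.volume_eq_prod] at hint ⊢
  rw [integral_prod _ hint]
  refine integral_congr_ae ?_
  filter_upwards [hint.prod_right_ae, ae_ne_zero hn₂] with lam hlam hne
  rw [volume_idx] at hlam ⊢
  rw [integral_countable hlam]
  have hs := hasSum_inner_fiberProj p κ I lam (dilBasis (scale_pos κ hne) b)
    (fun k => scale κ lam ^ 2 * ν k) (fun k => by
      rw [dilBasis_apply]
      exact isEigenvector_dilL2 (scale_pos κ hne) hlam₀ (scale_pow κ lam) (hb k))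
    (toL2 (partialFourier g lam)) (toL2 (partialFourier f lam))
  rw [← hs.tsum_eq, ← tsum_mul_left]
  have hsq : ((√((2 * Real.pi) ^ n₂) : ℝ) : ℂ) * ((√((2 * Real.pi) ^ n₂) : ℝ) : ℂ) =
      (((2 * Real.pi) ^ n₂ : ℝ) : ℂ) := by
    rw [← Complex.ofReal_mul, Real.mul_self_sqrt hpi.le]
  have hcount : ∀ k : Idx ι, (Measure.count : Measure (Idx ι)).real {k} = 1 := fun k => by
    simp [Measure.real]
  have key : ∀ k : ι, u (lam, k) = (((2 * Real.pi) ^ n₂ : ℝ) : ℂ) *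
      {k | scale κ lam ^ 2 * ν k ∈ I}.indicator (fun k =>
        inner ℂ (toL2 (partialFourier g lam)) (dilBasis (scale_pos κ hne) b k) *
          inner ℂ (dilBasis (scale_pos κ hne) b k) (toL2 (partialFourier f lam))) k := fun k => by
    simp only [u]
    rw [coef_eq κ b f hne k, coef_eq κ b g hne k]
    by_cases hk : scale κ lam ^ 2 * ν k ∈ I
    · have e1 : specInd κ ν I (lam, (k : Idx ι)) = 1 := Set.indicator_of_mem (by exact hk) _
      rw [e1, Set.indicator_of_mem (by exact hk), one_mul, map_mul, Complex.conj_ofReal,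
        inner_conj_symm, ← hsq]
      ring
    · have e1 : specInd κ ν I (lam, (k : Idx ι)) = 0 := Set.indicator_of_notMem (by exact hk) _
      rw [e1, Set.indicator_of_notMem (by exact hk), zero_mul, mul_zero]
  simp only [hcount, one_smul]
  exact tsum_congr key

theorem measurableSet_window (j : ℕ) : MeasurableSet (window j) := by
  cases j with
  | zero => exact measurableSet_Iio
  | succ j => exact measurableSet_Ico

omit [Countable ι] in
theorem sum_specInd_window (N : ℕ) (q : V n₂ × Idx ι) :
    ∑ j ∈ Finset.range (N + 1), specInd κ ν (window j) q = specInd κ ν (Set.Iio (2 ^ N)) q := by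
  induction N with
  | zero => simp [window]
  | succ N ih =>
    rw [Finset.sum_range_succ, ih]
    simp only [specInd, Set.indicator, Set.mem_ofPred_eq, window, Set.mem_Iio, Set.mem_Ico,
      Pi.one_apply]
    set y := scale κ q.1 ^ 2 * ν q.2
    have h2 : (2 : ℝ) ^ N ≤ 2 ^ (N + 1) := pow_le_pow_right₀ one_le_two (Nat.le_succ N)
    by_cases h : y < 2 ^ N
    · have h' : ¬ (2 : ℝ) ^ N ≤ y := not_le.mpr h
      have h3 : y < 2 ^ (N + 1) := h.trans_le h2
      simp [h, h', h3]
    · have h' : (2 : ℝ) ^ N ≤ y := not_lt.mp h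
      simp [h, h']

/-- The spectral projections of the windows sum to the identity. -/
theorem tendsto_sum_spectralProjection (hn₂ : 1 ≤ n₂) {κ : ℕ} (hκ : 1 ≤ κ) (p : PotentialType)
    (F : L2 (Sp n₁ n₂)) :
    Tendsto (fun N => ∑ j ∈ Finset.range (N + 1), spectralProjection p κ (window j) F) atTop
      (𝓝 F) := by
  let lam₀ : V n₂ := EuclideanSpace.single ⟨0, hn₂⟩ (1 : ℝ)
  have hlam₀ : ‖lam₀‖ = 1 := by simp [lam₀]
  obtain ⟨ι, hι, b, ν, hb⟩ := exists_eigenbasis_unit (n₁ := n₁) p hκ lam₀ hlam₀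
  -- Existence excludes the default value 0, and uniqueness identifies the chosen operator.
  have heq : ∀ j, spectralProjection p κ (window j) =
      specProj (n₂ := n₂) κ b ν hn₂ (measurableSet_window j) := fun j => by
    have h := isSpectralProjection_specProj κ b ν p hn₂ hlam₀ hb (measurableSet_window j)
    have hex : ∃ S : L2 (Sp n₁ n₂) →L[ℂ] L2 (Sp n₁ n₂), IsSpectralProjection p κ (window j) S :=
      ⟨_, h⟩
    rw [spectralProjection, dif_pos hex]
    exact hex.choose_spec.unique h
  have hsum : ∀ N, ∑ j ∈ Finset.range (N + 1), spectralProjection p κ (window j) F =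
      specProj κ b ν hn₂ (measurableSet_Iio (a := (2 : ℝ) ^ N)) F := fun N => by
    simp only [heq, specProj, ContinuousLinearMap.comp_apply]
    rw [← map_sum]
    congr 1
    apply Lp.ext
    have h1 : ∀ᵐ q : V n₂ × Idx ι, ∀ j, (mulL2 (specInd (n₂ := n₂) κ ν (window j))
        (measurable_specInd κ ν (measurableSet_window j)) 1 (norm_specInd_le κ ν _)
        (decomp κ b hn₂ F)) q = specInd κ ν (window j) q * decomp κ b hn₂ F q :=
      ae_all_iff.mpr fun j => mulL2_ae _ _ _ _ _
    filter_upwards [h1, mulL2_ae (specInd (n₂ := n₂) κ ν (Set.Iio (2 ^ N)))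
      (measurable_specInd κ ν measurableSet_Iio) 1 (norm_specInd_le κ ν _) (decomp κ b hn₂ F),
      Lp.coeFn_finsetSum (Finset.range (N + 1)) fun j =>
        mulL2 (specInd (n₂ := n₂) κ ν (window j))
        (measurable_specInd κ ν (measurableSet_window j)) 1 (norm_specInd_le κ ν _)
        (decomp κ b hn₂ F)] with q e1 e2 e3
    rw [e2, e3, Finset.sum_apply, ← sum_specInd_window, Finset.sum_mul]
    exact Finset.sum_congr rfl fun j _ => e1 j
  simp only [hsum, specProj, ContinuousLinearMap.comp_apply]
  have hlim := tendsto_mulL2 (fun N => specInd (n₂ := n₂) κ ν (Set.Iio ((2 : ℝ) ^ N)))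
    (fun N => measurable_specInd κ ν measurableSet_Iio) (fun N => norm_specInd_le κ ν _)
    (fun q => by
      have h : Tendsto (fun N : ℕ => (2 : ℝ) ^ N) atTop atTop :=
        tendsto_pow_atTop_atTop_of_one_lt one_lt_two
      filter_upwards [h.eventually_gt_atTop (scale κ q.1 ^ 2 * ν q.2)] with N hN
      exact Set.indicator_of_mem (by exact hN) _) (decomp κ b hn₂ F)
  have := ((decomp κ b hn₂).adjoint.continuous.tendsto _).comp hlim
  rw [adjoint_decomp] at this
  exact this

end Spectral

/-! ### Boxes, volumes of balls and doubling. -/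

section Geometry

variable {n₁ n₂ : ℕ} (κ : ℕ)

theorem dist_comm (x y : Sp n₁ n₂) : dist κ x y = dist κ y x := by
  simp only [dist, norm_sub_rev x.1 y.1, norm_sub_rev x.2 y.2, add_comm ‖x.1‖ ‖y.1‖]

/-- The vertical part of the quasi-metric. -/
def vert (x y : Sp n₁ n₂) : ℝ :=
  ‖x.2 - y.2‖ / max (‖x.2 - y.2‖ ^ (1 / (1 + (κ : ℝ)))) (‖x.1‖ + ‖y.1‖) ^ κ

theorem rpow_pow_succ {b : ℝ} (hb : 0 ≤ b) : (b ^ (1 / (1 + (κ : ℝ)))) ^ (κ + 1) = b := by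
  rw [← Real.rpow_natCast, ← Real.rpow_mul hb]
  push_cast
  rw [one_div, add_comm (κ : ℝ) 1, inv_mul_cancel₀ (by positivity), Real.rpow_one]

/-- With β = |x''-y''|^{1/(1+κ)} one has β = |x''-y''|/β^κ, so both cases of the definition divide
by the κ-th power of the larger of β and |x'|+|y'|. -/
theorem dist_eq (x y : Sp n₁ n₂) : dist κ x y = ‖x.1 - y.1‖ + vert κ x y := by
  rw [dist, vert]
  congr 1
  split_ifs with h
  · rw [max_eq_right h]
  · rw [max_eq_left (not_le.mp h).le]
    have hb := rpow_pow_succ κ (norm_nonneg (x.2 - y.2))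
    set β := ‖x.2 - y.2‖ ^ (1 / (1 + (κ : ℝ)))
    have hβ : 0 < β := lt_of_le_of_lt (by positivity) (not_le.mp h)
    rw [eq_div_iff (by positivity)]
    rw [← hb]
    ring

theorem vert_nonneg (x y : Sp n₁ n₂) : 0 ≤ vert κ x y :=
  div_nonneg (norm_nonneg _) (pow_nonneg (le_max_of_le_left (by positivity)) _)

theorem dist_nonneg (x y : Sp n₁ n₂) : 0 ≤ dist κ x y := by
  rw [dist_eq]
  exact add_nonneg (norm_nonneg _) (vert_nonneg κ x y)

theorem norm_fst_le_dist (x y : Sp n₁ n₂) : ‖x.1 - y.1‖ ≤ dist κ x y := by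
  rw [dist_eq]
  exact le_add_of_nonneg_right (vert_nonneg κ x y)

theorem vert_mul (x y : Sp n₁ n₂) :
    vert κ x y * max (‖x.2 - y.2‖ ^ (1 / (1 + (κ : ℝ)))) (‖x.1‖ + ‖y.1‖) ^ κ = ‖x.2 - y.2‖ := by
  have hb := rpow_pow_succ κ (norm_nonneg (x.2 - y.2))
  rw [vert]
  set β := ‖x.2 - y.2‖ ^ (1 / (1 + (κ : ℝ)))
  have hβ : 0 ≤ β := by positivity
  rcases hβ.eq_or_lt with h | h
  · have h0 : ‖x.2 - y.2‖ = 0 := by rw [← hb, ← h, zero_pow (Nat.succ_ne_zero κ)]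
    rw [h0, zero_div, zero_mul]
  · have : 0 < max β (‖x.1‖ + ‖y.1‖) := lt_max_of_lt_left h
    exact div_mul_cancel₀ _ (by positivity)

theorem vert_le (x y : Sp n₁ n₂) : vert κ x y ≤ ‖x.2 - y.2‖ ^ (1 / (1 + (κ : ℝ))) := by
  have hb := rpow_pow_succ κ (norm_nonneg (x.2 - y.2))
  rw [vert]
  set β := ‖x.2 - y.2‖ ^ (1 / (1 + (κ : ℝ)))
  have hβ : 0 ≤ β := by positivity
  refine div_le_of_le_mul₀ (by positivity) hβ ?_
  rw [← hb, pow_succ']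
  gcongr
  exact le_max_left _ _

/-- Either β = |x''-y''|^{1/(1+κ)} is at most |x'|+|y'|, or it is itself the vertical part of the
distance and so at most ρ. In both cases the maximum in `vert` is at most 2(|x'|+ρ). -/
theorem norm_snd_le (x y : Sp n₁ n₂) {ρ : ℝ} (h : dist κ x y ≤ ρ) :
    ‖x.2 - y.2‖ ≤ 2 ^ κ * ρ * (‖x.1‖ + ρ) ^ κ := by
  have hv := vert_mul κ x y
  have hv0 := vert_nonneg κ x y
  have h1 := (norm_fst_le_dist κ x y).trans h
  have h2 : vert κ x y ≤ ρ := by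
    rw [dist_eq] at h
    linarith [norm_nonneg (x.1 - y.1)]
  have hρ : 0 ≤ ρ := hv0.trans h2
  have hd : dist κ x y = ‖x.1 - y.1‖ + _ := rfl
  set β := ‖x.2 - y.2‖ ^ (1 / (1 + (κ : ℝ)))
  have h3 : max β (‖x.1‖ + ‖y.1‖) ≤ 2 * (‖x.1‖ + ρ) := by
    have hy : ‖y.1‖ ≤ ‖x.1‖ + ρ := by
      have : ‖y.1‖ ≤ ‖x.1‖ + ‖x.1 - y.1‖ := by
        have := norm_sub_le x.1 (x.1 - y.1)
        rwa [sub_sub_cancel] at this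
      linarith
    have hx := norm_nonneg x.1
    by_cases hβ : β ≤ ‖x.1‖ + ‖y.1‖
    · rw [max_eq_right hβ]
      linarith
    · rw [if_neg hβ] at hd
      refine max_le ?_ (by linarith)
      linarith [norm_nonneg (x.1 - y.1)]
  rw [← hv]
  calc vert κ x y * max β (‖x.1‖ + ‖y.1‖) ^ κ ≤ ρ * (2 * (‖x.1‖ + ρ)) ^ κ := by
        gcongr
    _ = _ := by rw [mul_pow]; ring

/-- If the maximum in `vert` is at least ρ, then |x'|+ρ is at most twice that maximum and the
quotient is controlled; otherwise the vertical part is at most β < ρ. -/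
theorem dist_le_of_norm_le (x y : Sp n₁ n₂) {ρ m : ℝ} (hρ : 0 ≤ ρ) (hm : 1 ≤ m)
    (h1 : ‖x.1 - y.1‖ ≤ ρ) (h2 : ‖x.2 - y.2‖ ≤ m * ρ * (‖x.1‖ + ρ) ^ κ) :
    dist κ x y ≤ (1 + m * 2 ^ κ) * ρ := by
  rw [dist_eq, add_mul, one_mul]
  refine add_le_add h1 ?_
  have hv := vert_mul κ x y
  have hl := vert_le κ x y
  have hβ0 : 0 ≤ ‖x.2 - y.2‖ ^ (1 / (1 + (κ : ℝ))) := by positivity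
  have hm2 : (1 : ℝ) ≤ m * 2 ^ κ := one_le_mul_of_one_le_of_one_le hm (one_le_pow₀ one_le_two)
  rw [vert]
  set β := ‖x.2 - y.2‖ ^ (1 / (1 + (κ : ℝ)))
  by_cases h : ρ ≤ max β (‖x.1‖ + ‖y.1‖)
  · refine div_le_of_le_mul₀ (by positivity) (by positivity) (h2.trans ?_)
    calc m * ρ * (‖x.1‖ + ρ) ^ κ ≤ m * ρ * (2 * max β (‖x.1‖ + ‖y.1‖)) ^ κ := by
          gcongr
          have : ‖x.1‖ ≤ max β (‖x.1‖ + ‖y.1‖) :=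
            le_max_of_le_right (le_add_of_nonneg_right (norm_nonneg _))
          linarith
      _ = _ := by rw [mul_pow]; ring
  · refine (hl.trans ((le_max_left β _).trans (not_le.mp h).le)).trans ?_
    exact le_mul_of_one_le_left hρ hm2

theorem measurable_dist : Measurable fun q : Sp n₁ n₂ × Sp n₁ n₂ => dist κ q.1 q.2 := by
  have e : (fun q : Sp n₁ n₂ × Sp n₁ n₂ => dist κ q.1 q.2) = fun q =>
      ‖q.1.1 - q.2.1‖ + ‖q.1.2 - q.2.2‖ /
        max (‖q.1.2 - q.2.2‖ ^ (1 / (1 + (κ : ℝ)))) (‖q.1.1‖ + ‖q.2.1‖) ^ κ := by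
    funext q
    rw [dist_eq, vert]
  rw [e]
  have h1 : Measurable fun q : Sp n₁ n₂ × Sp n₁ n₂ => ‖q.1.2 - q.2.2‖ := by fun_prop
  have h2 : Measurable fun q : Sp n₁ n₂ × Sp n₁ n₂ => ‖q.1.1 - q.2.1‖ := by fun_prop
  have h3 : Measurable fun q : Sp n₁ n₂ × Sp n₁ n₂ => ‖q.1.1‖ + ‖q.2.1‖ := by fun_prop
  exact h2.add (h1.div (((h1.pow_const _).max h3).pow_const _))

theorem measurable_dist_right (x : Sp n₁ n₂) : Measurable (dist κ x) :=
  Measurable.comp (g := fun q : Sp n₁ n₂ × Sp n₁ n₂ => dist κ q.1 q.2) (measurable_dist κ)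
    (f := fun y => (x, y)) (by fun_prop)

theorem measurableSet_ball (x : Sp n₁ n₂) (r : ℝ) : MeasurableSet (ball κ x r) :=
  measurable_dist_right κ x measurableSet_Iio

/-- The volume of a box, up to a constant. -/
def boxVol (n₂ : ℕ) (x : V n₁) (ρ : ℝ) : ℝ := ρ ^ n₁ * (ρ * (‖x‖ + ρ) ^ κ) ^ n₂

/-- Each of the n₁ + n₂ sides contributes one factor t, and each of the n₂ factors (|x'|+ρ)^κ
contributes t^κ; together these make the exponent Q. -/
theorem boxVol_mul_le (x : V n₁) {t ρ : ℝ} (ht : 1 ≤ t) (hρ : 0 ≤ ρ) :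
    boxVol κ n₂ x (t * ρ) ≤ t ^ homDim n₁ n₂ κ * boxVol κ n₂ x ρ := by
  have ht0 : 0 ≤ t := zero_le_one.trans ht
  have h : ‖x‖ + t * ρ ≤ t * (‖x‖ + ρ) := by nlinarith [norm_nonneg x]
  calc boxVol κ n₂ x (t * ρ) ≤ (t * ρ) ^ n₁ * (t * ρ * (t * (‖x‖ + ρ)) ^ κ) ^ n₂ := by
        rw [boxVol]
        gcongr
    _ = _ := by
        simp only [boxVol, homDim, mul_pow, pow_add, pow_mul, pow_one]
        ring

theorem boxVol_pos (x : V n₁) {ρ : ℝ} (hρ : 0 < ρ) : 0 < boxVol κ n₂ x ρ := by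
  have := norm_nonneg x
  rw [boxVol]
  positivity

/-- The product of the volumes of the Euclidean unit balls. -/
def unitVol (n₁ n₂ : ℕ) : ℝ≥0∞ :=
  volume (Metric.ball (0 : V n₁) 1) * volume (Metric.ball (0 : V n₂) 1)

theorem unitVol_ne_zero : unitVol n₁ n₂ ≠ 0 :=
  mul_ne_zero (Metric.measure_ball_pos _ _ one_pos).ne' (Metric.measure_ball_pos _ _ one_pos).ne'

theorem unitVol_ne_top : unitVol n₁ n₂ ≠ ∞ :=
  ENNReal.mul_ne_top measure_ball_lt_top.ne measure_ball_lt_top.ne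

theorem volume_ball_le (x : Sp n₁ n₂) {r : ℝ} (hr : 0 < r) :
    volume (ball κ x r) ≤
      unitVol n₁ n₂ * ENNReal.ofReal ((2 ^ κ) ^ n₂ * boxVol κ n₂ x.1 r) := by
  have hsub : ball κ x r ⊆ Metric.closedBall x.1 r ×ˢ
      Metric.closedBall x.2 (2 ^ κ * r * (‖x.1‖ + r) ^ κ) := by
    intro y hy
    have hy' : dist κ x y ≤ r := le_of_lt hy
    refine ⟨?_, ?_⟩
    · rw [mem_closedBall_iff_norm']
      exact (norm_fst_le_dist κ x y).trans hy'
    · rw [mem_closedBall_iff_norm']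
      exact norm_snd_le κ x y hy'
  refine (measure_mono hsub).trans ?_
  have hx := norm_nonneg x.1
  rw [Measure.volume_eq_prod, Measure.prod_prod, Measure.addHaar_closedBall _ _ hr.le,
    Measure.addHaar_closedBall _ _ (by positivity), unitVol, boxVol]
  simp only [finrank_euclideanSpace, Fintype.card_fin]
  rw [mul_mul_mul_comm, ← ENNReal.ofReal_mul (by positivity), mul_comm]
  refine le_of_eq ?_
  congr 2
  ring

theorem le_volume_ball (x : Sp n₁ n₂) {r : ℝ} (hr : 0 < r) :
    unitVol n₁ n₂ * ENNReal.ofReal (boxVol κ n₂ x.1 (r / (2 + 2 ^ κ))) ≤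
      volume (ball κ x r) := by
  -- Points of the box of size ρ are within (1 + 2^κ)ρ of the centre, strictly less than r.
  set ρ := r / (2 + 2 ^ κ) with hρ'
  have hρ : 0 < ρ := by positivity
  have hsub : Metric.ball x.1 ρ ×ˢ Metric.ball x.2 (ρ * (‖x.1‖ + ρ) ^ κ) ⊆ ball κ x r := by
    rintro y ⟨h1, h2⟩
    rw [mem_ball_iff_norm'] at h1 h2
    have := dist_le_of_norm_le κ x y hρ.le le_rfl h1.le (by rw [one_mul]; exact h2.le)
    have hr' : (2 + 2 ^ κ) * ρ = r := by rw [hρ']; field_simp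
    show dist κ x y < r
    nlinarith
  refine le_trans ?_ (measure_mono hsub)
  have hx := norm_nonneg x.1
  rw [Measure.volume_eq_prod, Measure.prod_prod, Measure.addHaar_ball_of_pos _ x.1 hρ,
    Measure.addHaar_ball_of_pos _ x.2 (r := ρ * (‖x.1‖ + ρ) ^ κ) (by positivity), unitVol, boxVol]
  simp only [finrank_euclideanSpace, Fintype.card_fin]
  rw [mul_mul_mul_comm, ← ENNReal.ofReal_mul (by positivity), mul_comm]

theorem volume_ball_ne_zero (x : Sp n₁ n₂) {r : ℝ} (hr : 0 < r) : volume (ball κ x r) ≠ 0 := by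
  refine ((ENNReal.mul_pos unitVol_ne_zero ?_).trans_le (le_volume_ball κ x hr)).ne'
  exact (ENNReal.ofReal_pos.mpr (boxVol_pos κ x.1 (by positivity))).ne'

theorem volume_ball_ne_top (x : Sp n₁ n₂) {r : ℝ} (hr : 0 < r) : volume (ball κ x r) ≠ ∞ :=
  ((volume_ball_le κ x hr).trans_lt
    (ENNReal.mul_lt_top unitVol_ne_top.lt_top ENNReal.ofReal_lt_top)).ne

/-- The doubling constant. -/
def doublingConst (n₁ n₂ κ : ℕ) : ℝ := (2 ^ κ) ^ n₂ * (2 + 2 ^ κ) ^ homDim n₁ n₂ κ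

theorem doublingConst_pos : 0 < doublingConst n₁ n₂ κ := by
  rw [doublingConst]
  positivity

theorem volume_ball_mul_le (x : Sp n₁ n₂) {t ρ : ℝ} (ht : 1 ≤ t) (hρ : 0 < ρ) :
    volume (ball κ x (t * ρ)) ≤
      ENNReal.ofReal (doublingConst n₁ n₂ κ * t ^ homDim n₁ n₂ κ) * volume (ball κ x ρ) := by
  have ht0 : 0 < t := zero_lt_one.trans_le ht
  have hA : (1 : ℝ) ≤ t * (2 + 2 ^ κ) := by
    have : (0 : ℝ) < 2 ^ κ := by positivity
    nlinarith
  refine (volume_ball_le κ x (mul_pos ht0 hρ)).trans ?_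
  have e : t * ρ = t * (2 + 2 ^ κ) * (ρ / (2 + 2 ^ κ)) := by field_simp
  have h1 := boxVol_mul_le (n₂ := n₂) κ x.1 hA (ρ := ρ / (2 + 2 ^ κ)) (by positivity)
  rw [← e] at h1
  calc unitVol n₁ n₂ * ENNReal.ofReal ((2 ^ κ) ^ n₂ * boxVol κ n₂ x.1 (t * ρ))
      ≤ unitVol n₁ n₂ * ENNReal.ofReal ((2 ^ κ) ^ n₂ * ((t * (2 + 2 ^ κ)) ^ homDim n₁ n₂ κ *
          boxVol κ n₂ x.1 (ρ / (2 + 2 ^ κ)))) := by gcongr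
    _ = ENNReal.ofReal (doublingConst n₁ n₂ κ * t ^ homDim n₁ n₂ κ) *
          (unitVol n₁ n₂ * ENNReal.ofReal (boxVol κ n₂ x.1 (ρ / (2 + 2 ^ κ)))) := by
        rw [mul_left_comm (ENNReal.ofReal _), ← ENNReal.ofReal_mul
          (mul_nonneg (doublingConst_pos κ).le (by positivity))]
        congr 2
        rw [doublingConst, mul_pow]
        ring
    _ ≤ _ := by
        gcongr
        exact le_volume_ball κ x hρ

/-- Comparison of balls with different centres. -/
theorem volume_ball_le_of_dist_le {C₀ : ℝ} (hC₀ : 1 < C₀)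
    (hquasi : ∀ x y z : Sp n₁ n₂, dist κ x y ≤ C₀ * (dist κ x z + dist κ z y))
    {A : ℝ} (hA : 0 ≤ A) (c y : Sp n₁ n₂) {ρ τ : ℝ} (hτ : 0 < τ) (hτρ : τ ≤ ρ)
    (h : dist κ c y ≤ A * ρ) :
    volume (ball κ c ρ) ≤
      ENNReal.ofReal (doublingConst n₁ n₂ κ * (C₀ * (A + 1)) ^ homDim n₁ n₂ κ *
        (ρ / τ) ^ homDim n₁ n₂ κ) * volume (ball κ y τ) := by
  have hsub : ball κ c ρ ⊆ ball κ y (C₀ * (A + 1) * (ρ / τ) * τ) := by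
    intro w hw
    have h1 : dist κ c w < ρ := hw
    have h2 := hquasi y w c
    rw [dist_comm κ y c] at h2
    show dist κ y w < _
    rw [mul_assoc _ (ρ / τ), div_mul_cancel₀ _ hτ.ne']
    nlinarith
  have h1 : 1 ≤ ρ / τ := (one_le_div hτ).mpr hτρ
  have h2 : 1 ≤ C₀ * (A + 1) := by nlinarith
  refine (measure_mono hsub).trans ((volume_ball_mul_le κ y
    (one_le_mul_of_one_le_of_one_le h2 h1) hτ).trans (le_of_eq ?_))
  rw [mul_pow, mul_assoc]

end Geometry

/-! ### Joining points by horizontally short segments. -/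

section Segments

variable {n₁ n₂ : ℕ} (κ : ℕ)

theorem norm_fderiv_fst_sq_le (u : Sp n₁ n₂ → ℂ) (x : Sp n₁ n₂) (v : V n₁) :
    ‖fderiv ℝ u x (v, 0)‖ ^ 2 ≤ ‖v‖ ^ 2 * gradSq κ u x := by
  have hv : ((v, 0) : Sp n₁ n₂) = ∑ j, v j • ((EuclideanSpace.single j (1 : ℝ), 0) : Sp n₁ n₂) := by
    rw [Prod.ext_iff, Prod.fst_sum, Prod.snd_sum]
    refine ⟨?_, by simp⟩
    have := (EuclideanSpace.basisFun (Fin n₁) ℝ).sum_repr v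
    simpa using this.symm
  have h1 : ‖fderiv ℝ u x (v, 0)‖ ≤ ∑ j, ‖v j‖ * ‖gradX' j u x‖ := by
    rw [hv, map_sum]
    refine (norm_sum_le _ _).trans (le_of_eq (Finset.sum_congr rfl fun j _ => ?_))
    rw [map_smul, norm_smul]
    rfl
  calc ‖fderiv ℝ u x (v, 0)‖ ^ 2 ≤ (∑ j, ‖v j‖ * ‖gradX' j u x‖) ^ 2 := by gcongr
    _ ≤ (∑ j, ‖v j‖ ^ 2) * ∑ j, ‖gradX' j u x‖ ^ 2 := Finset.sum_mul_sq_le_sq_mul_sq _ _ _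
    _ ≤ ‖v‖ ^ 2 * gradSq κ u x := by
        rw [← EuclideanSpace.norm_sq_eq, gradSq]
        gcongr
        exact le_add_of_nonneg_right (by positivity)

/-- Only the fields whose monomial is a pure power of the largest coordinate x'_i are used; |x'|² ≤
n₁ (x'_i)² then gives the factor n₁^κ. -/
theorem norm_fderiv_snd_sq_le (hn₁ : 1 ≤ n₁) (u : Sp n₁ n₂ → ℂ) (x : Sp n₁ n₂) (v : V n₂) :
    (‖x.1‖ ^ κ) ^ 2 * ‖fderiv ℝ u x (0, v)‖ ^ 2 ≤ n₁ ^ κ * ‖v‖ ^ 2 * gradSq κ u x := by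
  have hv : ((0, v) : Sp n₁ n₂) = ∑ j, v j • ((0, EuclideanSpace.single j (1 : ℝ)) : Sp n₁ n₂) := by
    rw [Prod.ext_iff, Prod.fst_sum, Prod.snd_sum]
    refine ⟨by simp, ?_⟩
    have := (EuclideanSpace.basisFun (Fin n₂) ℝ).sum_repr v
    simpa using this.symm
  set D : Fin n₂ → ℝ := fun k => ‖fderiv ℝ u x (0, EuclideanSpace.single k (1 : ℝ))‖
  have h1 : ‖fderiv ℝ u x (0, v)‖ ≤ ∑ j, ‖v j‖ * D j := by
    rw [hv, map_sum]
    refine (norm_sum_le _ _).trans (le_of_eq (Finset.sum_congr rfl fun j _ => ?_))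
    rw [map_smul, norm_smul]
  have h2 : ‖fderiv ℝ u x (0, v)‖ ^ 2 ≤ ‖v‖ ^ 2 * ∑ k, D k ^ 2 := by
    rw [EuclideanSpace.norm_sq_eq]
    exact (pow_le_pow_left₀ (norm_nonneg _) h1 2).trans (Finset.sum_mul_sq_le_sq_mul_sq _ _ _)
  obtain ⟨i, -, hi⟩ := Finset.exists_max_image Finset.univ (fun i => ‖x.1 i‖ ^ 2)
    ⟨(⟨0, hn₁⟩ : Fin n₁), Finset.mem_univ _⟩
  have h3 : ‖x.1‖ ^ 2 ≤ n₁ * ‖x.1 i‖ ^ 2 := by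
    rw [EuclideanSpace.norm_sq_eq]
    simpa using Finset.sum_le_card_nsmul Finset.univ _ _ hi
  have h4 : ‖x.1 i‖ ^ (2 * κ) * ∑ k, D k ^ 2 ≤ gradSq κ u x := by
    have hmem : Pi.single i κ ∈ Finset.piAntidiag (Finset.univ : Finset (Fin n₁)) κ := by
      simp [Finset.mem_piAntidiag]
    have e : ∑ k, ‖gradX'' (Pi.single i κ) k u x‖ ^ 2 = ‖x.1 i‖ ^ (2 * κ) * ∑ k, D k ^ 2 := by
      rw [Finset.mul_sum]
      refine Finset.sum_congr rfl fun k _ => ?_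
      have hp : ∏ l, x.1 l ^ (Pi.single i κ : Fin n₁ → ℕ) l = x.1 i ^ κ := by
        rw [Finset.prod_eq_single i (fun l _ hl => by rw [Pi.single_eq_of_ne hl, pow_zero])
          (fun h => absurd (Finset.mem_univ i) h), Pi.single_eq_same]
      rw [gradX'', hp, norm_mul, mul_pow, Complex.norm_real, norm_pow, ← pow_mul, mul_comm κ 2]
    rw [← e, gradSq]
    refine (Finset.single_le_sum (f := fun α => ∑ k, ‖gradX'' α k u x‖ ^ 2)
      (fun α _ => by positivity) hmem).trans (le_add_of_nonneg_left (by positivity))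
  have hD : 0 ≤ ∑ k, D k ^ 2 := by positivity
  calc (‖x.1‖ ^ κ) ^ 2 * ‖fderiv ℝ u x (0, v)‖ ^ 2
      = (‖x.1‖ ^ 2) ^ κ * ‖fderiv ℝ u x (0, v)‖ ^ 2 := by rw [← pow_mul, ← pow_mul, mul_comm κ 2]
    _ ≤ (n₁ * ‖x.1 i‖ ^ 2) ^ κ * (‖v‖ ^ 2 * ∑ k, D k ^ 2) := by gcongr
    _ = n₁ ^ κ * ‖v‖ ^ 2 * (‖x.1 i‖ ^ (2 * κ) * ∑ k, D k ^ 2) := by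
        rw [mul_pow, ← pow_mul]; ring
    _ ≤ _ := by gcongr

/-- The segment from `p` to `q` stays close to `y`, and its horizontal length is comparable
to `ρ`. -/
def GoodSegment (ρ : ℝ) (y p q : Sp n₁ n₂) : Prop :=
  ∀ t ∈ Set.Icc (0 : ℝ) 1, dist κ y (p + t • (q - p)) ≤ (1 + 4 ^ κ) * ρ ∧
    ∀ u : Sp n₁ n₂ → ℂ, ‖fderiv ℝ u (p + t • (q - p)) (q - p)‖ ^ 2 ≤
      4 * (4 * n₁) ^ κ * ρ ^ 2 * gradSq κ u (p + t • (q - p))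

theorem gradSq_nonneg (u : Sp n₁ n₂ → ℂ) (x : Sp n₁ n₂) : 0 ≤ gradSq κ u x := by
  rw [gradSq]
  positivity

/-- A step of length ρ directly away from the origin. At the new point the vertical fields have full
strength (|v|+ρ)^κ, even if v = 0, where n₁ ≥ 1 provides a direction. -/
theorem exists_norm_add_smul_eq (hn₁ : 1 ≤ n₁) (v : V n₁) {ρ : ℝ} (hρ : 0 ≤ ρ) :
    ∃ p : V n₁, ‖p - v‖ = ρ ∧ ‖p‖ = ‖v‖ + ρ := by
  by_cases hv : v = 0
  · refine ⟨EuclideanSpace.single ⟨0, hn₁⟩ ρ, ?_, ?_⟩ <;> simp [hv, abs_of_nonneg hρ]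
  · have hv' : 0 < ‖v‖ := norm_pos_iff.mpr hv
    refine ⟨(1 + ρ / ‖v‖) • v, ?_, ?_⟩
    · rw [add_smul, one_smul, add_sub_cancel_left, norm_smul, Real.norm_of_nonneg (by positivity),
        div_mul_cancel₀ _ hv'.ne']
    · rw [norm_smul, Real.norm_of_nonneg (by positivity), add_mul, div_mul_cancel₀ _ hv'.ne',
        one_mul]

/-- Two points at distance at most `ρ` are joined by three good segments. -/
theorem exists_goodSegments (hn₁ : 1 ≤ n₁) {ρ : ℝ} (hρ : 0 < ρ) (y z : Sp n₁ n₂)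
    (h : dist κ y z ≤ ρ) :
    ∃ p q : Sp n₁ n₂, GoodSegment κ ρ y y p ∧ GoodSegment κ ρ y p q ∧ GoodSegment κ ρ y q z := by
  obtain ⟨p, hp1, hp2⟩ := exists_norm_add_smul_eq hn₁ y.1 hρ.le
  have hz1 := (norm_fst_le_dist κ y z).trans h
  have hz2 := norm_snd_le κ y z h
  have h4 : (4 : ℝ) ^ κ = 2 ^ κ * 2 ^ κ := by rw [← mul_pow]; norm_num
  have hn : (1 : ℝ) ≤ n₁ := by exact_mod_cast hn₁
  have hL : (1 : ℝ) ≤ (4 * n₁) ^ κ := one_le_pow₀ (by linarith)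
  have h2κ : (1 : ℝ) ≤ 2 ^ κ := one_le_pow₀ one_le_two
  have hd : ∀ x : Sp n₁ n₂, ‖y.1 - x.1‖ ≤ ρ → ‖y.2 - x.2‖ ≤ ‖y.2 - z.2‖ →
      dist κ y x ≤ (1 + 4 ^ κ) * ρ := fun x h1 h2 => by
    rw [h4]
    exact dist_le_of_norm_le κ y x hρ.le h2κ h1 (h2.trans hz2)
  have hhor : ∀ (a b : V n₁) (e : V n₂), ‖b - a‖ ≤ 2 * ρ → ∀ (x : Sp n₁ n₂) (u : Sp n₁ n₂ → ℂ),
      ‖fderiv ℝ u x ((b, e) - (a, e))‖ ^ 2 ≤ 4 * (4 * n₁) ^ κ * ρ ^ 2 * gradSq κ u x := by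
    intro a b e hab x u
    rw [Prod.mk_sub_mk, sub_self]
    refine (norm_fderiv_fst_sq_le κ u x (b - a)).trans ?_
    have := gradSq_nonneg κ u x
    gcongr
    calc ‖b - a‖ ^ 2 ≤ (2 * ρ) ^ 2 := by gcongr
      _ = 4 * 1 * ρ ^ 2 := by ring
      _ ≤ _ := by gcongr
  -- Out to `p` horizontally, then vertically, then back horizontally. The vertical displacement is
  -- at most 2^κ ρ (|y'|+ρ)^κ, and since |p| = |y'|+ρ its horizontal length is O(ρ).
  refine ⟨(p, y.2), (p, z.2), fun t ht => ⟨hd _ ?_ ?_, fun u => ?_⟩,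
    fun t ht => ⟨hd _ ?_ ?_, fun u => ?_⟩, fun t ht => ⟨hd _ ?_ ?_, fun u => ?_⟩⟩
  · simp only [Prod.fst_add, Prod.smul_fst, Prod.fst_sub]
    rw [sub_add_cancel_left, norm_neg, norm_smul, hp1, Real.norm_of_nonneg ht.1]
    exact mul_le_of_le_one_left hρ.le ht.2
  · simp
  · exact hhor y.1 p y.2 (by linarith) _ u
  · simp only [Prod.fst_add, Prod.smul_fst, Prod.fst_sub, sub_self, smul_zero, add_zero]
    rw [norm_sub_rev, hp1]
  · simp only [Prod.snd_add, Prod.smul_snd, Prod.snd_sub]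
    rw [sub_add_cancel_left, norm_neg, norm_smul, norm_sub_rev, Real.norm_of_nonneg ht.1]
    exact mul_le_of_le_one_left (norm_nonneg _) ht.2
  · set x : Sp n₁ n₂ := (p, y.2) + t • ((p, z.2) - (p, y.2)) with hx
    have hx1 : x.1 = p := by simp [hx]
    have := norm_fderiv_snd_sq_le κ hn₁ u x (z.2 - y.2)
    rw [hx1, hp2] at this
    have hpos : 0 < ((‖y.1‖ + ρ) ^ κ) ^ 2 := by positivity
    have hg := gradSq_nonneg κ u x
    rw [Prod.mk_sub_mk, sub_self]
    refine le_of_mul_le_mul_left (this.trans ?_) hpos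
    calc (n₁ : ℝ) ^ κ * ‖z.2 - y.2‖ ^ 2 * gradSq κ u x
        ≤ (n₁ : ℝ) ^ κ * (2 ^ κ * ρ * (‖y.1‖ + ρ) ^ κ) ^ 2 * gradSq κ u x := by
          rw [norm_sub_rev]
          gcongr
      _ = ((‖y.1‖ + ρ) ^ κ) ^ 2 * (1 * (4 * n₁) ^ κ * ρ ^ 2 * gradSq κ u x) := by
          rw [mul_pow 4, h4]; ring
      _ ≤ _ := by
          gcongr
          norm_num
  · simp only [Prod.fst_add, Prod.smul_fst, Prod.fst_sub]
    have e : y.1 - (p + t • (z.1 - p)) = (1 - t) • (y.1 - p) + t • (y.1 - z.1) := by module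
    rw [e]
    refine (norm_add_le _ _).trans ?_
    rw [norm_smul, norm_smul, norm_sub_rev y.1 p, hp1, Real.norm_of_nonneg ht.1,
      Real.norm_of_nonneg (by linarith [ht.2])]
    nlinarith [ht.1]
  · simp
  · refine hhor p z.1 z.2 ?_ _ u
    have : z.1 - p = (z.1 - y.1) - (p - y.1) := by abel
    rw [this]
    refine (norm_sub_le _ _).trans ?_
    rw [hp1, norm_sub_rev]
    linarith

end Segments

/-! ### Auxiliary inequalities for extended nonnegative reals. -/

theorem le_of_sq_le_mul_sq {a b c : ℝ≥0∞} (h : a ^ 2 ≤ c * b ^ 2) : a ≤ (c + 1) * b := by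
  refine (ENNReal.pow_right_strictMono (n := 2) two_ne_zero).le_iff_le.mp (h.trans ?_)
  rw [mul_pow]
  gcongr
  -- As c ≤ (c + 1)², the constant c + 1 can stand in for the square root of c.
  calc c ≤ c * c + 2 * c + 1 := by
        refine le_add_right (le_add_left ?_)
        rw [two_mul]
        exact le_self_add
    _ = (c + 1) ^ 2 := by ring

theorem sq_lintegral_mul_le {α : Type} [MeasurableSpace α] {μ : Measure α} {f g : α → ℝ≥0∞}
    (hf : AEMeasurable f μ) (hg : AEMeasurable g μ) :
    (∫⁻ x, f x * g x ∂μ) ^ 2 ≤ (∫⁻ x, f x ^ 2 ∂μ) * ∫⁻ x, g x ^ 2 ∂μ := by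
  have h := ENNReal.lintegral_mul_le_Lp_mul_Lq μ Real.HolderConjugate.two_two hf hg
  have e : ∀ a : ℝ≥0∞, (a ^ (1 / (2 : ℝ))) ^ 2 = a := fun a => by
    rw [← ENNReal.rpow_natCast, ← ENNReal.rpow_mul]
    norm_num
  refine (pow_le_pow_left' h 2).trans (le_of_eq ?_)
  rw [mul_pow, e, e]
  simp only [ENNReal.rpow_ofNat]

/-- A geometric series with ratio `2 ^ (-ε)`. -/
def geomSum (ε : ℝ) : ℝ≥0∞ := ∑' k : ℕ, ENNReal.ofReal ((2 : ℝ) ^ (-ε * k))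

theorem geomSum_ne_top {ε : ℝ} (hε : 0 < ε) : geomSum ε ≠ ∞ := by
  have h : ∀ k : ℕ, ENNReal.ofReal ((2 : ℝ) ^ (-ε * k)) = ENNReal.ofReal ((2 : ℝ) ^ (-ε)) ^ k :=
    fun k => by
      rw [← ENNReal.ofReal_pow (by positivity), Real.rpow_mul two_pos.le, Real.rpow_natCast]
  rw [geomSum]
  simp only [h]
  rw [ENNReal.tsum_geometric]
  refine ENNReal.inv_ne_top.mpr (tsub_pos_of_lt ?_).ne'
  rw [ENNReal.ofReal_lt_one]
  exact Real.rpow_lt_one_of_one_lt_of_neg one_lt_two (by linarith)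

/-! ### Weighted integrals controlled by the maximal function. -/

section Maximal

variable {n₁ n₂ : ℕ} (κ : ℕ)

theorem lintegral_ball_le_maximal2 (f : Sp n₁ n₂ → ℂ) {x c : Sp n₁ n₂} {r : ℝ} (hr : 0 < r)
    (hx : x ∈ ball κ c r) :
    ∫⁻ y in ball κ c r, ‖f y‖ₑ ^ 2 ≤ volume (ball κ c r) * maximal2 κ f x ^ 2 := by
  have e : maximal2 κ f x ^ 2 = ⨆ (c : Sp n₁ n₂) (r : ℝ) (_ : 0 < r) (_ : x ∈ ball κ c r),
      (∫⁻ y in ball κ c r, ‖f y‖ₑ ^ 2) / volume (ball κ c r) := by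
    rw [maximal2, ← ENNReal.rpow_natCast, ← ENNReal.rpow_mul]
    norm_num
  rw [e, mul_comm, ← ENNReal.div_le_iff (volume_ball_ne_zero κ c hr) (volume_ball_ne_top κ c hr)]
  exact le_iSup_of_le c (le_iSup_of_le r (le_iSup_of_le hr (le_iSup_of_le hx le_rfl)))

/-- The constant in the estimate of tails. -/
def shellConst (n₁ n₂ κ : ℕ) (R₀ : ℝ) : ℝ≥0∞ :=
  ENNReal.ofReal (doublingConst n₁ n₂ κ * 2 ^ homDim n₁ n₂ κ) *
    geomSum (2 * R₀ - homDim n₁ n₂ κ)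

theorem shellConst_ne_top {R₀ : ℝ} (hR₀ : (homDim n₁ n₂ κ : ℝ) / 2 < R₀) :
    shellConst n₁ n₂ κ R₀ ≠ ∞ :=
  ENNReal.mul_ne_top ENNReal.ofReal_ne_top (geomSum_ne_top (by linarith))

/-- On the shell 2^k ρ ≤ d < 2^{k+1} ρ the weight gains 2^{-2R₀k} and doubling loses 2^{Qk}. The
resulting geometric series is kept in the constant; its finiteness, where R₀ > Q/2 enters, is
`shellConst_ne_top`. -/
theorem lintegral_tail_le (R₀ : ℝ) (hR₀ : 0 ≤ R₀) (f : Sp n₁ n₂ → ℂ) {x c : Sp n₁ n₂} {r ρ : ℝ}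
    (hr : 0 < r) (hrρ : r ≤ ρ) (hx : x ∈ ball κ c r) :
    ∫⁻ w in {w | ρ ≤ dist κ c w}, ENNReal.ofReal (dist κ c w ^ (-(2 * R₀))) * ‖f w‖ₑ ^ 2 ≤
      shellConst n₁ n₂ κ R₀ * ENNReal.ofReal (ρ ^ (-(2 * R₀))) * volume (ball κ c ρ) *
        maximal2 κ f x ^ 2 := by
  have hρ : 0 < ρ := hr.trans_le hrρ
  set Q := homDim n₁ n₂ κ
  set S : ℕ → Set (Sp n₁ n₂) := fun k => {w | 2 ^ k * ρ ≤ dist κ c w ∧ dist κ c w < 2 ^ (k + 1) * ρ}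
  have hSm : ∀ k, MeasurableSet (S k) := fun k =>
    (measurable_dist_right κ c measurableSet_Ici).inter
      (measurable_dist_right κ c measurableSet_Iio)
  have hsub : {w | ρ ≤ dist κ c w} ⊆ ⋃ k, S k := by
    intro w hw
    obtain ⟨k, h1, h2⟩ := exists_nat_pow_near ((one_le_div hρ).mpr hw) (one_lt_two (α := ℝ))
    rw [le_div_iff₀ hρ] at h1
    rw [div_lt_iff₀ hρ] at h2
    exact Set.mem_iUnion.mpr ⟨k, h1, h2⟩
  have hk : ∀ k, ∫⁻ w in S k, ENNReal.ofReal (dist κ c w ^ (-(2 * R₀))) * ‖f w‖ₑ ^ 2 ≤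
      ENNReal.ofReal ((2 : ℝ) ^ (-(2 * R₀ - Q) * k)) *
        (ENNReal.ofReal (doublingConst n₁ n₂ κ * 2 ^ Q) * ENNReal.ofReal (ρ ^ (-(2 * R₀))) *
          volume (ball κ c ρ) * maximal2 κ f x ^ 2) := by
    intro k
    have hpk : (0 : ℝ) < 2 ^ k * ρ := by positivity
    have h1k : (1 : ℝ) ≤ 2 ^ (k + 1) := one_le_pow₀ one_le_two
    have hxk : x ∈ ball κ c (2 ^ (k + 1) * ρ) := by
      refine lt_of_lt_of_le hx (hrρ.trans ?_)
      exact le_mul_of_one_le_left hρ.le h1k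
    calc ∫⁻ w in S k, ENNReal.ofReal (dist κ c w ^ (-(2 * R₀))) * ‖f w‖ₑ ^ 2
        ≤ ∫⁻ w in S k, ENNReal.ofReal ((2 ^ k * ρ) ^ (-(2 * R₀))) * ‖f w‖ₑ ^ 2 := by
          refine setLIntegral_mono' (hSm k) fun w hw => ?_
          gcongr ENNReal.ofReal ?_ * _
          exact Real.rpow_le_rpow_of_nonpos hpk hw.1 (by linarith)
      _ = ENNReal.ofReal ((2 ^ k * ρ) ^ (-(2 * R₀))) * ∫⁻ w in S k, ‖f w‖ₑ ^ 2 :=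
          lintegral_const_mul' _ _ ENNReal.ofReal_ne_top
      _ ≤ ENNReal.ofReal ((2 ^ k * ρ) ^ (-(2 * R₀))) *
          ∫⁻ w in ball κ c (2 ^ (k + 1) * ρ), ‖f w‖ₑ ^ 2 := by
          gcongr
          exact fun w hw => hw.2
      _ ≤ ENNReal.ofReal ((2 ^ k * ρ) ^ (-(2 * R₀))) *
          (ENNReal.ofReal (doublingConst n₁ n₂ κ * (2 ^ (k + 1)) ^ Q) * volume (ball κ c ρ) *
            maximal2 κ f x ^ 2) := by
          gcongr
          refine (lintegral_ball_le_maximal2 κ f (by positivity) hxk).trans ?_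
          gcongr
          exact volume_ball_mul_le κ c h1k hρ
      _ = _ := by
          simp only [← mul_assoc]
          congr 2
          have hD := doublingConst_pos (n₁ := n₁) (n₂ := n₂) κ
          rw [← ENNReal.ofReal_mul (by positivity), ← ENNReal.ofReal_mul (by positivity),
            ← ENNReal.ofReal_mul (by positivity)]
          congr 1
          have e1 : ((2 : ℝ) ^ k * ρ) ^ (-(2 * R₀)) = 2 ^ (-(2 * R₀) * k) * ρ ^ (-(2 * R₀)) := by
            rw [Real.mul_rpow (by positivity) hρ.le, ← Real.rpow_natCast 2 k,
              ← Real.rpow_mul two_pos.le, mul_comm (k : ℝ)]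
          have e2 : ((2 : ℝ) ^ (k + 1)) ^ Q = 2 ^ ((Q : ℝ) * k) * 2 ^ Q := by
            rw [pow_succ, mul_pow, Real.rpow_mul two_pos.le, Real.rpow_natCast, Real.rpow_natCast,
              ← pow_mul, ← pow_mul, mul_comm k]
          have e3 : (2 : ℝ) ^ (-(2 * R₀ - Q) * k) = 2 ^ (-(2 * R₀) * k) * 2 ^ ((Q : ℝ) * k) := by
            rw [← Real.rpow_add two_pos]
            congr 1
            ring
          rw [e1, e2, e3]
          ring
  refine ((lintegral_mono_set hsub).trans (lintegral_iUnion_le _ _)).trans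
    ((ENNReal.tsum_le_tsum hk).trans (le_of_eq ?_))
  rw [ENNReal.tsum_mul_right, shellConst, geomSum]
  ring

variable {κ} {C₀ : ℝ} (hC₀ : 1 < C₀)
  (hquasi : ∀ x y z : Sp n₁ n₂, dist κ x y ≤ C₀ * (dist κ x z + dist κ z y))

/-- The constant comparing balls with different centres. -/
def centreConst (n₁ n₂ κ : ℕ) (C₀ A : ℝ) : ℝ :=
  doublingConst n₁ n₂ κ * (C₀ * (A + 1)) ^ homDim n₁ n₂ κ

include hC₀ hquasi in
-- Cauchy–Schwarz on a ball about c. The maximal function takes the factor f, and the volume it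
-- leaves is exchanged for that of the ball of radius τ about y at the cost of (ρ/τ)^Q.
theorem sq_lintegral_inner_le {f : Sp n₁ n₂ → ℂ} (hf : Measurable f) {x c y : Sp n₁ n₂}
    {r ρ τ A E : ℝ} (hr : 0 < r) (hrρ : r ≤ ρ) (hτ : 0 < τ) (hτρ : τ ≤ ρ) (hA : 0 ≤ A)
    (hE : 0 ≤ E) (hx : x ∈ ball κ c r) (hy : dist κ c y ≤ A * ρ) {S : Set (Sp n₁ n₂)}
    (hS : ∀ w ∈ S, dist κ c w < ρ) {G : Sp n₁ n₂ → ℝ≥0∞} (hG : Measurable G)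
    (hGE : volume (ball κ y τ) * ∫⁻ w in S, G w ^ 2 ≤ ENNReal.ofReal E) :
    (∫⁻ w in S, G w * ‖f w‖ₑ) ^ 2 ≤ ENNReal.ofReal (centreConst n₁ n₂ κ C₀ A) *
      (ENNReal.ofReal (E * (ρ / τ) ^ homDim n₁ n₂ κ) * maximal2 κ f x ^ 2) := by
  have hρ : 0 < ρ := hr.trans_le hrρ
  have hv := volume_ball_le_of_dist_le κ hC₀ hquasi hA c y hτ hτρ hy
  have hD := doublingConst_pos (n₁ := n₁) (n₂ := n₂) κ
  have hC : 0 ≤ centreConst n₁ n₂ κ C₀ A := by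
    rw [centreConst]
    have : 0 < C₀ := by linarith
    positivity
  rw [← centreConst, ENNReal.ofReal_mul hC] at hv
  calc (∫⁻ w in S, G w * ‖f w‖ₑ) ^ 2
      ≤ (∫⁻ w in S, G w ^ 2) * ∫⁻ w in S, ‖f w‖ₑ ^ 2 :=
        sq_lintegral_mul_le hG.aemeasurable hf.enorm.aemeasurable
    _ ≤ (∫⁻ w in S, G w ^ 2) * (volume (ball κ c ρ) * maximal2 κ f x ^ 2) := by
        gcongr
        exact (lintegral_mono_set hS).trans
          (lintegral_ball_le_maximal2 κ f hρ (lt_of_lt_of_le hx hrρ))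
    _ ≤ (∫⁻ w in S, G w ^ 2) * (ENNReal.ofReal (centreConst n₁ n₂ κ C₀ A) *
          ENNReal.ofReal ((ρ / τ) ^ homDim n₁ n₂ κ) * volume (ball κ y τ) *
            maximal2 κ f x ^ 2) := by gcongr
    _ = (volume (ball κ y τ) * ∫⁻ w in S, G w ^ 2) * (ENNReal.ofReal (centreConst n₁ n₂ κ C₀ A) *
          ENNReal.ofReal ((ρ / τ) ^ homDim n₁ n₂ κ) * maximal2 κ f x ^ 2) := by ring
    _ ≤ ENNReal.ofReal E * (ENNReal.ofReal (centreConst n₁ n₂ κ C₀ A) *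
          ENNReal.ofReal ((ρ / τ) ^ homDim n₁ n₂ κ) * maximal2 κ f x ^ 2) := by gcongr
    _ = _ := by
        rw [ENNReal.ofReal_mul hE]
        ring

/-- The constant in the estimate of integrals away from the centre. -/
def outerConst (n₁ n₂ κ : ℕ) (C₀ R₀ A : ℝ) : ℝ≥0∞ :=
  ENNReal.ofReal ((2 * C₀) ^ (2 * R₀)) * shellConst n₁ n₂ κ R₀ *
    ENNReal.ofReal (centreConst n₁ n₂ κ C₀ A)

theorem outerConst_ne_top {R₀ : ℝ} (hR₀ : (homDim n₁ n₂ κ : ℝ) / 2 < R₀) (C₀ A : ℝ) :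
    outerConst n₁ n₂ κ C₀ R₀ A ≠ ∞ :=
  ENNReal.mul_ne_top (ENNReal.mul_ne_top ENNReal.ofReal_ne_top (shellConst_ne_top κ hR₀))
    ENNReal.ofReal_ne_top

include hC₀ hquasi in
-- Cauchy–Schwarz with the weight d(y,w)^{R₀} on G and its inverse on f. On S the inverse weight is
-- bounded by a multiple of d(c,w)^{-R₀}, so the tail estimate applies.
theorem sq_lintegral_outer_le {R₀ : ℝ} (hR₀ : 0 ≤ R₀) {f : Sp n₁ n₂ → ℂ} (hf : Measurable f)
    {x c y : Sp n₁ n₂} {r ρ τ A E : ℝ} (hr : 0 < r) (hrρ : r ≤ ρ) (hτ : 0 < τ) (hτρ : τ ≤ ρ)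
    (hA : 0 ≤ A) (hE : 0 ≤ E) (hx : x ∈ ball κ c r) (hy : dist κ c y ≤ A * ρ)
    {S : Set (Sp n₁ n₂)} (hSm : MeasurableSet S) (hS : ∀ w ∈ S, ρ ≤ dist κ c w)
    (hS' : ∀ w ∈ S, dist κ c w ≤ 2 * C₀ * dist κ y w) {G : Sp n₁ n₂ → ℝ≥0∞} (hG : Measurable G)
    (hGE : volume (ball κ y τ) * ∫⁻ w in S, ENNReal.ofReal (dist κ y w ^ (2 * R₀)) * G w ^ 2 ≤
      ENNReal.ofReal E) :
    (∫⁻ w in S, G w * ‖f w‖ₑ) ^ 2 ≤ outerConst n₁ n₂ κ C₀ R₀ A *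
      (ENNReal.ofReal (E * (ρ / τ) ^ homDim n₁ n₂ κ * ρ ^ (-(2 * R₀))) * maximal2 κ f x ^ 2) := by
  have hρ : 0 < ρ := hr.trans_le hrρ
  have hC₀' : 0 < C₀ := by linarith
  have hv := volume_ball_le_of_dist_le κ hC₀ hquasi hA c y hτ hτρ hy
  have hD := doublingConst_pos (n₁ := n₁) (n₂ := n₂) κ
  have hC : 0 ≤ centreConst n₁ n₂ κ C₀ A := by
    rw [centreConst]
    positivity
  rw [← centreConst, ENNReal.ofReal_mul hC] at hv
  have hdc : ∀ w ∈ S, 0 < dist κ c w := fun w hw => hρ.trans_le (hS w hw)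
  have hdy : ∀ w ∈ S, 0 < dist κ y w := fun w hw => by
    have := (hdc w hw).trans_le (hS' w hw)
    exact pos_of_mul_pos_right this (by positivity)
  have hθm : Measurable fun w => dist κ y w := measurable_dist_right κ y
  have h1 : ∫⁻ w in S, G w * ‖f w‖ₑ = ∫⁻ w in S, (ENNReal.ofReal (dist κ y w ^ R₀) * G w) *
      (ENNReal.ofReal (dist κ y w ^ (-R₀)) * ‖f w‖ₑ) := by
    refine setLIntegral_congr_fun hSm fun w hw => ?_
    have : ENNReal.ofReal (dist κ y w ^ R₀) * ENNReal.ofReal (dist κ y w ^ (-R₀)) = 1 := by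
      rw [← ENNReal.ofReal_mul (Real.rpow_nonneg (dist_nonneg κ y w) _),
        ← Real.rpow_add (hdy w hw), add_neg_cancel, Real.rpow_zero, ENNReal.ofReal_one]
    rw [mul_mul_mul_comm, this, one_mul]
  have hsq : ∀ (w : Sp n₁ n₂) (a : ℝ), ENNReal.ofReal (dist κ y w ^ a) ^ 2 =
      ENNReal.ofReal (dist κ y w ^ (2 * a)) := fun w a => by
    rw [← ENNReal.ofReal_pow (Real.rpow_nonneg (dist_nonneg κ y w) _), mul_comm 2 a,
      Real.rpow_mul (dist_nonneg κ y w), Real.rpow_two]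
  have h2 : ∫⁻ w in S, (ENNReal.ofReal (dist κ y w ^ (-R₀)) * ‖f w‖ₑ) ^ 2 ≤
      ENNReal.ofReal ((2 * C₀) ^ (2 * R₀)) *
        (shellConst n₁ n₂ κ R₀ * ENNReal.ofReal (ρ ^ (-(2 * R₀))) * volume (ball κ c ρ) *
          maximal2 κ f x ^ 2) := by
    calc ∫⁻ w in S, (ENNReal.ofReal (dist κ y w ^ (-R₀)) * ‖f w‖ₑ) ^ 2
        ≤ ∫⁻ w in S, ENNReal.ofReal ((2 * C₀) ^ (2 * R₀)) *
            (ENNReal.ofReal (dist κ c w ^ (-(2 * R₀))) * ‖f w‖ₑ ^ 2) := by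
          refine setLIntegral_mono' hSm fun w hw => ?_
          rw [mul_pow, hsq, ← mul_assoc, ← ENNReal.ofReal_mul (by positivity)]
          gcongr
          have h3 : dist κ c w / (2 * C₀) ≤ dist κ y w := by
            rw [div_le_iff₀ (by positivity), mul_comm]
            exact hS' w hw
          have h4 := Real.rpow_le_rpow_of_nonpos (z := 2 * -R₀)
            (div_pos (hdc w hw) (by positivity)) h3 (by linarith)
          refine h4.trans (le_of_eq ?_)
          rw [Real.div_rpow (hdc w hw).le (by positivity), mul_neg, Real.rpow_neg (x := 2 * C₀)
            (by positivity), div_inv_eq_mul, mul_comm]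
      _ = ENNReal.ofReal ((2 * C₀) ^ (2 * R₀)) *
            ∫⁻ w in S, ENNReal.ofReal (dist κ c w ^ (-(2 * R₀))) * ‖f w‖ₑ ^ 2 :=
          lintegral_const_mul' _ _ ENNReal.ofReal_ne_top
      _ ≤ _ := by
          gcongr
          exact (lintegral_mono_set hS).trans (lintegral_tail_le κ R₀ hR₀ f hr hrρ hx)
  have h3 : ∫⁻ w in S, (ENNReal.ofReal (dist κ y w ^ R₀) * G w) ^ 2 =
      ∫⁻ w in S, ENNReal.ofReal (dist κ y w ^ (2 * R₀)) * G w ^ 2 := by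
    simp only [mul_pow, hsq]
  set I := ∫⁻ w in S, ENNReal.ofReal (dist κ y w ^ (2 * R₀)) * G w ^ 2
  calc (∫⁻ w in S, G w * ‖f w‖ₑ) ^ 2
      ≤ I * ∫⁻ w in S, (ENNReal.ofReal (dist κ y w ^ (-R₀)) * ‖f w‖ₑ) ^ 2 := by
        rw [h1, ← h3]
        exact sq_lintegral_mul_le ((hθm.pow_const _).ennreal_ofReal.mul hG).aemeasurable
          ((hθm.pow_const _).ennreal_ofReal.mul hf.enorm).aemeasurable
    _ ≤ I * (ENNReal.ofReal ((2 * C₀) ^ (2 * R₀)) *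
        (shellConst n₁ n₂ κ R₀ * ENNReal.ofReal (ρ ^ (-(2 * R₀))) *
          (ENNReal.ofReal (centreConst n₁ n₂ κ C₀ A) *
            ENNReal.ofReal ((ρ / τ) ^ homDim n₁ n₂ κ) * volume (ball κ y τ)) *
          maximal2 κ f x ^ 2)) := by
        gcongr
        refine h2.trans ?_
        gcongr
    _ = (volume (ball κ y τ) * I) * (outerConst n₁ n₂ κ C₀ R₀ A * (ENNReal.ofReal
          (ρ ^ (-(2 * R₀))) * ENNReal.ofReal ((ρ / τ) ^ homDim n₁ n₂ κ) *
            maximal2 κ f x ^ 2)) := by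
        rw [outerConst]
        ring
    _ ≤ ENNReal.ofReal E * (outerConst n₁ n₂ κ C₀ R₀ A * (ENNReal.ofReal
          (ρ ^ (-(2 * R₀))) * ENNReal.ofReal ((ρ / τ) ^ homDim n₁ n₂ κ) *
            maximal2 κ f x ^ 2)) := by gcongr
    _ = _ := by
        rw [ENNReal.ofReal_mul (by positivity), ENNReal.ofReal_mul hE]
        ring

end Maximal

/-! ### Increments of a kernel along a segment. -/

section Segment

variable {n₁ n₂ : ℕ}

theorem hasDerivAt_segment {u : Sp n₁ n₂ → ℂ} (hu : ContDiff ℝ 1 u) (p q : Sp n₁ n₂) (t : ℝ) :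
    HasDerivAt (fun t : ℝ => u (p + t • (q - p))) (fderiv ℝ u (p + t • (q - p)) (q - p)) t := by
  have h1 : HasDerivAt (fun t : ℝ => p + t • (q - p)) (q - p) t := by
    simpa using ((hasDerivAt_id t).smul_const (q - p)).const_add p
  exact ((hu.differentiable one_ne_zero _).hasFDerivAt).comp_hasDerivAt t h1

theorem enorm_sub_le_lintegral_segment {u : Sp n₁ n₂ → ℂ} (hu : ContDiff ℝ 1 u)
    (p q : Sp n₁ n₂) :
    ‖u q - u p‖ₑ ≤ ∫⁻ t in Set.Ioc (0 : ℝ) 1, ‖fderiv ℝ u (p + t • (q - p)) (q - p)‖ₑ := by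
  have hc : Continuous fun t : ℝ => fderiv ℝ u (p + t • (q - p)) (q - p) := by
    have := hu.continuous_fderiv one_ne_zero
    fun_prop
  have h := intervalIntegral.integral_eq_sub_of_hasDerivAt
    (fun t _ => hasDerivAt_segment hu p q t) (hc.intervalIntegrable 0 1)
  simp only [one_smul, zero_smul, add_zero, add_sub_cancel] at h
  rw [← h, intervalIntegral.integral_of_le zero_le_one]
  exact enorm_integral_le_lintegral_enorm _

/-- The upper limit of difference quotients of a kernel along a segment. -/
def segmentDeriv (K : Sp n₁ n₂ → Sp n₁ n₂ → ℂ) (p q : Sp n₁ n₂) (t : ℝ) (w : Sp n₁ n₂) : ℝ≥0∞ :=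
  limsup (fun n : ℕ => ‖((1 : ℝ) / (n + 1))⁻¹ •
    (K (p + (t + 1 / (n + 1)) • (q - p)) w - K (p + t • (q - p)) w)‖ₑ) atTop

/-- The kernel is differentiable only for almost every w, so joint measurability of its derivative
is not at hand. A limsup of difference quotients is jointly measurable in all cases and gives the
norm of the derivative whenever it exists; Tonelli's theorem needs this. -/
theorem measurable_segmentDeriv {K : Sp n₁ n₂ → Sp n₁ n₂ → ℂ}
    (hK : Measurable (Function.uncurry K)) (p q : Sp n₁ n₂) :
    Measurable (Function.uncurry (segmentDeriv K p q)) := by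
  have h : ∀ a : ℝ, Measurable fun s : ℝ × Sp n₁ n₂ => K (p + (s.1 + a) • (q - p)) s.2 :=
    fun a => by
      have hg : Measurable fun s : ℝ × Sp n₁ n₂ => (p + (s.1 + a) • (q - p), s.2) := by fun_prop
      exact Measurable.comp (g := Function.uncurry K) hK hg
  have h0 : Measurable fun s : ℝ × Sp n₁ n₂ => K (p + s.1 • (q - p)) s.2 := by
    simpa only [add_zero] using h 0
  have h1 : ∀ n : ℕ, Measurable fun s : ℝ × Sp n₁ n₂ => ‖((1 : ℝ) / (n + 1))⁻¹ •
      (K (p + (s.1 + 1 / (n + 1)) • (q - p)) s.2 - K (p + s.1 • (q - p)) s.2)‖ₑ :=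
    fun n => (((h (1 / (n + 1))).sub h0).const_smul ((1 : ℝ) / (n + 1))⁻¹).enorm
  exact Measurable.limsup h1

theorem segmentDeriv_eq {K : Sp n₁ n₂ → Sp n₁ n₂ → ℂ} {w : Sp n₁ n₂}
    (hw : ContDiff ℝ 1 fun x => K x w) (p q : Sp n₁ n₂) (t : ℝ) :
    segmentDeriv K p q t w = ‖fderiv ℝ (fun x => K x w) (p + t • (q - p)) (q - p)‖ₑ := by
  have h := hasDerivAt_iff_tendsto_slope_zero.mp (hasDerivAt_segment hw p q t)
  generalize fderiv ℝ (fun x => K x w) (p + t • (q - p)) (q - p) = D at h ⊢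
  have h1 : Tendsto (fun n : ℕ => (1 : ℝ) / (n + 1)) atTop (𝓝[≠] 0) :=
    tendsto_nhdsWithin_iff.mpr ⟨tendsto_one_div_add_atTop_nhds_zero_nat,
      Eventually.of_forall fun n => by
        have : (1 : ℝ) / (n + 1) ≠ 0 := by positivity
        exact this⟩
  have h2 := (h.comp h1).enorm.limsup_eq
  rw [segmentDeriv, ← h2]
  rfl

theorem measurable_swap_uncurry {α β γ : Type} [MeasurableSpace α] [MeasurableSpace β]
    [MeasurableSpace γ] {f : α → β → γ} (hf : Measurable (Function.uncurry f)) :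
    Measurable fun s : β × α => f s.2 s.1 :=
  hf.comp measurable_swap

/-- Estimate of the increment of a kernel along a segment through its directional derivative. -/
theorem lintegral_sub_mul_le {K : Sp n₁ n₂ → Sp n₁ n₂ → ℂ} (hK : Measurable (Function.uncurry K))
    (hdiff : ∀ᵐ w, ContDiff ℝ 1 fun x => K x w) (p q : Sp n₁ n₂) {f : Sp n₁ n₂ → ℂ}
    (hf : Measurable f) (S : Set (Sp n₁ n₂)) (b : ℝ≥0∞)
    (hb : ∀ t ∈ Set.Icc (0 : ℝ) 1, ∀ G : Sp n₁ n₂ → ℝ≥0∞, Measurable G →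
      (∀ᵐ w, G w = ‖fderiv ℝ (fun x => K x w) (p + t • (q - p)) (q - p)‖ₑ) →
        ∫⁻ w in S, G w * ‖f w‖ₑ ≤ b) :
    ∫⁻ w in S, ‖K q w - K p w‖ₑ * ‖f w‖ₑ ≤ b := by
  have hm := measurable_segmentDeriv hK p q
  have hm1 : Measurable fun s : Sp n₁ n₂ × ℝ => segmentDeriv K p q s.2 s.1 :=
    measurable_swap_uncurry hm
  have hm3 : Measurable fun s : Sp n₁ n₂ × ℝ => segmentDeriv K p q s.2 s.1 * ‖f s.1‖ₑ :=
    hm1.mul (Measurable.comp (g := fun w => ‖f w‖ₑ) hf.enorm measurable_fst)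
  calc ∫⁻ w in S, ‖K q w - K p w‖ₑ * ‖f w‖ₑ
      ≤ ∫⁻ w in S, ∫⁻ t in Set.Ioc (0 : ℝ) 1, segmentDeriv K p q t w * ‖f w‖ₑ := by
        refine lintegral_mono_ae (ae_restrict_of_ae ?_)
        filter_upwards [hdiff] with w hw
        rw [lintegral_mul_const' _ _ enorm_ne_top]
        gcongr
        simp only [segmentDeriv_eq hw]
        exact enorm_sub_le_lintegral_segment hw p q
    _ = ∫⁻ t in Set.Ioc (0 : ℝ) 1, ∫⁻ w in S, segmentDeriv K p q t w * ‖f w‖ₑ := by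
        exact lintegral_lintegral_swap (f := fun w t => segmentDeriv K p q t w * ‖f w‖ₑ)
          hm3.aemeasurable
    _ ≤ ∫⁻ _ in Set.Ioc (0 : ℝ) 1, b := by
        refine setLIntegral_mono' measurableSet_Ioc fun t ht => ?_
        refine hb t ⟨ht.1.le, ht.2⟩ _ hm.of_uncurry_left ?_
        filter_upwards [hdiff] with w hw
        exact segmentDeriv_eq hw p q t
    _ = b := by simp

end Segment

/-! ### Summation over the spectral scales. -/

/-- The length scale `2 ^ (-j / 2)`. -/
def tau (j : ℕ) : ℝ := (2 : ℝ) ^ (-(j : ℝ) / 2)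

theorem tau_pos (j : ℕ) : 0 < tau j := Real.rpow_pos_of_pos two_pos _

theorem tau_le_one (j : ℕ) : tau j ≤ 1 :=
  Real.rpow_le_one_of_one_le_of_nonpos one_le_two (by
    have : (0 : ℝ) ≤ j := Nat.cast_nonneg j
    linarith)

theorem tau_rpow (j : ℕ) (a : ℝ) : tau j ^ a = (2 : ℝ) ^ (-(a / 2) * j) := by
  rw [tau, ← Real.rpow_mul two_pos.le]
  congr 1
  ring

theorem tau_add (j k : ℕ) : tau (j + k) = tau j * (2 : ℝ) ^ (-(1 / 2 : ℝ) * k) := by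
  rw [tau, tau, ← Real.rpow_add two_pos]
  congr 1
  push_cast
  ring

theorem two_pow_eq_tau (j : ℕ) : (2 : ℝ) ^ j = (tau j ^ 2)⁻¹ := by
  rw [← Real.rpow_natCast (tau j), tau_rpow, ← Real.rpow_neg two_pos.le, ← Real.rpow_natCast 2 j]
  congr 1
  push_cast
  ring

theorem exists_tau_le {r : ℝ} (hr : 0 < r) : ∃ j, tau j ≤ r := by
  have h0 : (2 : ℝ) ^ (-(1 / 2 : ℝ)) < 1 :=
    Real.rpow_lt_one_of_one_lt_of_neg one_lt_two (by norm_num)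
  obtain ⟨j, hj⟩ := exists_pow_lt_of_lt_one hr h0
  refine ⟨j, le_of_lt (lt_of_eq_of_lt ?_ hj)⟩
  rw [tau, ← Real.rpow_natCast, ← Real.rpow_mul two_pos.le]
  congr 1
  ring

/-- The weight of the `j`-th piece at scale `r`. -/
def pieceWeight (ε r : ℝ) (j : ℕ) : ℝ≥0∞ :=
  if tau j ≤ r then ENNReal.ofReal ((tau j / r) ^ ε)
  else ENNReal.ofReal (tau j ^ ε) + ENNReal.ofReal (r / tau j)

/-- Split at the first J with τ_J ≤ r. From J on, τ_j/r starts at most at 1 and decays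
geometrically; below J, r/τ_j decays geometrically as j decreases from J - 1, where τ_j > r. The
powers τ_j^ε are summable regardless, so the bound does not depend on r. -/
theorem tsum_pieceWeight_le {ε r : ℝ} (hε : 0 < ε) (hr : 0 < r) :
    ∑' j, pieceWeight ε r j ≤ 2 * geomSum (ε / 2) + geomSum (1 / 2) := by
  set a : ℕ → ℝ≥0∞ := fun j => if tau j ≤ r then ENNReal.ofReal ((tau j / r) ^ ε) else 0
  set b : ℕ → ℝ≥0∞ := fun j => ENNReal.ofReal (tau j ^ ε)
  set d : ℕ → ℝ≥0∞ := fun j => if tau j ≤ r then 0 else ENNReal.ofReal (r / tau j)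
  have hle : ∀ j, pieceWeight ε r j ≤ a j + b j + d j := fun j => by
    simp only [pieceWeight, a, b, d]
    split_ifs
    · rw [add_zero]
      exact le_self_add
    · rw [zero_add]
  have hb : ∑' j, b j = geomSum (ε / 2) := by
    simp only [b, tau_rpow, geomSum]
  set J := Nat.find (exists_tau_le hr)
  have hJ : tau J ≤ r := Nat.find_spec (exists_tau_le hr)
  have hJ' : ∀ j < J, r < tau j := fun j hj => not_le.mp (Nat.find_min (exists_tau_le hr) hj)
  have hJle : ∀ k, tau (k + J) ≤ r * 2 ^ (-(1 / 2 : ℝ) * k) := fun k => by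
    rw [add_comm, tau_add]
    gcongr
  have ha : ∑' j, a j ≤ geomSum (ε / 2) := by
    rw [← ENNReal.summable.sum_add_tsum_nat_add' (k := J), Finset.sum_eq_zero, zero_add, geomSum]
    · refine ENNReal.tsum_le_tsum fun k => ?_
      simp only [a]
      split_ifs
      · refine ENNReal.ofReal_le_ofReal ?_
        have h1 : tau (k + J) / r ≤ 2 ^ (-(1 / 2 : ℝ) * k) := by
          rw [div_le_iff₀ hr, mul_comm]
          exact hJle k
        refine (Real.rpow_le_rpow (div_nonneg (tau_pos _).le hr.le) h1 hε.le).trans (le_of_eq ?_)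
        rw [← Real.rpow_mul two_pos.le]
        congr 1
        ring
      · exact zero_le
    · intro j hj
      exact if_neg (not_le.mpr (hJ' j (Finset.mem_range.mp hj)))
  have hd : ∑' j, d j ≤ geomSum (1 / 2) := by
    have h0 : ∀ j ∉ Finset.range J, d j = 0 := fun j hj => by
      have hj' : J ≤ j := not_lt.mp fun h => hj (Finset.mem_range.mpr h)
      obtain ⟨k, rfl⟩ := Nat.exists_eq_add_of_le' hj'
      refine if_pos ((hJle k).trans (mul_le_of_le_one_right hr.le ?_))
      refine Real.rpow_le_one_of_one_le_of_nonpos one_le_two ?_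
      have : (0 : ℝ) ≤ k := Nat.cast_nonneg k
      linarith
    rw [tsum_eq_sum h0, ← Finset.sum_range_reflect, geomSum]
    refine (Finset.sum_le_sum fun k hk => ?_).trans (ENNReal.sum_le_tsum (Finset.range J))
    have hk' := Finset.mem_range.mp hk
    simp only [d]
    split_ifs
    · exact zero_le
    · refine ENNReal.ofReal_le_ofReal ?_
      have h1 := tau_add (J - 1 - k) k
      rw [Nat.sub_add_cancel (by omega)] at h1
      rw [div_le_iff₀ (tau_pos _), mul_comm, ← h1]
      exact (hJ' (J - 1) (by omega)).le
  calc ∑' j, pieceWeight ε r j ≤ ∑' j, (a j + b j + d j) := ENNReal.tsum_le_tsum hle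
    _ = ∑' j, a j + ∑' j, b j + ∑' j, d j := by rw [ENNReal.tsum_add, ENNReal.tsum_add]
    _ ≤ geomSum (ε / 2) + geomSum (ε / 2) + geomSum (1 / 2) := by
        rw [hb]
        gcongr
    _ = _ := by rw [two_mul]

/-! ### Estimates for single pieces. -/

section Kernel

variable {n₁ n₂ κ : ℕ} {K : ℕ → Sp n₁ n₂ → Sp n₁ n₂ → ℂ} {R₀ : ℝ} {C₀ : ℝ} (hC₀ : 1 < C₀)
  (hquasi : ∀ x y z : Sp n₁ n₂, dist κ x y ≤ C₀ * (dist κ x z + dist κ z y))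

include hC₀ hquasi in
-- This is where the factor 3C₀² is spent: d(c,w) ≥ 3C₀r, so the term C₀ d(c,y) of the
-- quasi-triangle inequality is at most a third of d(c,w) and can be absorbed.
theorem dist_le_of_notMem_ball {s : ℝ} (hs : 3 * C₀ ^ 2 ≤ s) {c y w : Sp n₁ n₂} {r : ℝ}
    (hr : 0 < r) (hy : y ∈ ball κ c r) (hw : w ∉ ball κ c (s * r)) :
    r ≤ dist κ c w ∧ dist κ c w ≤ 2 * C₀ * dist κ y w := by
  have h1 : dist κ c y < r := hy
  have h2 : s * r ≤ dist κ c w := not_lt.mp hw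
  have h3 := hquasi c w y
  have h4 : 3 * C₀ * r ≤ dist κ c w := by
    have h : 3 * C₀ ≤ s := by nlinarith
    exact (mul_le_mul_of_nonneg_right h hr.le).trans h2
  have h5 : C₀ * dist κ c y ≤ C₀ * r := by nlinarith
  refine ⟨by nlinarith, by nlinarith⟩

include hC₀ hquasi in
/-- Estimate of a piece away from the centre through the size condition. -/
theorem exists_lintegral_kernel_outer_le (hK : ∀ j, Measurable (Function.uncurry (K j)))
    (hR₀ : (homDim n₁ n₂ κ : ℝ) / 2 < R₀) (hcond : KernelCondition κ R₀ K) :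
    ∃ C : ℝ≥0∞, C ≠ ∞ ∧ ∀ (f : Sp n₁ n₂ → ℂ), Measurable f → ∀ (x c y : Sp n₁ n₂) (r ρ : ℝ)
      (j : ℕ) (S : Set (Sp n₁ n₂)), 0 < r → r ≤ ρ → tau j ≤ ρ → x ∈ ball κ c r → y ∈ ball κ c r →
      MeasurableSet S → (∀ w ∈ S, ρ ≤ dist κ c w) →
      (∀ w ∈ S, dist κ c w ≤ 2 * C₀ * dist κ y w) →
      ∫⁻ w in S, ‖K j y w‖ₑ * ‖f w‖ₑ ≤
        C * (ENNReal.ofReal ((tau j / ρ) ^ (R₀ - homDim n₁ n₂ κ / 2)) * maximal2 κ f x) := by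
  obtain ⟨C, hC⟩ := hcond
  have hR : 0 ≤ R₀ := le_trans (by positivity) hR₀.le
  refine ⟨outerConst n₁ n₂ κ C₀ R₀ 1 * C + 1,
    ENNReal.add_ne_top.mpr ⟨ENNReal.mul_ne_top (outerConst_ne_top hR₀ _ _) ENNReal.coe_ne_top,
      ENNReal.one_ne_top⟩, ?_⟩
  intro f hf x c y r ρ j S hr hrρ hτρ hx hy hSm hS hS'
  have hτ := tau_pos j
  have hρ : 0 < ρ := hr.trans_le hrρ
  refine le_of_sq_le_mul_sq ?_
  have hE : volume (ball κ y (tau j)) * ∫⁻ w in S, ENNReal.ofReal (dist κ y w ^ (2 * R₀)) *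
      ‖K j y w‖ₑ ^ 2 ≤ ENNReal.ofReal (C * tau j ^ (2 * R₀)) := by
    rw [ENNReal.ofReal_mul C.coe_nonneg, ENNReal.ofReal_coe_nnreal, tau_rpow]
    have h := hC R₀ ⟨hR, le_rfl⟩ j y
    rw [show -(j : ℝ) * R₀ = -(2 * R₀ / 2) * j by ring] at h
    refine le_trans ?_ h
    gcongr
    · exact le_rfl
    · exact Measure.restrict_le_self
  have hy' : dist κ c y ≤ 1 * ρ := by
    have : dist κ c y < r := hy
    linarith
  refine (sq_lintegral_outer_le hC₀ hquasi hR hf hr hrρ hτ hτρ zero_le_one (by positivity) hx hy'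
    hSm hS hS' (hK j).of_uncurry_left.enorm hE).trans (le_of_eq ?_)
  -- The powers balance: τ^{2R₀} from the size condition, (ρ/τ)^Q from changing balls and ρ^{-2R₀}
  -- from the tail.
  have e : (C : ℝ) * tau j ^ (2 * R₀) * (ρ / tau j) ^ homDim n₁ n₂ κ * ρ ^ (-(2 * R₀)) =
      C * ((tau j / ρ) ^ (R₀ - homDim n₁ n₂ κ / 2)) ^ 2 := by
    have e1 : ((tau j / ρ) ^ (R₀ - homDim n₁ n₂ κ / 2)) ^ 2 =
        (tau j / ρ) ^ (2 * R₀) * (tau j / ρ) ^ (-(homDim n₁ n₂ κ : ℝ)) := by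
      rw [← Real.rpow_natCast, ← Real.rpow_mul (by positivity), ← Real.rpow_add (by positivity)]
      congr 1
      push_cast
      ring
    rw [e1, Real.rpow_neg (x := tau j / ρ) (by positivity), Real.rpow_natCast, ← inv_pow, inv_div,
      Real.div_rpow hτ.le hρ.le, Real.rpow_neg hρ.le]
    ring
  rw [e, ENNReal.ofReal_mul C.coe_nonneg, ENNReal.ofReal_coe_nnreal,
    ENNReal.ofReal_pow (by positivity)]
  ring

include hC₀ hquasi in
/-- Estimate of the increment of a piece along a good segment through the gradient condition. -/
theorem exists_lintegral_kernel_segment_le (hK : ∀ j, Measurable (Function.uncurry (K j)))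
    (hdiff : ∀ j, ∀ᵐ y, ContDiff ℝ 1 fun x => K j x y)
    (hR₀ : (homDim n₁ n₂ κ : ℝ) / 2 < R₀) (hgrad : GradientKernelCondition κ R₀ K) :
    ∃ C : ℝ≥0∞, C ≠ ∞ ∧ ∀ (f : Sp n₁ n₂ → ℂ), Measurable f → ∀ (x c y p q : Sp n₁ n₂) (r : ℝ)
      (j : ℕ), 0 < r → r < tau j → x ∈ ball κ c r → y ∈ ball κ c r →
      GoodSegment κ (2 * C₀ * r) y p q →
      ∫⁻ w in ball κ c 1, ‖K j q w - K j p w‖ₑ * ‖f w‖ₑ ≤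
        C * (ENNReal.ofReal (r / tau j) * maximal2 κ f x) := by
  have hC₀' : 0 < C₀ := by linarith
  -- Every point z of the segment satisfies d(c,z) ≤ Br.
  set B : ℝ := C₀ * (1 + (1 + 4 ^ κ) * (2 * C₀)) with hB
  have hB1 : 1 ≤ B := by
    have : (0 : ℝ) ≤ (1 + 4 ^ κ) * (2 * C₀) := by positivity
    nlinarith
  have hB0 : 0 < B := by linarith
  -- Beyond radius Dτ_j about c, the term C₀ d(c,z) ≤ C₀Br is at most half of d(c,w), so distances
  -- from z and from c are comparable.
  set D : ℝ := 2 * C₀ * B with hD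
  have hD1 : 1 ≤ D := by nlinarith
  have hD0 : 0 < D := by linarith
  -- For d(c,w) < 1 and r < 1 one has d(z,w) < C₀(B + 1), so a single gradient constant serves all
  -- segments.
  obtain ⟨C, hC⟩ := hgrad (C₀ * (B + 1)) (by positivity)
  have hR : 0 ≤ R₀ := le_trans (by positivity) hR₀.le
  set L : ℝ := 4 * (4 * n₁) ^ κ * (2 * C₀) ^ 2 with hL
  have hL0 : 0 ≤ L := by positivity
  set Ci : ℝ≥0∞ := ENNReal.ofReal (centreConst n₁ n₂ κ C₀ B) *
    ENNReal.ofReal (L * C * D ^ homDim n₁ n₂ κ) + 1 with hCi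
  set Co : ℝ≥0∞ := outerConst n₁ n₂ κ C₀ R₀ B *
    ENNReal.ofReal (L * C * D ^ homDim n₁ n₂ κ * D ^ (-(2 * R₀))) + 1 with hCo
  have hCit : Ci ≠ ∞ := ENNReal.add_ne_top.mpr
    ⟨ENNReal.mul_ne_top ENNReal.ofReal_ne_top ENNReal.ofReal_ne_top, ENNReal.one_ne_top⟩
  have hCot : Co ≠ ∞ := ENNReal.add_ne_top.mpr
    ⟨ENNReal.mul_ne_top (outerConst_ne_top hR₀ _ _) ENNReal.ofReal_ne_top, ENNReal.one_ne_top⟩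
  refine ⟨Ci + Co, ENNReal.add_ne_top.mpr ⟨hCit, hCot⟩, ?_⟩
  intro f hf x c y p q r j hr hrτ hx hy hseg
  have hτ := tau_pos j
  refine lintegral_sub_mul_le (hK j) (hdiff j) p q hf (ball κ c 1) _ fun t ht G hG hGe => ?_
  obtain ⟨hd, hg⟩ := hseg t ht
  set z := p + t • (q - p) with hz
  have hcy : dist κ c y < r := hy
  have hcz : dist κ c z ≤ B * r := by
    have := hquasi c z y
    rw [hB]
    nlinarith
  have hr1 : r < 1 := hrτ.trans_le (tau_le_one j)
  have hgr : ∀ ex ∈ Set.Icc 0 R₀, ∀ S ⊆ ball κ c 1, volume (ball κ z (tau j)) *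
      ∫⁻ w in S, ENNReal.ofReal (dist κ z w ^ (2 * ex)) * G w ^ 2 ≤
        ENNReal.ofReal (L * r ^ 2 * (C * (tau j ^ (2 * ex) * (tau j ^ 2)⁻¹))) := by
    intro ex hex S hS
    have h := hC ex hex j z
    rw [show -(j : ℝ) * ex = -(2 * ex / 2) * j by ring, ← tau_rpow, two_pow_eq_tau] at h
    rw [ENNReal.ofReal_mul (by positivity), ENNReal.ofReal_mul C.coe_nonneg,
      ENNReal.ofReal_coe_nnreal]
    calc volume (ball κ z (tau j)) * ∫⁻ w in S, ENNReal.ofReal (dist κ z w ^ (2 * ex)) * G w ^ 2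
        ≤ volume (ball κ z (tau j)) * ∫⁻ w in S, ENNReal.ofReal (L * r ^ 2) *
          (ENNReal.ofReal (dist κ z w ^ (2 * ex)) *
            ENNReal.ofReal (gradSq κ (fun x' => K j x' w) z)) := by
          gcongr 1
          refine lintegral_mono_ae (ae_restrict_of_ae ?_)
          filter_upwards [hGe] with w hw
          rw [mul_left_comm]
          gcongr
          rw [hw, ← ofReal_norm, ← ENNReal.ofReal_pow (norm_nonneg _),
            ← ENNReal.ofReal_mul (by positivity)]
          refine ENNReal.ofReal_le_ofReal ((hg _).trans (le_of_eq ?_))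
          rw [hL]
          ring
      _ = ENNReal.ofReal (L * r ^ 2) * (volume (ball κ z (tau j)) * ∫⁻ w in S,
          (ENNReal.ofReal (dist κ z w ^ (2 * ex)) *
            ENNReal.ofReal (gradSq κ (fun x' => K j x' w) z))) := by
          rw [lintegral_const_mul' _ _ ENNReal.ofReal_ne_top]
          ring
      _ ≤ _ := by
          refine mul_le_mul_right (le_trans ?_ h) _
          refine mul_le_mul_right (lintegral_mono_set fun w hw => ?_) _
          have h1 : dist κ c w < 1 := hS hw
          have h2 := hquasi z w c
          rw [dist_comm κ z c] at h2
          show dist κ z w < C₀ * (B + 1)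
          nlinarith
  have hcz' : dist κ c z ≤ B * (D * tau j) := by
    refine hcz.trans ?_
    gcongr
    nlinarith
  have hrD : r ≤ D * tau j := by nlinarith
  have hτD : tau j ≤ D * tau j := le_mul_of_one_le_left hτ.le hD1
  have hdiv : D * tau j / tau j = D := mul_div_cancel_right₀ _ hτ.ne'
  have hsplit : ball κ c 1 ⊆ (ball κ c 1 ∩ ball κ c (D * tau j)) ∪
      (ball κ c 1 \ ball κ c (D * tau j)) := by
    rw [Set.inter_union_sdiff]
  -- At distance up to Dτ_j exponent 0 is enough, and changing balls costs only D^Q; farther out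
  -- exponent R₀ is used.
  have hin : ∫⁻ w in ball κ c 1 ∩ ball κ c (D * tau j), G w * ‖f w‖ₑ ≤
      Ci * (ENNReal.ofReal (r / tau j) * maximal2 κ f x) := by
    refine le_of_sq_le_mul_sq ?_
    have h := hgr 0 ⟨le_rfl, hR⟩ _ (Set.inter_subset_left (t := ball κ c (D * tau j)))
    simp only [mul_zero, Real.rpow_zero, ENNReal.ofReal_one, one_mul] at h
    refine (sq_lintegral_inner_le hC₀ hquasi hf hr hrD hτ hτD hB0.le (by positivity) hx hcz'
      (fun w hw => hw.2) hG h).trans (le_of_eq ?_)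
    rw [hdiv, show L * r ^ 2 * (C * (tau j ^ 2)⁻¹) * D ^ homDim n₁ n₂ κ =
      L * C * D ^ homDim n₁ n₂ κ * (r / tau j) ^ 2 by rw [div_pow]; ring,
      ENNReal.ofReal_mul (by positivity), ENNReal.ofReal_pow (by positivity)]
    ring
  have hout : ∫⁻ w in ball κ c 1 \ ball κ c (D * tau j), G w * ‖f w‖ₑ ≤
      Co * (ENNReal.ofReal (r / tau j) * maximal2 κ f x) := by
    refine le_of_sq_le_mul_sq ?_
    have h := hgr R₀ ⟨hR, le_rfl⟩ _ (Set.sdiff_subset (t := ball κ c (D * tau j)))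
    have hge : ∀ w ∈ ball κ c 1 \ ball κ c (D * tau j), D * tau j ≤ dist κ c w :=
      fun w hw => not_lt.mp hw.2
    have hge' : ∀ w ∈ ball κ c 1 \ ball κ c (D * tau j),
        dist κ c w ≤ 2 * C₀ * dist κ z w := fun w hw => by
      have h1 := hge w hw
      have h2 := hquasi c w z
      have h3 : C₀ * dist κ c z ≤ C₀ * (B * r) := by gcongr
      have h4 : 2 * (C₀ * (B * r)) ≤ D * tau j := by
        rw [hD]
        nlinarith [mul_pos hC₀' hB0]
      nlinarith
    refine (sq_lintegral_outer_le hC₀ hquasi hR hf hr hrD hτ hτD hB0.le (by positivity) hx hcz'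
      ((measurableSet_ball κ c 1).diff (measurableSet_ball κ c _)) hge hge' hG h).trans
      (le_of_eq ?_)
    have hτR : tau j ^ (2 * R₀) * tau j ^ (-(2 * R₀)) = 1 := by
      rw [← Real.rpow_add hτ, add_neg_cancel, Real.rpow_zero]
    rw [hdiv, Real.mul_rpow hD0.le hτ.le, show L * r ^ 2 * (C * (tau j ^ (2 * R₀) *
      (tau j ^ 2)⁻¹)) * D ^ homDim n₁ n₂ κ * (D ^ (-(2 * R₀)) * tau j ^ (-(2 * R₀))) =
      L * C * D ^ homDim n₁ n₂ κ * D ^ (-(2 * R₀)) * (r / tau j) ^ 2 *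
        (tau j ^ (2 * R₀) * tau j ^ (-(2 * R₀))) by rw [div_pow]; ring, hτR, mul_one,
      ENNReal.ofReal_mul (by positivity), ENNReal.ofReal_pow (by positivity)]
    ring
  calc ∫⁻ w in ball κ c 1, G w * ‖f w‖ₑ
      ≤ _ := (lintegral_mono_set hsplit).trans (lintegral_union_le _ _ _)
    _ ≤ _ := add_le_add hin hout
    _ = _ := (add_mul Ci Co _).symm

include hC₀ hquasi in
/-- Estimate of the increment of a piece between two points of a ball. -/
theorem exists_lintegral_kernel_sub_le (hn₁ : 1 ≤ n₁)
    (hK : ∀ j, Measurable (Function.uncurry (K j)))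
    (hdiff : ∀ j, ∀ᵐ y, ContDiff ℝ 1 fun x => K j x y)
    (hR₀ : (homDim n₁ n₂ κ : ℝ) / 2 < R₀) (hcond : KernelCondition κ R₀ K)
    (hgrad : GradientKernelCondition κ R₀ K) {s : ℝ} (hs : 3 * C₀ ^ 2 ≤ s) :
    ∃ C : ℝ≥0∞, C ≠ ∞ ∧ ∀ (f : Sp n₁ n₂ → ℂ), Measurable f → ∀ (x c y z : Sp n₁ n₂) (r : ℝ)
      (j : ℕ), 0 < r → x ∈ ball κ c r → y ∈ ball κ c r → z ∈ ball κ c r →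
      ∫⁻ w in (ball κ c (s * r))ᶜ, ‖K j y w - K j z w‖ₑ * ‖f w‖ₑ ≤
        C * (pieceWeight (R₀ - homDim n₁ n₂ κ / 2) r j * maximal2 κ f x) := by
  obtain ⟨C, hCt, hC⟩ := exists_lintegral_kernel_outer_le hC₀ hquasi hK hR₀ hcond
  obtain ⟨C', hCt', hC'⟩ := exists_lintegral_kernel_segment_le hC₀ hquasi hK hdiff hR₀ hgrad
  refine ⟨2 * C + 3 * C', ENNReal.add_ne_top.mpr ⟨ENNReal.mul_ne_top ENNReal.ofNat_ne_top hCt,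
    ENNReal.mul_ne_top ENNReal.ofNat_ne_top hCt'⟩, ?_⟩
  intro f hf x c y z r j hr hx hy hz
  have hKm : ∀ a, Measurable fun w => K j a w := fun a => (hK j).of_uncurry_left
  have htri : ∀ (S : Set (Sp n₁ n₂)) (a b : Sp n₁ n₂),
      ∫⁻ w in S, ‖K j a w - K j b w‖ₑ * ‖f w‖ₑ ≤
        (∫⁻ w in S, ‖K j a w‖ₑ * ‖f w‖ₑ) + ∫⁻ w in S, ‖K j b w‖ₑ * ‖f w‖ₑ := fun S a b => by
    have hm : Measurable fun w => ‖K j a w‖ₑ * ‖f w‖ₑ := (hKm a).enorm.mul hf.enorm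
    rw [← lintegral_add_left hm]
    refine lintegral_mono fun w => ?_
    rw [← add_mul]
    gcongr
    exact enorm_sub_le
  have hfar : ∀ ρ, r ≤ ρ → tau j ≤ ρ → ∫⁻ w in (ball κ c (s * r))ᶜ ∩ {w | ρ ≤ dist κ c w},
      ‖K j y w - K j z w‖ₑ * ‖f w‖ₑ ≤ 2 * C *
        (ENNReal.ofReal ((tau j / ρ) ^ (R₀ - homDim n₁ n₂ κ / 2)) * maximal2 κ f x) := by
    intro ρ hrρ hτρ
    have hm : MeasurableSet ((ball κ c (s * r))ᶜ ∩ {w | ρ ≤ dist κ c w}) :=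
      (measurableSet_ball κ c _).compl.inter (measurable_dist_right κ c measurableSet_Ici)
    refine (htri _ y z).trans ?_
    rw [two_mul, add_mul]
    exact add_le_add
      (hC f hf x c y r ρ j _ hr hrρ hτρ hx hy hm (fun w hw => hw.2)
        fun w hw => (dist_le_of_notMem_ball hC₀ hquasi hs hr hy hw.1).2)
      (hC f hf x c z r ρ j _ hr hrρ hτρ hx hz hm (fun w hw => hw.2)
        fun w hw => (dist_le_of_notMem_ball hC₀ hquasi hs hr hz hw.1).2)
  rw [pieceWeight]
  split_ifs with h
  · have hsub : (ball κ c (s * r))ᶜ ⊆ (ball κ c (s * r))ᶜ ∩ {w | r ≤ dist κ c w} :=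
      fun w hw => ⟨hw, (dist_le_of_notMem_ball hC₀ hquasi hs hr hy hw).1⟩
    refine (lintegral_mono_set hsub).trans ((hfar r le_rfl h).trans ?_)
    gcongr
    exact le_self_add
  -- Now r < τ_j ≤ 1. The gradient condition is available only at bounded distance, so the region is
  -- cut at d(c,w) = 1: outside, the size estimate with ρ = 1 gives τ_j^ε; inside, the three
  -- segments give r/τ_j.
  · have hrτ := not_le.mp h
    have hr1 : r < 1 := hrτ.trans_le (tau_le_one j)
    have hsub : (ball κ c (s * r))ᶜ ⊆
        ((ball κ c (s * r))ᶜ ∩ {w | 1 ≤ dist κ c w}) ∪ ball κ c 1 := fun w hw => by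
      by_cases h1 : w ∈ ball κ c 1
      · exact Or.inr h1
      · exact Or.inl ⟨hw, (not_lt (α := ℝ)).mp h1⟩
    have hyz : dist κ y z ≤ 2 * C₀ * r := by
      have h1 : dist κ c y < r := hy
      have h2 : dist κ c z < r := hz
      have h3 := hquasi y z c
      rw [dist_comm κ y c] at h3
      nlinarith
    obtain ⟨p, q, g1, g2, g3⟩ := exists_goodSegments κ hn₁ (by positivity) y z hyz
    have hnear : ∫⁻ w in ball κ c 1, ‖K j y w - K j z w‖ₑ * ‖f w‖ₑ ≤
        3 * C' * (ENNReal.ofReal (r / tau j) * maximal2 κ f x) := by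
      have hm : ∀ a b, Measurable fun w => ‖K j a w - K j b w‖ₑ * ‖f w‖ₑ :=
        fun a b => ((hKm a).sub (hKm b)).enorm.mul hf.enorm
      calc ∫⁻ w in ball κ c 1, ‖K j y w - K j z w‖ₑ * ‖f w‖ₑ
          ≤ ∫⁻ w in ball κ c 1, (‖K j p w - K j y w‖ₑ * ‖f w‖ₑ + (‖K j q w - K j p w‖ₑ * ‖f w‖ₑ +
            ‖K j z w - K j q w‖ₑ * ‖f w‖ₑ)) := by
            refine lintegral_mono fun w => ?_
            rw [← add_mul, ← add_mul]
            gcongr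
            have e : K j y w - K j z w = -((K j p w - K j y w) + ((K j q w - K j p w) +
              (K j z w - K j q w))) := by ring
            rw [e, enorm_neg]
            exact (enorm_add_le _ _).trans (by gcongr; exact enorm_add_le _ _)
        _ = _ := by
            rw [lintegral_add_left (hm p y), lintegral_add_left (hm q p)]
        _ ≤ _ := add_le_add (hC' f hf x c y y p r j hr hrτ hx hy g1)
            (add_le_add (hC' f hf x c y p q r j hr hrτ hx hy g2)
              (hC' f hf x c y q z r j hr hrτ hx hy g3))
        _ = _ := by ring
    have hfar1 := hfar 1 hr1.le (tau_le_one j)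
    rw [div_one] at hfar1
    refine (lintegral_mono_set hsub).trans ((lintegral_union_le _ _ _).trans
      ((add_le_add hfar1 hnear).trans ?_))
    rw [add_mul _ _ (maximal2 κ f x), mul_add]
    gcongr
    · exact le_self_add
    · exact le_add_self

end Kernel

/-! ### Assembly of the pieces. -/

section Main

variable {n₁ n₂ κ : ℕ}

/-- Increments of `T F` are controlled by the sum of the increments of the pieces. -/
theorem ae_enorm_sub_le_tsum (hn₂ : 1 ≤ n₂) (hκ : 1 ≤ κ) (p : PotentialType)
    (T : L2 (Sp n₁ n₂) →L[ℂ] L2 (Sp n₁ n₂)) {K : ℕ → Sp n₁ n₂ → Sp n₁ n₂ → ℂ}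
    (hK : ∀ j, IsIntegralKernel (piece p κ T j) (K j)) (F : L2 (Sp n₁ n₂)) :
    ∃ P : Set (Sp n₁ n₂), (∀ᵐ y, y ∈ P) ∧ ∀ y ∈ P, ∀ z ∈ P,
      ‖T F y - T F z‖ₑ ≤ ∑' j, ∫⁻ w, ‖K j y w - K j z w‖ₑ * ‖F w‖ₑ := by
  have hlim : Tendsto (fun N => ∑ j ∈ Finset.range (N + 1), piece p κ T j F) atTop (𝓝 (T F)) := by
    have := (T.continuous.tendsto F).comp (tendsto_sum_spectralProjection hn₂ hκ p F)
    refine this.congr fun N => ?_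
    simp only [Function.comp, map_sum]
    rfl
  -- Almost everywhere convergence along a subsequence suffices, since the full series of absolute
  -- increments dominates every partial sum.
  obtain ⟨ns, -, hns⟩ := (tendstoInMeasure_of_tendsto_Lp hlim).exists_seq_tendsto_ae
  have hsum : ∀ᵐ y, ∀ N, (∑ j ∈ Finset.range (N + 1), piece p κ T j F : L2 (Sp n₁ n₂)) y =
      ∑ j ∈ Finset.range (N + 1), piece p κ T j F y := by
    refine ae_all_iff.mpr fun N => ?_
    filter_upwards [Lp.coeFn_finsetSum (Finset.range (N + 1)) fun j => piece p κ T j F] with y hy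
    rw [hy, Finset.sum_apply]
  have hker := ae_all_iff.mpr fun j => (hK j).2 F
  refine ⟨{y | Tendsto (fun i => ∑ j ∈ Finset.range (ns i + 1), ∫ w, K j y w * F w) atTop
      (𝓝 (T F y)) ∧ ∀ j, Integrable fun w => K j y w * F w}, ?_, ?_⟩
  · filter_upwards [hns, hsum, hker] with y h1 h2 h3
    refine ⟨h1.congr fun i => ?_, fun j => (h3 j).1⟩
    rw [h2]
    exact Finset.sum_congr rfl fun j _ => (h3 j).2
  · rintro y ⟨hy, hyi⟩ z ⟨hz, hzi⟩
    refine le_of_tendsto (hy.sub hz).enorm (Eventually.of_forall fun i => ?_)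
    rw [← Finset.sum_sub_distrib]
    refine (enorm_sum_le _ _).trans (le_trans (Finset.sum_le_sum fun j _ => ?_)
      (ENNReal.sum_le_tsum _))
    rw [← integral_sub (hyi j) (hzi j)]
    refine (enorm_integral_le_lintegral_enorm _).trans (le_of_eq (lintegral_congr fun w => ?_))
    rw [← sub_mul, enorm_mul]

/-- The bound holds at every x: the exceptional null set concerns only y and z, and the essential
supremum ignores it. Square integrability of f ensures that `toL2` returns the class of the
truncated function and not its default 0. -/
theorem grandMaximal_le (hn₁ : 1 ≤ n₁) (hn₂ : 1 ≤ n₂) (hκ : 1 ≤ κ) (p : PotentialType)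
    (T : L2 (Sp n₁ n₂) →L[ℂ] L2 (Sp n₁ n₂)) {K : ℕ → Sp n₁ n₂ → Sp n₁ n₂ → ℂ}
    (hK : ∀ j, IsIntegralKernel (piece p κ T j) (K j))
    (hdiff : ∀ j, ∀ᵐ y, ContDiff ℝ 1 fun x => K j x y) {R₀ : ℝ}
    (hR₀ : (homDim n₁ n₂ κ : ℝ) / 2 < R₀) (hcond : KernelCondition κ R₀ K)
    (hgrad : GradientKernelCondition κ R₀ K) {C₀ : ℝ} (hC₀ : 1 < C₀)
    (hquasi : ∀ x y z : Sp n₁ n₂, dist κ x y ≤ C₀ * (dist κ x z + dist κ z y))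
    {s : ℝ} (hs : 3 * C₀ ^ 2 ≤ s) :
    ∃ C : ℝ≥0, ∀ f : Sp n₁ n₂ → ℂ, Measurable f → MemLp f 2 (volume : Measure (Sp n₁ n₂)) →
      ∀ x, grandMaximal κ T s f x ≤ C * maximal2 κ f x := by
  set ε := R₀ - homDim n₁ n₂ κ / 2
  have hε : 0 < ε := sub_pos.mpr hR₀
  obtain ⟨C, hCt, hC⟩ := exists_lintegral_kernel_sub_le hC₀ hquasi hn₁ (fun j => (hK j).1) hdiff
    hR₀ hcond hgrad hs
  set W := 2 * geomSum (ε / 2) + geomSum (1 / 2)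
  have hW : W ≠ ∞ := ENNReal.add_ne_top.mpr ⟨ENNReal.mul_ne_top ENNReal.ofNat_ne_top
    (geomSum_ne_top (by positivity)), geomSum_ne_top (by norm_num)⟩
  have hCW : C * W ≠ ∞ := ENNReal.mul_ne_top hCt hW
  refine ⟨(C * W).toNNReal, fun f hf hfL x => ?_⟩
  rw [ENNReal.coe_toNNReal hCW, grandMaximal]
  refine iSup_le fun c => iSup_le fun r => iSup_le fun hr => iSup_le fun hx => ?_
  set S := (ball κ c (s * r))ᶜ
  have hSm : MeasurableSet S := (measurableSet_ball κ c _).compl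
  have hFL : MemLp (S.indicator f) 2 (volume : Measure (Sp n₁ n₂)) := hfL.indicator hSm
  have hF : toL2 (S.indicator f) =ᵐ[volume] S.indicator f := by
    rw [toL2, dif_pos hFL]
    exact hFL.coeFn_toLp
  set F := toL2 (S.indicator f)
  obtain ⟨P, hP, hPle⟩ := ae_enorm_sub_le_tsum hn₂ hκ p T hK F
  have hmem : ∀ᵐ y ∂(volume.restrict (ball κ c r)), y ∈ P ∧ y ∈ ball κ c r :=
    (ae_restrict_of_ae hP).and (ae_restrict_mem (measurableSet_ball κ c r))
  refine essSup_le_of_ae_le _ ?_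
  filter_upwards [Measure.quasiMeasurePreserving_fst.ae hmem,
    Measure.quasiMeasurePreserving_snd.ae hmem] with q h1 h2
  refine (hPle _ h1.1 _ h2.1).trans ?_
  calc ∑' j, ∫⁻ w, ‖K j q.1 w - K j q.2 w‖ₑ * ‖F w‖ₑ
      = ∑' j, ∫⁻ w in S, ‖K j q.1 w - K j q.2 w‖ₑ * ‖f w‖ₑ := by
        refine tsum_congr fun j => ?_
        rw [← lintegral_indicator hSm]
        refine lintegral_congr_ae ?_
        filter_upwards [hF] with w hw
        rw [hw]
        by_cases hwS : w ∈ S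
        · rw [Set.indicator_of_mem hwS, Set.indicator_of_mem hwS]
        · rw [Set.indicator_of_notMem hwS, Set.indicator_of_notMem hwS, enorm_zero, mul_zero]
    _ ≤ ∑' j, C * (pieceWeight ε r j * maximal2 κ f x) :=
        ENNReal.tsum_le_tsum fun j => hC f hf x c q.1 q.2 r j hr hx h1.2 h2.2
    _ = C * ((∑' j, pieceWeight ε r j) * maximal2 κ f x) := by
        rw [ENNReal.tsum_mul_left, ENNReal.tsum_mul_right]
    _ ≤ C * (W * maximal2 κ f x) := by
        gcongr
        exact tsum_pieceWeight_le hε hr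
    _ = _ := (mul_assoc _ _ _).symm

end Main

end Grushin

end

theorem mainTheorem6 (n₁ n₂ κ : ℕ) (hn₁ : 1 ≤ n₁) (hn₂ : 1 ≤ n₂) (hκ : 1 ≤ κ)
    (p : Grushin.PotentialType)
    (T : Grushin.L2 (Grushin.Sp n₁ n₂) →L[ℂ] Grushin.L2 (Grushin.Sp n₁ n₂))
    (K : ℕ → Grushin.Sp n₁ n₂ → Grushin.Sp n₁ n₂ → ℂ)
    (hK : ∀ j, Grushin.IsIntegralKernel (Grushin.piece p κ T j) (K j))
    (hdiff : ∀ j, ∀ᵐ y, ContDiff ℝ 1 (fun x => K j x y))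
    (R₀ : ℝ) (hR₀ : (Grushin.homDim n₁ n₂ κ : ℝ) / 2 < R₀)
    (hcond : Grushin.KernelCondition κ R₀ K)
    (hgrad : Grushin.GradientKernelCondition κ R₀ K)
    (C₀ : ℝ) (hC₀ : 1 < C₀)
    (hquasi : ∀ x y z : Grushin.Sp n₁ n₂,
      Grushin.dist κ x y ≤ C₀ * (Grushin.dist κ x z + Grushin.dist κ z y))
    (C₁ : ℝ) (hC₁ : 1 ≤ C₁) (δ₀ : ℝ) (hδ₀ : 0 < δ₀) (hδ₀' : δ₀ < 1)
    (s : ℝ) (hs : s = 3 * C₁ * C₀ ^ 2 / δ₀) :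
    ∃ C : ℝ≥0, ∀ f : Grushin.Sp n₁ n₂ → ℂ,
      Measurable f → (∃ M : ℝ, ∀ x, ‖f x‖ ≤ M) → HasCompactSupport f →
        ∀ᵐ x, Grushin.grandMaximal κ T s f x ≤ C * Grushin.maximal2 κ f x := by
  -- C₁ ≥ 1 and δ₀ < 1 enter only through this lower bound for the dilation factor.
  have hs' : 3 * C₀ ^ 2 ≤ s := by
    rw [hs, le_div_iff₀ hδ₀]
    nlinarith [mul_nonneg (sq_nonneg C₀) (sub_nonneg.mpr hδ₀'.le),
      mul_nonneg (sq_nonneg C₀) (sub_nonneg.mpr hC₁)]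
  obtain ⟨C, hC⟩ := Grushin.grandMaximal_le hn₁ hn₂ hκ p T hK hdiff hR₀ hcond hgrad hC₀ hquasi hs'
  refine ⟨C, fun f hf ⟨M, hM⟩ hfc => Filter.Eventually.of_forall (hC f hf ?_)⟩
  exact hfc.memLp_of_bound hf.aestronglyMeasurable M (Filter.Eventually.of_forall hM)
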